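/- Let $F:\mathbb{R}\to\mathbb{R}$ be a smooth, negative, $1$-periodic, even function with $F'(0)=F'(\pm\frac12)=0$. Put $$\Pi=\{\xi\in\mathbb{R}^2:\ -\tfrac12<\xi_1<\tfrac12,\ \xi_2>F(\xi_1)\},\qquad \Gamma=\{\xi\in\mathbb{R}^2:\ -\tfrac12<\xi_1<\tfrac12,\ \xi_2=F(\xi_1)\}.$$ Let $X$ be the solution of $$\Delta X=0\ \text{in }\Pi,\qquad X=0\ \text{on }\Gamma,\qquad \frac{\partial X}{\partial\xi_1}=0\ \text{for }\xi_1=\pm\tfrac12,\qquad X\sim\xi_2\ \text{as }\xi_2\to+\infty,$$ and let $\widetilde X$ be the solution of $$\Delta\widetilde X=\frac{\partial X}{\partial\xi_1}\ \text{in }\Pi,\qquad \widetilde X=0\ \text{on }\partial\Pi,$$ that is exponentially small as $\xi_2\to+\infty$, i.e. $\widetilde X(\xi)=O(e^{-\varsigma\xi_2})$ uniformly in $\xi_1$ for some $\varsigma>0$. Solutions are smooth in $\Pi$, where the equation holds pointwise, and have square integrable values and first derivatives on $\Pi\cap\{\xi_2<R\}$ for every $R$; Dirichlet conditions are understood in the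 sense of traces, and Neumann conditions on the lateral sides in the variational sense. Then there is a constant $C_{(I)}(F)$, depending only on $F$, such that the problem $$\Delta Y=\frac{\partial\widetilde X}{\partial\xi_1}\ \text{in }\Pi,\qquad Y=0\ \text{on }\Gamma,\qquad \frac{\partial Y}{\partial\xi_1}=0\ \text{for }\xi_1=\pm\tfrac12$$ has a solution $Y$ with $Y=C_{(I)}(F)$ as $\xi_2\to+\infty$ up to exponentially small terms: there is $\varsigma>0$ such that for every $\delta>0$ and every $\alpha\in\mathbb{N}^2$ there is a constant $C_{\delta,\alpha}$ with $$\bigl|\partial^\alpha\bigl(Y-C_{(I)}(F)\bigr)(\xi)\bigr|\le C_{\delta,\alpha}\,e^{-\varsigma\xi_2}\qquad\text{for all }\xi\in\Pi\text{ with }\xi_2\ge\delta.$$ -/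

import Mathlib

namespace CellStrip

open scoped ContDiff
open MeasureTheory Filter Asymptotics

/-- Admissible boundary profiles: smooth, negative, `1`-periodic, even functions whose derivative
vanishes at `0` and `±1/2`. -/
structure IsProfile (F : ℝ → ℝ) : Prop where
  smooth : ContDiff ℝ ∞ F
  neg : ∀ t, F t < 0
  periodic : Function.Periodic F 1
  even : Function.Even F
  deriv_zero : deriv F 0 = 0
  deriv_half : deriv F (1 / 2) = 0
  deriv_neg_half : deriv F (-(1 / 2)) = 0

/-- The open vertical strip `-1/2 < ξ₁ < 1/2`. -/
def openStrip : Set (ℝ × ℝ) := {ξ | -(1 / 2) < ξ.1 ∧ ξ.1 < 1 / 2}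

/-- The open region above the graph of the profile `F`. -/
def aboveGraph (F : ℝ → ℝ) : Set (ℝ × ℝ) := {ξ | F ξ.1 < ξ.2}

/-- The semi-infinite cell `Π = {-1/2 < ξ₁ < 1/2, ξ₂ > F(ξ₁)}`. -/
def cell (F : ℝ → ℝ) : Set (ℝ × ℝ) := openStrip ∩ aboveGraph F

/-- The partial derivative `∂u/∂ξ₁`. -/
noncomputable def d1 (u : ℝ × ℝ → ℝ) : ℝ × ℝ → ℝ :=
  fun ξ => deriv (fun t => u (t, ξ.2)) ξ.1

/-- The partial derivative `∂u/∂ξ₂`. -/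
noncomputable def d2 (u : ℝ × ℝ → ℝ) : ℝ × ℝ → ℝ :=
  fun ξ => deriv (fun t => u (ξ.1, t)) ξ.2

/-- The Laplacian `∂²u/∂ξ₁² + ∂²u/∂ξ₂²`. -/
noncomputable def lap (u : ℝ × ℝ → ℝ) : ℝ × ℝ → ℝ :=
  fun ξ => d1 (d1 u) ξ + d2 (d2 u) ξ

/-- Smooth functions on the plane with compact support contained in `S`. -/
structure IsTest (S : Set (ℝ × ℝ)) (φ : ℝ × ℝ → ℝ) : Prop where
  smooth : ContDiff ℝ ∞ φ
  compact : HasCompactSupport φ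
  supp : tsupport φ ⊆ S

/-- `u` and its first derivatives are square integrable on every bounded part
`{ξ ∈ Π, ξ₂ < R}` of the cell. -/
def LocallyH1 (F : ℝ → ℝ) (u : ℝ × ℝ → ℝ) : Prop :=
  ∀ R : ℝ,
    MemLp u 2 (volume.restrict (cell F ∩ {ξ | ξ.2 < R})) ∧
    MemLp (d1 u) 2 (volume.restrict (cell F ∩ {ξ | ξ.2 < R})) ∧
    MemLp (d2 u) 2 (volume.restrict (cell F ∩ {ξ | ξ.2 < R}))

/-- The trace of `u` vanishes on the part of the boundary of the cell that lies in the open set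
`S`: inside `S`, the extension of `u` by zero outside of the cell has as weak gradient the
extension by zero of the gradient of `u`. By Green's formula this says that
`∫ u φ νⱼ ds = 0` over `S ∩ ∂Π` for all test functions `φ` supported in `S`.
For `S` the open strip this is `u = 0` on the curved bottom `Γ`;
for `S` the whole plane this is `u = 0` on `∂Π`. -/
def ZeroTraceIn (F : ℝ → ℝ) (S : Set (ℝ × ℝ)) (u : ℝ × ℝ → ℝ) : Prop :=
  ∀ φ : ℝ × ℝ → ℝ, IsTest S φ →
    ∫ ξ in cell F, u ξ * d1 φ ξ = -∫ ξ in cell F, d1 u ξ * φ ξ ∧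
    ∫ ξ in cell F, u ξ * d2 φ ξ = -∫ ξ in cell F, d2 u ξ * φ ξ

/-- `u` solves `Δu = f` in `Π`, `u = 0` on `Γ`, `∂u/∂ξ₁ = 0` for `ξ₁ = ±1/2`. The equation holds
pointwise, the condition on `Γ` in the sense of traces; the condition on the lateral sides is the
natural one of the variational identity, whose test functions need not vanish there. -/
structure IsMixedSolution (F : ℝ → ℝ) (f u : ℝ × ℝ → ℝ) : Prop where
  smooth : ContDiffOn ℝ ∞ u (cell F)
  locallyH1 : LocallyH1 F u
  equation : ∀ ξ ∈ cell F, lap u ξ = f ξ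
  bottom : ZeroTraceIn F openStrip u
  variational : ∀ φ : ℝ × ℝ → ℝ, IsTest (aboveGraph F) φ →
    ∫ ξ in cell F, (d1 u ξ * d1 φ ξ + d2 u ξ * d2 φ ξ) = -∫ ξ in cell F, f ξ * φ ξ

/-- `u` solves `Δu = f` in `Π`, `u = 0` on `∂Π`. -/
structure IsDirichletSolution (F : ℝ → ℝ) (f u : ℝ × ℝ → ℝ) : Prop where
  smooth : ContDiffOn ℝ ∞ u (cell F)
  locallyH1 : LocallyH1 F u
  equation : ∀ ξ ∈ cell F, lap u ξ = f ξ
  boundary : ZeroTraceIn F Set.univ u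

/-- The filter `ξ₂ → +∞` in `Π` (uniformly in `ξ₁`). -/
def atInfty (F : ℝ → ℝ) : Filter (ℝ × ℝ) := comap Prod.snd atTop ⊓ 𝓟 (cell F)

/-- The function `X`: harmonic in `Π`, zero on `Γ`, with zero `ξ₁`-derivative on the lateral
sides, and `X ∼ ξ₂` as `ξ₂ → +∞`. -/
def IsX (F : ℝ → ℝ) (X : ℝ × ℝ → ℝ) : Prop :=
  IsMixedSolution F (fun _ => 0) X ∧ X ~[atInfty F] (fun ξ => ξ.2)

/-- The function `X̃` belonging to `X`: `ΔX̃ = ∂X/∂ξ₁` in `Π`, `X̃ = 0` on `∂Π`, exponentially small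
as `ξ₂ → +∞`. -/
def IsXtilde (F : ℝ → ℝ) (X Xt : ℝ × ℝ → ℝ) : Prop :=
  IsDirichletSolution F (d1 X) Xt ∧
    ∃ ς : ℝ, 0 < ς ∧ Xt =O[atInfty F] (fun ξ => Real.exp (-ς * ξ.2))

/-- `u = c` as `ξ₂ → +∞` up to exponentially small terms: for one rate `ς > 0`, every partial
derivative of `u - c`, of every order, is `O(exp(-ς ξ₂))` on `{ξ ∈ Π, ξ₂ ≥ δ}` for every
`δ > 0`. -/
def EqUpToExp (F : ℝ → ℝ) (u : ℝ × ℝ → ℝ) (c : ℝ) : Prop :=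
  ∃ ς : ℝ, 0 < ς ∧ ∀ δ : ℝ, 0 < δ → ∀ i j : ℕ, ∃ K : ℝ, ∀ ξ ∈ cell F, δ ≤ ξ.2 →
    |(d1^[i] (d2^[j] (fun η => u η - c))) ξ| ≤ K * Real.exp (-ς * ξ.2)

end CellStrip

/-! Since `F < 0`, the half-strip `ξ₂ > 0` lies in the cell, and there every function involved can
be expanded along the cross section.

Put `κ = nπ`. Tested against `cos κ(ξ₁ + 1/2)`, the function `X` has coefficients that solve `g'' =
κ²g` weakly. The condition `X ∼ ξ₂` excludes `exp(κt)`, so `X = A + ξ₂` plus a series with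
coefficients `aₙ exp(-κt)` (`IsX.expansion`). Tested against `sin κ(ξ₁ + 1/2)`, the function `X̃`
satisfies `g'' - κ²g = -κ aₙ exp(-κt)`, which gives coefficients `(bₙ + aₙt/2) exp(-κt)`
(`IsXtilde.expansion`). In particular `∂X̃/∂ξ₁` decays exponentially.

A solution `Y` then comes from Lax–Milgram in the completion of the test functions for the Dirichlet
energy. Hardy's inequality with the weight `1/(ξ₂ + c)` makes the form coercive (`hardy_inequality`,
`exists_mem_closure_of_coercive`), and Weyl's lemma makes the variational solution smooth
(`exists_contDiffOn_ae_eq`, `exists_isMixedSolution`). Its cosine coefficients of order `n ≠ 0` are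
quadratic polynomials times `exp(-κt)`. In order `0` the right-hand side drops out, because `X̃`
vanishes on both lateral sides, so this coefficient is affine; integrability of `Y/(ξ₂ + c)²`
forbids a linear term. What remains is the constant `C` (`IsMixedSolution.expansion_of_isXtilde`).

All derivatives are controlled at once through `q = exp(iπ(ξ₁ + 1/2 + iξ₂))`. The remainders are
finite sums of `ξ₂^k Re f(q)` with `f` holomorphic in the unit disc and `f(0) = 0`. This class is
closed under `∂/∂ξ₁` and `∂/∂ξ₂`, and each member is `O(exp(-ξ₂))` on `ξ₂ ≥ δ` (`IsDecaying`).

The constant depends on `F` only because `X` and `X̃` are unique. The expansions make the difference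
of two solutions bounded at infinity, and a Caccioppoli estimate bounds its energy below height `R`
by `const/R`, so it is constant, and the zero trace makes it zero (`eq_zero_of_energy`). Using the
difference itself as a test function requires approximating it by smooth admissible functions: it is
dilated in `ξ₁`, lifted off the bottom and mollified (`HasApproxShear`,
`integral_eq_zero_of_forall_test`). -/

namespace CellStrip

open scoped ContDiff Topology
open MeasureTheory Filter Asymptotics Set

/-! ### Calculus of the partial derivatives and the Laplacian. -/

section Partial

variable {u v : ℝ × ℝ → ℝ} {ξ : ℝ × ℝ} {U : Set (ℝ × ℝ)}

theorem hasDerivAt_d1 (h : DifferentiableAt ℝ u ξ) :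
    HasDerivAt (fun t => u (t, ξ.2)) (d1 u ξ) ξ.1 := by
  have h1 : HasDerivAt (fun t : ℝ => (t, ξ.2)) ((1 : ℝ), (0 : ℝ)) ξ.1 :=
    (hasDerivAt_id _).prodMk (hasDerivAt_const _ _)
  exact (HasFDerivAt.comp_hasDerivAt (f := fun t : ℝ => (t, ξ.2)) ξ.1
    (show HasFDerivAt u _ (ξ.1, ξ.2) from h.hasFDerivAt) h1).differentiableAt.hasDerivAt

theorem hasDerivAt_d2 (h : DifferentiableAt ℝ u ξ) :
    HasDerivAt (fun t => u (ξ.1, t)) (d2 u ξ) ξ.2 := by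
  have h1 : HasDerivAt (fun t : ℝ => (ξ.1, t)) ((0 : ℝ), (1 : ℝ)) ξ.2 :=
    (hasDerivAt_const _ _).prodMk (hasDerivAt_id _)
  exact (HasFDerivAt.comp_hasDerivAt (f := fun t : ℝ => (ξ.1, t)) ξ.2
    (show HasFDerivAt u _ (ξ.1, ξ.2) from h.hasFDerivAt) h1).differentiableAt.hasDerivAt

theorem d1_eq_of_hasFDerivAt {L : ℝ × ℝ →L[ℝ] ℝ} (h : HasFDerivAt u L ξ) :
    d1 u ξ = L (1, 0) := by
  have h1 : HasDerivAt (fun t : ℝ => (t, ξ.2)) ((1 : ℝ), (0 : ℝ)) ξ.1 :=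
    (hasDerivAt_id _).prodMk (hasDerivAt_const _ _)
  exact (HasFDerivAt.comp_hasDerivAt (f := fun t : ℝ => (t, ξ.2)) ξ.1
    (show HasFDerivAt u _ (ξ.1, ξ.2) from h) h1).deriv

theorem d2_eq_of_hasFDerivAt {L : ℝ × ℝ →L[ℝ] ℝ} (h : HasFDerivAt u L ξ) :
    d2 u ξ = L (0, 1) := by
  have h1 : HasDerivAt (fun t : ℝ => (ξ.1, t)) ((0 : ℝ), (1 : ℝ)) ξ.2 :=
    (hasDerivAt_const _ _).prodMk (hasDerivAt_id _)
  exact (HasFDerivAt.comp_hasDerivAt (f := fun t : ℝ => (ξ.1, t)) ξ.2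
    (show HasFDerivAt u _ (ξ.1, ξ.2) from h) h1).deriv

theorem d1_eq_fderiv (h : DifferentiableAt ℝ u ξ) : d1 u ξ = fderiv ℝ u ξ (1, 0) :=
  d1_eq_of_hasFDerivAt h.hasFDerivAt

theorem d2_eq_fderiv (h : DifferentiableAt ℝ u ξ) : d2 u ξ = fderiv ℝ u ξ (0, 1) :=
  d2_eq_of_hasFDerivAt h.hasFDerivAt

theorem d1_congr (h : u =ᶠ[𝓝 ξ] v) : d1 u ξ = d1 v ξ := by
  refine Filter.EventuallyEq.deriv_eq ?_
  have hc : Tendsto (fun t : ℝ => (t, ξ.2)) (𝓝 ξ.1) (𝓝 ξ) :=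
    (Continuous.prodMk continuous_id continuous_const).tendsto' _ _ rfl
  exact hc.eventually h

theorem d2_congr (h : u =ᶠ[𝓝 ξ] v) : d2 u ξ = d2 v ξ := by
  refine Filter.EventuallyEq.deriv_eq ?_
  have hc : Tendsto (fun t : ℝ => (ξ.1, t)) (𝓝 ξ.2) (𝓝 ξ) :=
    (Continuous.prodMk continuous_const continuous_id).tendsto' _ _ rfl
  exact hc.eventually h

theorem d1_eventuallyEq (h : u =ᶠ[𝓝 ξ] v) : d1 u =ᶠ[𝓝 ξ] d1 v :=
  h.eventually_nhds.mono fun _ => d1_congr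

theorem d2_eventuallyEq (h : u =ᶠ[𝓝 ξ] v) : d2 u =ᶠ[𝓝 ξ] d2 v :=
  h.eventually_nhds.mono fun _ => d2_congr

theorem eqOn_d1 (hU : IsOpen U) (h : EqOn u v U) : EqOn (d1 u) (d1 v) U := fun _ hx =>
  d1_congr (h.eventuallyEq_of_mem (hU.mem_nhds hx))

theorem eqOn_d2 (hU : IsOpen U) (h : EqOn u v U) : EqOn (d2 u) (d2 v) U := fun _ hx =>
  d2_congr (h.eventuallyEq_of_mem (hU.mem_nhds hx))

theorem differentiableAt_of_contDiffOn (hU : IsOpen U) (h : ContDiffOn ℝ ∞ u U) (hx : ξ ∈ U) :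
    DifferentiableAt ℝ u ξ :=
  ((h ξ hx).contDiffAt (hU.mem_nhds hx)).differentiableAt (by simp)

theorem contDiffOn_d1 (hU : IsOpen U) (h : ContDiffOn ℝ ∞ u U) : ContDiffOn ℝ ∞ (d1 u) U := by
  have h1 : ContDiffOn ℝ ∞ (fun ξ => fderiv ℝ u ξ (1, 0)) U :=
    (h.fderiv_of_isOpen hU (by simp)).clm_apply contDiffOn_const
  exact h1.congr fun x hx => d1_eq_fderiv (differentiableAt_of_contDiffOn hU h hx)

theorem contDiffOn_d2 (hU : IsOpen U) (h : ContDiffOn ℝ ∞ u U) : ContDiffOn ℝ ∞ (d2 u) U := by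
  have h1 : ContDiffOn ℝ ∞ (fun ξ => fderiv ℝ u ξ (0, 1)) U :=
    (h.fderiv_of_isOpen hU (by simp)).clm_apply contDiffOn_const
  exact h1.congr fun x hx => d2_eq_fderiv (differentiableAt_of_contDiffOn hU h hx)

theorem contDiff_d1 (h : ContDiff ℝ ∞ u) : ContDiff ℝ ∞ (d1 u) :=
  contDiffOn_univ.1 (contDiffOn_d1 isOpen_univ h.contDiffOn)

theorem contDiff_d2 (h : ContDiff ℝ ∞ u) : ContDiff ℝ ∞ (d2 u) :=
  contDiffOn_univ.1 (contDiffOn_d2 isOpen_univ h.contDiffOn)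

theorem contDiffOn_lap (hU : IsOpen U) (h : ContDiffOn ℝ ∞ u U) : ContDiffOn ℝ ∞ (lap u) U :=
  (contDiffOn_d1 hU (contDiffOn_d1 hU h)).add (contDiffOn_d2 hU (contDiffOn_d2 hU h))

theorem d1_add (hu : DifferentiableAt ℝ u ξ) (hv : DifferentiableAt ℝ v ξ) :
    d1 (fun x => u x + v x) ξ = d1 u ξ + d1 v ξ :=
  ((hasDerivAt_d1 hu).add (hasDerivAt_d1 hv)).deriv

theorem d2_add (hu : DifferentiableAt ℝ u ξ) (hv : DifferentiableAt ℝ v ξ) :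
    d2 (fun x => u x + v x) ξ = d2 u ξ + d2 v ξ :=
  ((hasDerivAt_d2 hu).add (hasDerivAt_d2 hv)).deriv

theorem d1_sub (hu : DifferentiableAt ℝ u ξ) (hv : DifferentiableAt ℝ v ξ) :
    d1 (fun x => u x - v x) ξ = d1 u ξ - d1 v ξ :=
  ((hasDerivAt_d1 hu).sub (hasDerivAt_d1 hv)).deriv

theorem d2_sub (hu : DifferentiableAt ℝ u ξ) (hv : DifferentiableAt ℝ v ξ) :
    d2 (fun x => u x - v x) ξ = d2 u ξ - d2 v ξ :=
  ((hasDerivAt_d2 hu).sub (hasDerivAt_d2 hv)).deriv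

theorem d1_mul (hu : DifferentiableAt ℝ u ξ) (hv : DifferentiableAt ℝ v ξ) :
    d1 (fun x => u x * v x) ξ = d1 u ξ * v ξ + u ξ * d1 v ξ :=
  ((hasDerivAt_d1 hu).mul (hasDerivAt_d1 hv)).deriv

theorem d2_mul (hu : DifferentiableAt ℝ u ξ) (hv : DifferentiableAt ℝ v ξ) :
    d2 (fun x => u x * v x) ξ = d2 u ξ * v ξ + u ξ * d2 v ξ :=
  ((hasDerivAt_d2 hu).mul (hasDerivAt_d2 hv)).deriv

theorem d1_const_mul (c : ℝ) (u : ℝ × ℝ → ℝ) (ξ : ℝ × ℝ) :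
    d1 (fun x => c * u x) ξ = c * d1 u ξ := by
  simp [d1]

theorem d2_const_mul (c : ℝ) (u : ℝ × ℝ → ℝ) (ξ : ℝ × ℝ) :
    d2 (fun x => c * u x) ξ = c * d2 u ξ := by
  simp [d2]

theorem lap_add (hU : IsOpen U) (hu : ContDiffOn ℝ ∞ u U) (hv : ContDiffOn ℝ ∞ v U) (hx : ξ ∈ U) :
    lap (fun x => u x + v x) ξ = lap u ξ + lap v ξ := by
  have du := fun {x} (hx : x ∈ U) => differentiableAt_of_contDiffOn hU hu hx
  have dv := fun {x} (hx : x ∈ U) => differentiableAt_of_contDiffOn hU hv hx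
  have e1 : EqOn (d1 fun x => u x + v x) (fun x => d1 u x + d1 v x) U := fun x hx =>
    d1_add (du hx) (dv hx)
  have e2 : EqOn (d2 fun x => u x + v x) (fun x => d2 u x + d2 v x) U := fun x hx =>
    d2_add (du hx) (dv hx)
  have d1u := differentiableAt_of_contDiffOn hU (contDiffOn_d1 hU hu) hx
  have d1v := differentiableAt_of_contDiffOn hU (contDiffOn_d1 hU hv) hx
  have d2u := differentiableAt_of_contDiffOn hU (contDiffOn_d2 hU hu) hx
  have d2v := differentiableAt_of_contDiffOn hU (contDiffOn_d2 hU hv) hx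
  simp only [lap]
  rw [eqOn_d1 hU e1 hx, eqOn_d2 hU e2 hx, d1_add d1u d1v, d2_add d2u d2v]
  ring

theorem lap_const_mul (c : ℝ) (u : ℝ × ℝ → ℝ) (ξ : ℝ × ℝ) :
    lap (fun x => c * u x) ξ = c * lap u ξ := by
  have e1 : d1 (fun x => c * u x) = fun x => c * d1 u x := funext (d1_const_mul c u)
  have e2 : d2 (fun x => c * u x) = fun x => c * d2 u x := funext (d2_const_mul c u)
  simp only [lap, e1, e2, d1_const_mul, d2_const_mul]
  ring

theorem lap_sub (hU : IsOpen U) (hu : ContDiffOn ℝ ∞ u U) (hv : ContDiffOn ℝ ∞ v U) (hx : ξ ∈ U) :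
    lap (fun x => u x - v x) ξ = lap u ξ - lap v ξ := by
  have := lap_add hU hu (v := fun x => (-1) * v x) (contDiffOn_const.mul hv) hx
  rw [lap_const_mul] at this
  simpa [sub_eq_add_neg] using this

theorem lap_mul (hU : IsOpen U) (hu : ContDiffOn ℝ ∞ u U) (hv : ContDiffOn ℝ ∞ v U) (hx : ξ ∈ U) :
    lap (fun x => u x * v x) ξ =
      lap u ξ * v ξ + 2 * (d1 u ξ * d1 v ξ + d2 u ξ * d2 v ξ) + u ξ * lap v ξ := by
  have du := fun {x} (hx : x ∈ U) => differentiableAt_of_contDiffOn hU hu hx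
  have dv := fun {x} (hx : x ∈ U) => differentiableAt_of_contDiffOn hU hv hx
  have e1 : EqOn (d1 fun x => u x * v x) (fun x => d1 u x * v x + u x * d1 v x) U := fun x hx =>
    d1_mul (du hx) (dv hx)
  have e2 : EqOn (d2 fun x => u x * v x) (fun x => d2 u x * v x + u x * d2 v x) U := fun x hx =>
    d2_mul (du hx) (dv hx)
  have d1u := differentiableAt_of_contDiffOn hU (contDiffOn_d1 hU hu) hx
  have d1v := differentiableAt_of_contDiffOn hU (contDiffOn_d1 hU hv) hx
  have d2u := differentiableAt_of_contDiffOn hU (contDiffOn_d2 hU hu) hx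
  have d2v := differentiableAt_of_contDiffOn hU (contDiffOn_d2 hU hv) hx
  simp only [lap]
  rw [eqOn_d1 hU e1 hx, eqOn_d2 hU e2 hx, d1_add (d1u.fun_mul (dv hx)) ((du hx).fun_mul d1v),
    d2_add (d2u.fun_mul (dv hx)) ((du hx).fun_mul d2v), d1_mul d1u (dv hx), d1_mul (du hx) d1v,
    d2_mul d2u (dv hx), d2_mul (du hx) d2v]
  ring

end Partial

/-! ### Topology of the cell and uniform properties of the profile. -/

section Geometry

variable {F : ℝ → ℝ}

theorem isOpen_openStrip : IsOpen openStrip :=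
  (isOpen_lt continuous_const continuous_fst).inter (isOpen_lt continuous_fst continuous_const)

theorem isOpen_aboveGraph (hF : Continuous F) : IsOpen (aboveGraph F) :=
  isOpen_lt (hF.comp continuous_fst) continuous_snd

theorem isOpen_cell (hF : Continuous F) : IsOpen (cell F) :=
  isOpen_openStrip.inter (isOpen_aboveGraph hF)

theorem measurableSet_cell (hF : Continuous F) : MeasurableSet (cell F) :=
  (isOpen_cell hF).measurableSet

theorem isOpen_snd_lt (R : ℝ) : IsOpen {ξ : ℝ × ℝ | ξ.2 < R} :=
  isOpen_lt continuous_snd continuous_const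

theorem IsProfile.continuous (hF : IsProfile F) : Continuous F := hF.smooth.continuous

/-- The bound provides the shift `c` for which `ξ.2 + c` is positive on the whole cell, as the Hardy
weight requires. By periodicity a minimum over `[0, 1]` is global. -/
theorem IsProfile.exists_lower_bound (hF : IsProfile F) : ∃ M : ℝ, 0 < M ∧ ∀ t, -M < F t := by
  obtain ⟨t, -, ht⟩ := isCompact_Icc.exists_isMinOn (nonempty_Icc.2 (zero_le_one (α := ℝ)))
    hF.continuous.continuousOn
  refine ⟨1 - F t, by linarith [hF.neg t], fun s => ?_⟩
  obtain ⟨y, hy, hys⟩ := hF.periodic.exists_mem_Ico₀ one_pos s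
  have := ht ⟨hy.1, hy.2.le⟩
  simp only [mem_ofPred_eq] at this
  rw [hys]
  linarith

/-- Subtracting `⌊a⌋` from two points at distance less than `1` brings both into the compact
interval `[-1, 2]` without changing the values of `F`. -/
theorem IsProfile.uniformContinuous (hF : IsProfile F) : UniformContinuous F := by
  have h1 : UniformContinuousOn F (Icc (-1) 2) :=
    isCompact_Icc.uniformContinuousOn_of_continuous hF.continuous.continuousOn
  rw [Metric.uniformContinuousOn_iff] at h1
  rw [Metric.uniformContinuous_iff]
  intro ε hε
  obtain ⟨δ, hδ, h⟩ := h1 ε hε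
  refine ⟨min δ 1, lt_min hδ one_pos, fun a b hab => ?_⟩
  have e : ∀ x : ℝ, F x = F (x - ⌊a⌋) := fun x => (hF.periodic.sub_int_mul_eq ⌊a⌋ (x := x)).symm.trans
    (by simp)
  have hab' := hab.trans_le (min_le_left _ _)
  have hab1 := hab.trans_le (min_le_right _ _)
  rw [Real.dist_eq, abs_lt] at hab1
  have := Int.floor_le a
  have := Int.lt_floor_add_one a
  rw [e a, e b]
  refine h _ ⟨?_, ?_⟩ _ ⟨?_, ?_⟩ ?_ <;> try linarith
  simpa [Real.dist_eq] using hab'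

end Geometry

/-! ### Test functions in the plane and integration by parts. -/

section Tests

variable {S U : Set (ℝ × ℝ)} {φ ψ u : ℝ × ℝ → ℝ}

theorem IsTest.mono (h : IsTest S φ) (hSU : S ⊆ U) : IsTest U φ := ⟨h.smooth, h.compact, h.supp.trans hSU⟩

theorem IsTest.differentiable (h : IsTest S φ) : Differentiable ℝ φ := h.smooth.differentiable (by simp)

theorem IsTest.eq_zero (h : IsTest S φ) {x : ℝ × ℝ} (hx : x ∉ S) : φ x = 0 :=
  image_eq_zero_of_notMem_tsupport fun h' => hx (h.supp h')

theorem tsupport_d1_subset : tsupport (d1 u) ⊆ tsupport u := by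
  intro x hx
  by_contra h
  have h0 : u =ᶠ[𝓝 x] fun _ => 0 := notMem_tsupport_iff_eventuallyEq.1 h
  have h1 : d1 u =ᶠ[𝓝 x] 0 :=
    (d1_eventuallyEq h0).trans (EventuallyEq.of_eq (funext fun y => by simp [d1]))
  exact (notMem_tsupport_iff_eventuallyEq.2 h1) hx

theorem tsupport_d2_subset : tsupport (d2 u) ⊆ tsupport u := by
  intro x hx
  by_contra h
  have h0 : u =ᶠ[𝓝 x] fun _ => 0 := notMem_tsupport_iff_eventuallyEq.1 h
  have h1 : d2 u =ᶠ[𝓝 x] 0 :=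
    (d2_eventuallyEq h0).trans (EventuallyEq.of_eq (funext fun y => by simp [d2]))
  exact (notMem_tsupport_iff_eventuallyEq.2 h1) hx

theorem IsTest.d1 (h : IsTest S φ) : IsTest S (d1 φ) :=
  ⟨contDiff_d1 h.smooth, h.compact.of_isClosed_subset (isClosed_tsupport _) tsupport_d1_subset,
    tsupport_d1_subset.trans h.supp⟩

theorem IsTest.d2 (h : IsTest S φ) : IsTest S (d2 φ) :=
  ⟨contDiff_d2 h.smooth, h.compact.of_isClosed_subset (isClosed_tsupport _) tsupport_d2_subset,
    tsupport_d2_subset.trans h.supp⟩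

theorem IsTest.mul_left (h : IsTest S φ) (hψ : ContDiff ℝ ∞ ψ) : IsTest S (fun x => ψ x * φ x) :=
  ⟨hψ.mul h.smooth, h.compact.mul_left, (tsupport_mul_subset_right).trans h.supp⟩

theorem integrable_mul_test (hu : ContinuousOn u U) (h : IsTest U φ) :
    Integrable (fun x => u x * φ x) := by
  rw [← integrableOn_iff_integrable_of_support_subset (s := tsupport φ)
    ((Function.support_mul_subset_right u φ).trans (subset_tsupport φ))]
  exact ((hu.mono h.supp).mul h.smooth.continuous.continuousOn).integrableOn_compact h.compact

/-- The support of `φ` is a compact subset of `U`, so there are no boundary terms, and the arbitrary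
values of `u` and `d1 u` off `U` are multiplied by zero. -/
theorem integral_mul_d1 (hU : IsOpen U) (hu : ContDiffOn ℝ ∞ u U) (h : IsTest U φ) :
    ∫ x, u x * d1 φ x = -∫ x, d1 u x * φ x := by
  have h1 : (fun x => u x * d1 φ x) = fun x => u x * fderiv ℝ φ x (1, 0) :=
    funext fun x => by rw [d1_eq_fderiv (h.differentiable x)]
  have h2 : (fun x => d1 u x * φ x) = fun x => fderiv ℝ u x (1, 0) * φ x := by
    funext x
    by_cases hx : x ∈ U
    · rw [d1_eq_fderiv (differentiableAt_of_contDiffOn hU hu hx)]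
    · simp [h.eq_zero hx]
  have i1 := integrable_mul_test hu.continuousOn h.d1
  have i2 := integrable_mul_test (contDiffOn_d1 hU hu).continuousOn h
  have i3 := integrable_mul_test hu.continuousOn h
  rw [h1] at i1
  rw [h2] at i2
  rw [h1, h2]
  exact integral_mul_fderiv_eq_neg_fderiv_mul_of_integrable i2 i1 i3
    (fun x hx => differentiableAt_of_contDiffOn hU hu (h.supp hx)) (fun x _ => h.differentiable x)

theorem integral_mul_d2 (hU : IsOpen U) (hu : ContDiffOn ℝ ∞ u U) (h : IsTest U φ) :
    ∫ x, u x * d2 φ x = -∫ x, d2 u x * φ x := by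
  have h1 : (fun x => u x * d2 φ x) = fun x => u x * fderiv ℝ φ x (0, 1) :=
    funext fun x => by rw [d2_eq_fderiv (h.differentiable x)]
  have h2 : (fun x => d2 u x * φ x) = fun x => fderiv ℝ u x (0, 1) * φ x := by
    funext x
    by_cases hx : x ∈ U
    · rw [d2_eq_fderiv (differentiableAt_of_contDiffOn hU hu hx)]
    · simp [h.eq_zero hx]
  have i1 := integrable_mul_test hu.continuousOn h.d2
  have i2 := integrable_mul_test (contDiffOn_d2 hU hu).continuousOn h
  have i3 := integrable_mul_test hu.continuousOn h
  rw [h1] at i1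
  rw [h2] at i2
  rw [h1, h2]
  exact integral_mul_fderiv_eq_neg_fderiv_mul_of_integrable i2 i1 i3
    (fun x hx => differentiableAt_of_contDiffOn hU hu (h.supp hx)) (fun x _ => h.differentiable x)

theorem IsTest.setIntegral_eq (h : IsTest U φ) (u : ℝ × ℝ → ℝ) :
    ∫ x in U, u x * φ x = ∫ x, u x * φ x :=
  setIntegral_eq_integral_of_forall_compl_eq_zero fun x hx => by simp [h.eq_zero hx]

theorem IsTest.integrable (h : IsTest U φ) : Integrable φ :=
  h.smooth.continuous.integrable_of_hasCompactSupport h.compact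

theorem IsTest.memLp (h : IsTest U φ) (p : ENNReal) : MemLp φ p :=
  h.smooth.continuous.memLp_of_hasCompactSupport h.compact

theorem IsTest.exists_bound (h : IsTest U φ) : ∃ C, 0 ≤ C ∧ ∀ x, |φ x| ≤ C := by
  obtain ⟨C, hC⟩ := h.compact.exists_bound_of_continuous h.smooth.continuous
  exact ⟨C, (norm_nonneg _).trans (hC 0), hC⟩

theorem IsTest.exists_eq_zero_above (h : IsTest U φ) : ∃ R : ℝ, ∀ x : ℝ × ℝ, R ≤ x.2 → φ x = 0 := by
  obtain ⟨R, hR⟩ := (h.compact.image continuous_snd).bddAbove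
  refine ⟨R + 1, fun x hx => image_eq_zero_of_notMem_tsupport fun hx' => ?_⟩
  have := hR ⟨x, hx', rfl⟩
  linarith

end Tests

/-! ### Test functions on the half-line. -/

/-- Smooth functions on the line with compact support contained in `(0, ∞)`. -/
structure IsLineTest (η : ℝ → ℝ) : Prop where
  smooth : ContDiff ℝ ∞ η
  compact : HasCompactSupport η
  supp : tsupport η ⊆ Ioi 0

namespace IsLineTest

variable {η θ : ℝ → ℝ}

theorem deriv (h : IsLineTest η) : IsLineTest (deriv η) :=
  ⟨(contDiff_infty_iff_deriv.1 h.smooth).2, h.compact.deriv,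
    (tsupport_deriv_subset (𝕜 := ℝ)).trans h.supp⟩

theorem mul_left (h : IsLineTest η) (hθ : ContDiff ℝ ∞ θ) : IsLineTest (fun t => θ t * η t) :=
  ⟨hθ.mul h.smooth, h.compact.mul_left, tsupport_mul_subset_right.trans h.supp⟩

theorem sub (h : IsLineTest η) (hθ : IsLineTest θ) : IsLineTest (fun t => η t - θ t) :=
  ⟨h.smooth.sub hθ.smooth, h.compact.sub hθ.compact,
    (tsupport_sub η θ).trans (union_subset h.supp hθ.supp)⟩

theorem hasDerivAt (h : IsLineTest η) (t : ℝ) : HasDerivAt η (_root_.deriv η t) t :=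
  ((h.smooth.differentiable (by simp)) t).hasDerivAt

theorem eq_zero (h : IsLineTest η) {t : ℝ} (ht : t ≤ 0) : η t = 0 :=
  image_eq_zero_of_notMem_tsupport fun h' => not_lt.2 ht (h.supp h')

theorem integrable (h : IsLineTest η) : Integrable η :=
  h.smooth.continuous.integrable_of_hasCompactSupport h.compact

theorem integrable_mul {g : ℝ → ℝ} (hg : LocallyIntegrableOn g (Ioi 0)) (h : IsLineTest η) :
    Integrable (fun t => g t * η t) := by
  rw [← integrableOn_iff_integrable_of_support_subset (s := tsupport η)
    ((Function.support_mul_subset_right g η).trans (subset_tsupport η))]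
  exact (hg.integrableOn_compact_subset h.supp h.compact).mul_continuousOn
    h.smooth.continuous.continuousOn h.compact

theorem exists_support_Icc (h : IsLineTest η) :
    ∃ a b : ℝ, 0 < a ∧ (∀ t, t < a → η t = 0) ∧ ∀ t, b < t → η t = 0 := by
  rcases (tsupport η).eq_empty_or_nonempty with he | hne
  · refine ⟨1, 1, one_pos, ?_, ?_⟩ <;>
    exact fun t _ => image_eq_zero_of_notMem_tsupport (by simp [he])
  · obtain ⟨a, ha⟩ := h.compact.isCompact.exists_isLeast hne
    obtain ⟨b, hb⟩ := h.compact.isCompact.exists_isGreatest hne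
    exact ⟨a, b, h.supp ha.1,
      fun t ht => image_eq_zero_of_notMem_tsupport fun h' => not_lt.2 (ha.2 h') ht,
      fun t ht => image_eq_zero_of_notMem_tsupport fun h' => not_lt.2 (hb.2 h') ht⟩

/-- The primitive from `0` vanishes to the left of the support, and to the right of it the primitive
equals the full integral, which is zero. -/
theorem exists_antideriv (h : IsLineTest η) (h0 : ∫ t, η t = 0) :
    ∃ θ, IsLineTest θ ∧ _root_.deriv θ = η := by
  obtain ⟨a, b, ha, hηa, hηb⟩ := h.exists_support_Icc
  have hc := h.smooth.continuous
  set θ : ℝ → ℝ := fun t => ∫ x in (0 : ℝ)..t, η x with hθ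
  have hd : ∀ t, HasDerivAt θ (η t) t := fun t =>
    intervalIntegral.integral_hasDerivAt_right (hc.intervalIntegrable _ _)
      (hc.stronglyMeasurableAtFilter _ _) hc.continuousAt
  have hd' : _root_.deriv θ = η := funext fun t => (hd t).deriv
  have z1 : ∀ t, t < a → θ t = 0 := by
    intro t ht
    refine intervalIntegral.integral_zero_ae (Eventually.of_forall fun x hx => hηa x ?_)
    exact (mem_uIoc.1 hx).elim (fun h => by linarith [h.2]) (fun h => by linarith [h.2])
  -- The endpoints are supplied without `a ≤ b`, hence the maximum.
  have z2 : ∀ t, max a b < t → θ t = 0 := by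
    intro t ht
    have h1 : ∫ x in (0 : ℝ)..t, η x = ∫ x, η x := by
      rw [intervalIntegral.integral_of_le (by linarith [le_max_left a b])]
      refine setIntegral_eq_integral_of_forall_compl_eq_zero fun x hx => ?_
      rw [mem_Ioc, not_and_or, not_lt, not_le] at hx
      exact hx.elim (fun h => hηa x (by linarith)) (fun h => hηb x (by linarith [le_max_right a b]))
    rw [hθ]
    simp only
    rw [h1, h0]
  have hsub : tsupport θ ⊆ Icc a (max a b) := by
    refine closure_minimal (fun x hx => ?_) isClosed_Icc
    by_contra h'
    rw [mem_Icc, not_and_or, not_le, not_le] at h'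
    exact hx (h'.elim (z1 x) (z2 x))
  refine ⟨θ, ⟨contDiff_infty_iff_deriv.2 ⟨fun t => (hd t).differentiableAt, hd' ▸ h.smooth⟩,
    isCompact_Icc.of_isClosed_subset (isClosed_tsupport _) hsub,
    hsub.trans fun x hx => ha.trans_le hx.1⟩, hd'⟩

theorem exists_integral_mul_ne_zero {e : ℝ → ℝ} (he : Continuous e) (hpos : ∀ t, 0 < e t) :
    ∃ η, IsLineTest η ∧ ∫ t, η t * e t = 1 := by
  let f : ContDiffBump (2 : ℝ) := ⟨1 / 2, 1, by norm_num, by norm_num⟩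
  have hf : IsLineTest f := by
    refine ⟨f.contDiff, f.hasCompactSupport, ?_⟩
    rw [f.tsupport_eq, Real.closedBall_eq_Icc]
    exact fun x hx => lt_of_lt_of_le (by norm_num [f]) hx.1
  have hpos' : 0 < ∫ t, f t * e t := by
    refine (f.continuous.mul he).integral_pos_of_hasCompactSupport_nonneg_nonzero
      (f.hasCompactSupport.mul_right) (fun t => mul_nonneg f.nonneg (hpos t).le) (x := 2) ?_
    simp [f.one_of_mem_closedBall (Metric.mem_closedBall_self f.rIn_pos.le), (hpos 2).ne']
  refine ⟨fun t => (∫ t, f t * e t)⁻¹ * f t, hf.mul_left contDiff_const, ?_⟩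
  simp_rw [mul_assoc]
  rw [integral_const_mul, inv_mul_cancel₀ hpos'.ne']

end IsLineTest

/-! ### Weak solutions of `g'' = κ²g + f` on the half-line. -/

section WeakODE

variable {g : ℝ → ℝ}

/-- The du Bois-Reymond lemma: for a fixed `η₀` of integral one, `ψ - (∫ψ)η₀` has mean zero and is
therefore the derivative of a test function. Hence `∫ gψ = c ∫ψ` with `c = ∫ gη₀`. -/
theorem ae_eq_const_of_integral_mul_deriv (hg : LocallyIntegrableOn g (Ioi 0))
    (h : ∀ η, IsLineTest η → ∫ t, g t * deriv η t = 0) :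
    ∃ c : ℝ, ∀ᵐ t, t ∈ Ioi (0 : ℝ) → g t = c := by
  obtain ⟨η₀, h₀, h₀'⟩ := IsLineTest.exists_integral_mul_ne_zero continuous_one fun _ => one_pos
  simp only [Pi.one_apply, mul_one] at h₀'
  refine ⟨∫ t, g t * η₀ t, ?_⟩
  set c := ∫ t, g t * η₀ t
  have key := IsOpen.ae_eq_zero_of_integral_contDiff_smul_eq_zero (f := fun t => g t - c)
    (μ := volume) isOpen_Ioi (hg.sub ((locallyIntegrable_const c).locallyIntegrableOn _)) ?_
  · exact key.mono fun t ht h' => sub_eq_zero.1 (ht h')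
  intro ψ hψ hψc hψs
  have hψ : IsLineTest ψ := ⟨hψ, hψc, hψs⟩
  obtain ⟨θ, hθ, hθ'⟩ := (hψ.sub (h₀.mul_left contDiff_const (θ := fun _ => ∫ t, ψ t))).exists_antideriv
    (by rw [integral_sub hψ.integrable (h₀.integrable.const_mul _), integral_const_mul, h₀']; ring)
  have h2 := h θ hθ
  have i1 := hψ.integrable_mul hg
  have i2 := h₀.integrable_mul hg
  have e2 : ∀ t, g t * deriv θ t = g t * ψ t - (∫ t, ψ t) * (g t * η₀ t) := fun t => by
    rw [hθ']; ring
  simp_rw [e2] at h2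
  rw [integral_sub i1 (i2.const_mul _), integral_const_mul] at h2
  have e3 : ∀ t, ψ t • (g t - c) = g t * ψ t - c * ψ t := fun t => by simp; ring
  simp_rw [e3]
  rw [integral_sub i1 (hψ.integrable.const_mul _), integral_const_mul]
  linarith

/-- A functional that vanishes on the kernel of `η ↦ ∫ ηe` is a multiple of it. Thus `∫ gη' = B ∫
ηe`, that is, `g + BE` has zero weak derivative. This form serves the affine case (`e = 1`) and the
exponential case alike. -/
theorem ae_eq_of_integral_mul_deriv_of_orthogonal {E e : ℝ → ℝ} (hg : LocallyIntegrableOn g (Ioi 0))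
    (he : Continuous e) (hpos : ∀ t, 0 < e t) (hE : ∀ t, HasDerivAt E (e t) t)
    (h : ∀ η, IsLineTest η → ∫ t, η t * e t = 0 → ∫ t, g t * deriv η t = 0) :
    ∃ A B : ℝ, ∀ᵐ t, t ∈ Ioi (0 : ℝ) → g t = A + B * E t := by
  obtain ⟨η₀, h₀, h₀'⟩ := IsLineTest.exists_integral_mul_ne_zero he hpos
  set B := ∫ t, g t * deriv η₀ t with hB
  have hEc : Continuous E := continuous_iff_continuousAt.2 fun t => (hE t).continuousAt
  have hl : ∀ f : ℝ → ℝ, Continuous f → LocallyIntegrableOn f (Ioi 0) := fun f hf =>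
    hf.locallyIntegrable.locallyIntegrableOn _
  suffices hη : ∀ η, IsLineTest η → ∫ t, (g t + B * E t) * deriv η t = 0 by
    obtain ⟨A, hA⟩ := ae_eq_const_of_integral_mul_deriv (g := fun t => g t + B * E t)
      (hg.add (hl _ (continuous_const.mul hEc))) hη
    exact ⟨A, -B, hA.mono fun t ht h' => by linarith [ht h']⟩
  intro η hη
  set s := ∫ t, η t * e t with hs
  have ie : ∀ {η}, IsLineTest η → Integrable fun t => η t * e t := fun h => by
    simpa only [mul_comm] using h.integrable_mul (hl e he)
  have h1 := h _ (hη.sub (h₀.mul_left contDiff_const (θ := fun _ => s))) (by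
    simp_rw [sub_mul, mul_assoc]
    rw [integral_sub (ie hη) ((ie h₀).const_mul _), integral_const_mul, h₀']; ring)
  have e1 : ∀ t, g t * deriv (fun t => η t - s * η₀ t) t
      = g t * deriv η t - s * (g t * deriv η₀ t) := fun t => by
    rw [((hη.hasDerivAt t).fun_sub ((h₀.hasDerivAt t).const_mul s)).deriv]; ring
  simp_rw [e1] at h1
  rw [integral_sub (hη.deriv.integrable_mul hg) ((h₀.deriv.integrable_mul hg).const_mul _),
    integral_const_mul, ← hB] at h1
  have h2 : ∫ t, E t * deriv η t = -∫ t, e t * η t :=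
    integral_mul_deriv_eq_deriv_mul_of_integrable (fun t _ => hE t) (fun t _ => hη.hasDerivAt t)
      (hη.deriv.integrable_mul (hl E hEc)) (hη.integrable_mul (hl e he))
      (hη.integrable_mul (hl E hEc))
  have e3 : ∀ t, (g t + B * E t) * deriv η t = g t * deriv η t + B * (E t * deriv η t) :=
    fun t => by ring
  simp_rw [e3]
  rw [integral_add (hη.deriv.integrable_mul hg) ((hη.deriv.integrable_mul (hl E hEc)).const_mul _),
    integral_const_mul, h2]
  simp_rw [mul_comm (e _)]
  rw [← hs]
  linarith

theorem ae_eq_affine_of_weak_ode (hg : LocallyIntegrableOn g (Ioi 0))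
    (h : ∀ η, IsLineTest η → ∫ t, g t * deriv (deriv η) t = 0) :
    ∃ A B : ℝ, ∀ᵐ t, t ∈ Ioi (0 : ℝ) → g t = A + B * t := by
  refine ae_eq_of_integral_mul_deriv_of_orthogonal (e := fun _ => 1) hg continuous_const
    (fun _ => one_pos) hasDerivAt_id fun η hη h0 => ?_
  obtain ⟨θ, hθ, rfl⟩ := hη.exists_antideriv (by simpa using h0)
  exact h θ hθ

/-- Reduction of order: the operator factors as `exp(κt) (exp(-2κt) (exp(κt) g)')'` up to the sign
of `κ`, so it suffices to determine `g exp(-κt)`, for which one integration against the weight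
`exp(-2κt)` remains. -/
theorem ae_eq_exp_of_weak_ode {κ : ℝ} (hκ : 0 < κ) (hg : LocallyIntegrableOn g (Ioi 0))
    (h : ∀ η, IsLineTest η → ∫ t, g t * (deriv (deriv η) t - κ ^ 2 * η t) = 0) :
    ∃ A B : ℝ, ∀ᵐ t, t ∈ Ioi (0 : ℝ) → g t = A * Real.exp (-κ * t) + B * Real.exp (κ * t) := by
  have hexp : ∀ c : ℝ, ContDiff ℝ ∞ fun t => Real.exp (c * t) := fun c =>
    (contDiff_const.mul contDiff_id).exp
  have dexp : ∀ c t : ℝ, HasDerivAt (fun t => Real.exp (c * t)) (c * Real.exp (c * t)) t := fun c t => by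
    simpa [mul_comm] using ((hasDerivAt_id t).const_mul c).exp
  suffices hs : ∀ σ, IsLineTest σ → ∫ t, σ t * Real.exp (-(2 * κ) * t) = 0 →
      ∫ t, g t * Real.exp (-κ * t) * deriv σ t = 0 by
    obtain ⟨A, B, hAB⟩ := ae_eq_of_integral_mul_deriv_of_orthogonal
      (g := fun t => g t * Real.exp (-κ * t)) (e := fun t => Real.exp (-(2 * κ) * t))
      (E := fun t => -(2 * κ)⁻¹ * Real.exp (-(2 * κ) * t))
      (hg.mul_continuousOn (hexp (-κ)).continuous.continuousOn isOpen_Ioi.isLocallyClosed)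
      (hexp _).continuous (fun _ => Real.exp_pos _)
      (fun t => ((dexp (-(2 * κ)) t).const_mul (-(2 * κ)⁻¹)).congr_deriv (by field_simp))
      hs
    refine ⟨-B * (2 * κ)⁻¹, A, hAB.mono fun t ht h' => ?_⟩
    have h1 := ht h'
    have h2 : g t = (g t * Real.exp (-κ * t)) * Real.exp (κ * t) := by
      rw [mul_assoc, ← Real.exp_add]; simp
    have h3 : Real.exp (-κ * t) = Real.exp (-(2 * κ) * t) * Real.exp (κ * t) := by
      rw [← Real.exp_add]; ring_nf
    rw [h2, h1, h3]
    ring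
  intro σ hσ h0
  obtain ⟨θ, hθ, hθ'⟩ := (hσ.mul_left (hexp (-(2 * κ)))).exists_antideriv
    (by simpa only [mul_comm] using h0)
  -- For `η = exp(κt) θ` with `θ' = exp(-2κt) σ` one finds `η'' - κ²η = exp(-κt) σ'`, so the
  -- hypothesis on `g` becomes the required identity for `σ`.
  have h1 := h _ (hθ.mul_left (hexp κ))
  rw [← h1]
  congr 1
  funext t
  have d1 : ∀ t, HasDerivAt θ (Real.exp (-(2 * κ) * t) * σ t) t := fun t => by
    have := hθ.hasDerivAt t
    rwa [hθ'] at this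
  have e1 : deriv (fun t => Real.exp (κ * t) * θ t)
      = fun t => κ * Real.exp (κ * t) * θ t + Real.exp (-κ * t) * σ t := by
    funext t
    rw [((dexp κ t).fun_mul (d1 t)).deriv, ← mul_assoc, ← Real.exp_add]
    ring_nf
  rw [e1, ((((dexp κ t).const_mul κ).fun_mul (d1 t)).fun_add ((dexp (-κ) t).fun_mul (hσ.hasDerivAt t))).deriv]
  have e2 : Real.exp (κ * t) * Real.exp (-(2 * κ) * t) = Real.exp (-κ * t) := by
    rw [← Real.exp_add]; ring_nf
  linear_combination (-(g t) * κ * σ t) * e2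

theorem integral_mul_ode_eq {p p' p'' : ℝ → ℝ} {κ : ℝ} {η : ℝ → ℝ} (hη : IsLineTest η)
    (hp : ∀ t, HasDerivAt p (p' t) t) (hp' : ∀ t, HasDerivAt p' (p'' t) t) (hc : Continuous p'') :
    ∫ t, p t * (deriv (deriv η) t - κ ^ 2 * η t) = ∫ t, (p'' t - κ ^ 2 * p t) * η t := by
  have hl : ∀ f : ℝ → ℝ, Continuous f → LocallyIntegrableOn f (Ioi 0) := fun f hf =>
    hf.locallyIntegrable.locallyIntegrableOn _
  have c0 := hl p (continuous_iff_continuousAt.2 fun t => (hp t).continuousAt)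
  have c1 := hl p' (continuous_iff_continuousAt.2 fun t => (hp' t).continuousAt)
  have c2 := hl p'' hc
  have h1 : ∫ t, p t * deriv (deriv η) t = -∫ t, p' t * deriv η t :=
    integral_mul_deriv_eq_deriv_mul_of_integrable (fun t _ => hp t) (fun t _ => hη.deriv.hasDerivAt t)
      (hη.deriv.deriv.integrable_mul c0) (hη.deriv.integrable_mul c1) (hη.deriv.integrable_mul c0)
  have h2 : ∫ t, p' t * deriv η t = -∫ t, p'' t * η t :=
    integral_mul_deriv_eq_deriv_mul_of_integrable (fun t _ => hp' t) (fun t _ => hη.hasDerivAt t)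
      (hη.deriv.integrable_mul c1) (hη.integrable_mul c2) (hη.integrable_mul c1)
  have e1 : ∀ t, p t * (deriv (deriv η) t - κ ^ 2 * η t)
      = p t * deriv (deriv η) t - κ ^ 2 * (p t * η t) := fun t => by ring
  have e2 : ∀ t, (p'' t - κ ^ 2 * p t) * η t = p'' t * η t - κ ^ 2 * (p t * η t) := fun t => by ring
  simp_rw [e1, e2]
  rw [integral_sub (hη.deriv.deriv.integrable_mul c0) ((hη.integrable_mul c0).const_mul _),
    integral_sub (hη.integrable_mul c2) ((hη.integrable_mul c0).const_mul _), h1, h2]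
  ring

/-- Weak solutions of `g'' - κ² g = f` for a continuous right-hand side with a known classical
solution `p`. -/
theorem ae_eq_of_weak_ode {p p' p'' f : ℝ → ℝ} {κ : ℝ} (hκ : 0 < κ)
    (hg : LocallyIntegrableOn g (Ioi 0))
    (hp : ∀ t, HasDerivAt p (p' t) t) (hp' : ∀ t, HasDerivAt p' (p'' t) t) (hc : Continuous p'')
    (hf : ∀ᵐ t, t ∈ Ioi (0 : ℝ) → f t = p'' t - κ ^ 2 * p t)
    (h : ∀ η, IsLineTest η → ∫ t, g t * (deriv (deriv η) t - κ ^ 2 * η t) = ∫ t, f t * η t) :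
    ∃ A B : ℝ, ∀ᵐ t, t ∈ Ioi (0 : ℝ) →
      g t = p t + A * Real.exp (-κ * t) + B * Real.exp (κ * t) := by
  have c0 : LocallyIntegrableOn p (Ioi 0) :=
    (continuous_iff_continuousAt.2 fun t => (hp t).continuousAt).locallyIntegrable.locallyIntegrableOn _
  obtain ⟨A, B, hAB⟩ := ae_eq_exp_of_weak_ode (g := fun t => g t - p t) hκ (hg.sub c0)
    fun η hη => by
      have i : ∀ {g}, LocallyIntegrableOn g (Ioi 0) →
          Integrable fun t => g t * (deriv (deriv η) t - κ ^ 2 * η t) := fun hg =>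
        (hη.deriv.deriv.sub (hη.mul_left contDiff_const)).integrable_mul hg
      simp_rw [sub_mul]
      rw [integral_sub (i hg) (i c0), h η hη, integral_mul_ode_eq hη hp hp' hc, sub_eq_zero]
      refine integral_congr_ae (hf.mono fun t ht => ?_)
      by_cases h0 : 0 < t
      · simp only [ht h0]
      · simp [hη.eq_zero (not_lt.1 h0)]
  exact ⟨A, B, hAB.mono fun t ht h' => by linarith [ht h']⟩

end WeakODE

/-! ### Growth arguments that exclude unwanted solutions. -/

section Growth

theorem exists_gt_of_ae {P : ℝ → Prop} (h : ∀ᵐ t : ℝ, P t) {a b : ℝ} (hab : a < b) :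
    ∃ t, a < t ∧ t < b ∧ P t := by
  by_contra! hcon
  have : volume (Ioo a b) = 0 := measure_mono_null (fun t ht => hcon t ht.1 ht.2) (ae_iff.1 h)
  rw [Real.volume_Ioo, ENNReal.ofReal_eq_zero] at this
  linarith

theorem not_integrableOn_of_eventually_inv_le {f : ℝ → ℝ} (h : ∀ᶠ t in atTop, t⁻¹ ≤ |f t|) :
    ¬ IntegrableOn f (Ioi 0) := by
  intro hf
  obtain ⟨T, hT⟩ := eventually_atTop.1 h
  have h1 : IntegrableOn f (Ioi (max T 1)) :=
    hf.mono_set fun t ht => lt_trans one_pos ((le_max_right T 1).trans_lt ht)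
  refine not_integrableOn_Ioi_inv (a := max T 1) (Integrable.mono h1
    measurable_inv.aestronglyMeasurable
    ((ae_restrict_iff' measurableSet_Ioi).2 (Eventually.of_forall fun t ht => ?_)))
  have ht' : max T 1 < t := ht
  rw [Real.norm_of_nonneg (inv_nonneg.2 (by linarith [le_max_right T 1]))]
  exact hT t (by linarith [le_max_left T 1])

/-- With `S = |d| + |α| + |β| + |K|` and `δ = |B| / (S + 1)` one has `Sδ < |B|`, and eventually `1`,
`t` and `t²` are all at most `δ exp(κt)`. The exponentially growing term then outweighs everything
else, including `K * t`. -/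
theorem eventually_mul_lt_abs_exp {κ B : ℝ} (hκ : 0 < κ) (hB : B ≠ 0) (d α β K : ℝ) :
    ∀ᶠ t in atTop, K * t <
      |(d + α * t + β * t ^ 2) * Real.exp (-κ * t) + B * Real.exp (κ * t)| := by
  set S := |d| + |α| + |β| + |K| with hS
  have hS0 : 0 ≤ S := by positivity
  have hB0 : 0 < |B| := abs_pos.2 hB
  have hδ : 0 < |B| / (S + 1) := by positivity
  have hδS : S * (|B| / (S + 1)) < |B| := by
    rw [mul_div_assoc', div_lt_iff₀ (by positivity)]
    nlinarith
  set δ := |B| / (S + 1) with hδ'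
  have h := fun k : ℕ => (isLittleO_pow_exp_pos_mul_atTop k hκ).bound hδ
  filter_upwards [h 0, h 1, h 2, eventually_ge_atTop (0 : ℝ)] with t h0 h1 h2 ht
  simp only [pow_zero, pow_one, norm_one, Real.norm_eq_abs, abs_of_nonneg ht, Real.abs_exp,
    abs_of_nonneg (sq_nonneg t)] at h0 h1 h2
  set e := Real.exp (κ * t) with he
  have he0 : 0 < e := Real.exp_pos _
  have hexp : Real.exp (-κ * t) ≤ 1 := Real.exp_le_one_iff.2 (by nlinarith)
  have r1 : |(d + α * t + β * t ^ 2) * Real.exp (-κ * t)| ≤ |d| * (δ * e) + |α| * (δ * e) + |β| * (δ * e) := by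
    rw [abs_mul, abs_of_pos (Real.exp_pos _)]
    refine (mul_le_of_le_one_right (abs_nonneg _) hexp).trans ?_
    refine (abs_add_le _ _).trans (add_le_add ((abs_add_le _ _).trans (add_le_add ?_ ?_)) ?_)
    · exact le_mul_of_one_le_right (abs_nonneg _) h0
    · rw [abs_mul, abs_of_nonneg ht]
      exact mul_le_mul_of_nonneg_left h1 (abs_nonneg _)
    · rw [abs_mul, abs_of_nonneg (sq_nonneg t)]
      exact mul_le_mul_of_nonneg_left h2 (abs_nonneg _)
  have r2 : K * t ≤ |K| * (δ * e) :=
    (mul_le_mul_of_nonneg_right (le_abs_self K) ht).trans (mul_le_mul_of_nonneg_left h1 (abs_nonneg _))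
  have r3 : |B * e| ≤ |(d + α * t + β * t ^ 2) * Real.exp (-κ * t) + B * e| +
      |(d + α * t + β * t ^ 2) * Real.exp (-κ * t)| := by
    have := abs_sub ((d + α * t + β * t ^ 2) * Real.exp (-κ * t) + B * e)
      ((d + α * t + β * t ^ 2) * Real.exp (-κ * t))
    rwa [add_sub_cancel_left] at this
  rw [abs_mul, abs_of_pos he0] at r3
  have r4 := mul_lt_mul_of_pos_right hδS he0
  have r5 : S * δ * e = |d| * (δ * e) + |α| * (δ * e) + |β| * (δ * e) + |K| * (δ * e) := by
    rw [hS]; ring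
  linarith

theorem frequently_of_ae {P : ℝ → Prop} (h : ∀ᵐ t : ℝ, P t) : ∃ᶠ t in atTop, P t := by
  refine frequently_atTop.2 fun T => ?_
  obtain ⟨t, h1, -, h2⟩ := exists_gt_of_ae h (lt_add_one T)
  exact ⟨t, h1.le, h2⟩

end Growth

/-! ### Completeness and orthogonality of the cosine and sine modes. -/

section Completeness

/-- The cross section `(-1/2, 1/2)` of the strip. -/
abbrev crossSection : Set ℝ := Ioo (-(1 / 2)) (1 / 2)

/-- The modes `cos (n π (s + 1/2))`. -/
noncomputable def cosMode (n : ℕ) (s : ℝ) : ℝ := Real.cos (n * Real.pi * (s + 1 / 2))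

/-- The modes `sin (n π (s + 1/2))`. -/
noncomputable def sinMode (n : ℕ) (s : ℝ) : ℝ := Real.sin (n * Real.pi * (s + 1 / 2))

theorem continuous_cosMode (n : ℕ) : Continuous (cosMode n) := by unfold cosMode; fun_prop

theorem continuous_sinMode (n : ℕ) : Continuous (sinMode n) := by unfold sinMode; fun_prop

theorem abs_cosMode_le (n : ℕ) (s : ℝ) : |cosMode n s| ≤ 1 := Real.abs_cos_le_one _

theorem abs_sinMode_le (n : ℕ) (s : ℝ) : |sinMode n s| ≤ 1 := Real.abs_sin_le_one _

@[simp] theorem cosMode_zero : cosMode 0 = fun _ => 1 := by funext s; simp [cosMode]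

theorem integrableOn_crossSection_mul {g f : ℝ → ℝ} (hg : IntegrableOn g crossSection)
    (hf : Continuous f) : IntegrableOn (fun s => g s * f s) crossSection :=
  (Integrable.mono_measure (hg.mul_continuousOn_of_subset hf.continuousOn measurableSet_Ioo
    isCompact_Icc Ioo_subset_Icc_self) le_rfl)

/-- By the product-to-sum formula `g` is orthogonal to every polynomial in `cosMode 1`. Since `s ↦
cos π(s + 1/2)` is injective on the cross section with values in `[-1, 1]`, Weierstrass
approximation in that variable reaches every continuous function. -/
theorem integral_mul_continuous_eq_zero {g : ℝ → ℝ} (hg : IntegrableOn g crossSection)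
    (h : ∀ n : ℕ, ∫ s in crossSection, g s * cosMode n s = 0) {φ : ℝ → ℝ} (hφ : Continuous φ) :
    ∫ s in crossSection, g s * φ s = 0 := by
  have ii : ∀ {f : ℝ → ℝ}, Continuous f → IntegrableOn (fun s => g s * f s) crossSection :=
    fun hf => integrableOn_crossSection_mul hg hf
  have c1 := continuous_cosMode 1
  have hpow : ∀ k n : ℕ, ∫ s in crossSection, g s * (cosMode 1 s ^ k * cosMode n s) = 0 := by
    intro k
    induction k with
    | zero => simpa using h
    | succ k ih =>
      intro n
      -- The order `0` is separate because the product formula would call for the mode of order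
      -- `-1`.
      cases n with
      | zero => simpa [pow_succ] using ih 1
      | succ m =>
        have e : ∀ s, g s * (cosMode 1 s ^ (k + 1) * cosMode (m + 1) s) =
            2⁻¹ * (g s * (cosMode 1 s ^ k * cosMode (m + 2) s)) +
            2⁻¹ * (g s * (cosMode 1 s ^ k * cosMode m s)) := by
          intro s
          have e1 : cosMode (m + 2) s = cosMode (m + 1) s * cosMode 1 s
              - sinMode (m + 1) s * sinMode 1 s := by
            simp only [cosMode, sinMode]
            rw [← Real.cos_add]; push_cast; ring_nf
          have e2 : cosMode m s = cosMode (m + 1) s * cosMode 1 s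
              + sinMode (m + 1) s * sinMode 1 s := by
            simp only [cosMode, sinMode]
            rw [← Real.cos_sub]; push_cast; ring_nf
          rw [e1, e2]
          ring
        simp_rw [e]
        have i3 : ∀ j, IntegrableOn (fun s => g s * (cosMode 1 s ^ k * cosMode j s)) crossSection :=
          fun j => ii ((c1.pow k).mul (continuous_cosMode j))
        rw [integral_add ((i3 _).const_mul _) ((i3 _).const_mul _), integral_const_mul,
          integral_const_mul, ih, ih]
        simp
  have ip : ∀ p : Polynomial ℝ, IntegrableOn (fun s => g s * p.eval (cosMode 1 s)) crossSection :=
    fun p => ii (p.continuous.comp c1)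
  have hpoly : ∀ p : Polynomial ℝ, ∫ s in crossSection, g s * p.eval (cosMode 1 s) = 0 := by
    intro p
    induction p using Polynomial.induction_on' with
    | add p q hp hq =>
      simp_rw [Polynomial.eval_add, mul_add]
      rw [integral_add (ip p) (ip q), hp, hq, add_zero]
    | monomial n a =>
      have := hpow n 0
      simp only [cosMode_zero, mul_one] at this
      simp_rw [Polynomial.eval_monomial, mul_left_comm _ a]
      rw [integral_const_mul, this, mul_zero]
  refine abs_eq_zero.1 (le_antisymm (le_of_forall_pos_lt_add fun ε hε => ?_) (abs_nonneg _))
  set L := ∫ s in crossSection, |g s| with hL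
  have hL0 : 0 ≤ L := integral_nonneg fun _ => abs_nonneg _
  -- This is `φ` read in the variable `x = cosMode 1 s`, whose inverse is `arccos x / π - 1/2`.
  have hψ : Continuous fun x => φ (Real.arccos x / Real.pi - 1 / 2) :=
    hφ.comp ((Real.continuous_arccos.div_const _).sub continuous_const)
  obtain ⟨p, hp⟩ := exists_polynomial_near_of_continuousOn (-1) 1 _ hψ.continuousOn
    (ε / (L + 1)) (by positivity)
  have hp' : ∀ s ∈ crossSection, |φ s - p.eval (cosMode 1 s)| ≤ ε / (L + 1) := by
    intro s hs
    have h1 := hp (cosMode 1 s) ⟨(abs_le.1 (abs_cosMode_le 1 s)).1, (abs_le.1 (abs_cosMode_le 1 s)).2⟩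
    have h2 : Real.arccos (cosMode 1 s) = Real.pi * (s + 1 / 2) := by
      simp only [cosMode, Nat.cast_one, one_mul]
      exact Real.arccos_cos (by have := hs.1; have := Real.pi_pos; nlinarith)
        (by have := hs.2; have := Real.pi_pos; nlinarith)
    rw [h2, mul_div_cancel_left₀ _ Real.pi_ne_zero, add_sub_cancel_right, abs_sub_comm] at h1
    exact h1.le
  have e : ∫ s in crossSection, g s * φ s
      = ∫ s in crossSection, g s * (φ s - p.eval (cosMode 1 s)) := by
    simp_rw [mul_sub]
    rw [integral_sub (ii hφ) (ip p), hpoly, sub_zero]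
  rw [e, zero_add]
  calc |∫ s in crossSection, g s * (φ s - p.eval (cosMode 1 s))|
      ≤ ∫ s in crossSection, |g s * (φ s - p.eval (cosMode 1 s))| := abs_integral_le_integral_abs
    _ ≤ ∫ s in crossSection, |g s| * (ε / (L + 1)) := by
        refine setIntegral_mono_on (ii (hφ.sub (p.continuous.comp c1))).abs
          (hg.abs.mul_const _) measurableSet_Ioo fun s hs => ?_
        rw [abs_mul]
        exact mul_le_mul_of_nonneg_left (hp' s hs) (abs_nonneg _)
    _ = L * (ε / (L + 1)) := by rw [integral_mul_const]
    _ < ε := by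
        rw [mul_div_assoc', div_lt_iff₀ (by positivity)]
        nlinarith

theorem ae_eq_zero_of_cosMode {g : ℝ → ℝ} (hg : IntegrableOn g crossSection)
    (h : ∀ n : ℕ, ∫ s in crossSection, g s * cosMode n s = 0) :
    ∀ᵐ s, s ∈ crossSection → g s = 0 := by
  refine IsOpen.ae_eq_zero_of_integral_contDiff_smul_eq_zero isOpen_Ioo
    hg.locallyIntegrableOn fun φ hφ _ hs => ?_
  rw [← integral_mul_continuous_eq_zero hg h hφ.continuous,
    setIntegral_eq_integral_of_forall_compl_eq_zero]
  · simp [mul_comm]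
  · intro x hx
    rw [image_eq_zero_of_notMem_tsupport fun h' => hx (hs h'), mul_zero]

/-- The products `sinMode 1 * cosMode n` are differences of sine modes, so `g * sinMode 1` is
orthogonal to all cosines and vanishes. The factor `sinMode 1` is positive on the open cross
section. -/
theorem ae_eq_zero_of_sinMode {g : ℝ → ℝ} (hg : IntegrableOn g crossSection)
    (h : ∀ n : ℕ, ∫ s in crossSection, g s * sinMode n s = 0) :
    ∀ᵐ s, s ∈ crossSection → g s = 0 := by
  have ii : ∀ {f : ℝ → ℝ}, Continuous f → IntegrableOn (fun s => g s * f s) crossSection :=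
    fun hf => integrableOn_crossSection_mul hg hf
  have key := ae_eq_zero_of_cosMode (ii (continuous_sinMode 1)) fun n => by
    cases n with
    | zero => simpa using h 1
    | succ m =>
      have e : ∀ s, g s * sinMode 1 s * cosMode (m + 1) s =
          2⁻¹ * (g s * sinMode (m + 2) s) - 2⁻¹ * (g s * sinMode m s) := by
        intro s
        have e1 : sinMode (m + 2) s = sinMode (m + 1) s * cosMode 1 s
            + cosMode (m + 1) s * sinMode 1 s := by
          simp only [cosMode, sinMode]
          rw [← Real.sin_add]; push_cast; ring_nf
        have e2 : sinMode m s = sinMode (m + 1) s * cosMode 1 s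
            - cosMode (m + 1) s * sinMode 1 s := by
          simp only [cosMode, sinMode]
          rw [← Real.sin_sub]; push_cast; ring_nf
        rw [e1, e2]
        ring
      simp_rw [e]
      rw [integral_sub ((ii (continuous_sinMode _)).const_mul _)
        ((ii (continuous_sinMode _)).const_mul _), integral_const_mul, integral_const_mul, h, h]
      simp
  refine key.mono fun s hs hs' => (mul_eq_zero.1 (hs hs')).resolve_right ?_
  simp only [sinMode, Nat.cast_one, one_mul]
  refine (Real.sin_pos_of_pos_of_lt_pi ?_ ?_).ne'
  · have := hs'.1; have := Real.pi_pos; nlinarith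
  · have := hs'.2; have := Real.pi_pos; nlinarith

theorem integral_cos_int_mul (k : ℤ) :
    ∫ s in crossSection, Real.cos (k * Real.pi * (s + 1 / 2)) = if k = 0 then 1 else 0 := by
  rw [← integral_Ioc_eq_integral_Ioo, ← intervalIntegral.integral_of_le (by norm_num)]
  split_ifs with hk
  · simp [hk]
    norm_num
  · have hk' : (k * Real.pi : ℝ) ≠ 0 := mul_ne_zero (by exact_mod_cast hk) Real.pi_ne_zero
    have hd : ∀ s ∈ uIcc (-(1 / 2) : ℝ) (1 / 2),
        HasDerivAt (fun s => (k * Real.pi)⁻¹ * Real.sin (k * Real.pi * (s + 1 / 2)))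
          (Real.cos (k * Real.pi * (s + 1 / 2))) s := fun s _ => by
      refine (((((hasDerivAt_id s).add_const (1 / 2)).const_mul (k * Real.pi)).sin).const_mul
        (k * Real.pi : ℝ)⁻¹).congr_deriv ?_
      simp only [id]
      field_simp
    rw [intervalIntegral.integral_eq_sub_of_hasDerivAt hd
      (Continuous.intervalIntegrable (by fun_prop) _ _)]
    have e1 : (k * Real.pi * (1 / 2 + 1 / 2) : ℝ) = k * Real.pi := by ring
    have e2 : (k * Real.pi * (-(1 / 2) + 1 / 2) : ℝ) = 0 := by ring
    rw [e1, e2, Real.sin_int_mul_pi]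
    simp

/-- The product splits into the frequencies `m - n` and `m + n`. As `n ≠ 0` the second is never
zero, which excludes the differently normalised diagonal entry of the constant mode. -/
theorem integral_cosMode_mul_cosMode (m n : ℕ) (hn : n ≠ 0) :
    ∫ s in crossSection, cosMode m s * cosMode n s = if m = n then 1 / 2 else 0 := by
  have e : ∀ s, cosMode m s * cosMode n s =
      2⁻¹ * Real.cos (((m - n : ℤ) : ℝ) * Real.pi * (s + 1 / 2)) +
      2⁻¹ * Real.cos (((m + n : ℤ) : ℝ) * Real.pi * (s + 1 / 2)) := fun s => by
    push_cast
    simp only [sub_mul, add_mul, Real.cos_add, Real.cos_sub, cosMode]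
    ring
  have i : ∀ k : ℤ, IntegrableOn (fun s => Real.cos ((k : ℝ) * Real.pi * (s + 1 / 2))) crossSection :=
    fun k => (Continuous.integrableOn_Icc (by fun_prop)).mono_set Ioo_subset_Icc_self
  simp_rw [e]
  rw [integral_add ((i _).const_mul _) ((i _).const_mul _), integral_const_mul, integral_const_mul,
    integral_cos_int_mul, integral_cos_int_mul, if_neg (show ¬ ((m : ℤ) + n = 0) by omega)]
  by_cases h : m = n
  · simp [h]
  · rw [if_neg (show ¬ ((m : ℤ) - n = 0) by omega), if_neg h]
    simp

theorem integral_sinMode_mul_sinMode (m n : ℕ) (hn : n ≠ 0) :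
    ∫ s in crossSection, sinMode m s * sinMode n s = if m = n then 1 / 2 else 0 := by
  have e : ∀ s, sinMode m s * sinMode n s =
      2⁻¹ * Real.cos (((m - n : ℤ) : ℝ) * Real.pi * (s + 1 / 2)) -
      2⁻¹ * Real.cos (((m + n : ℤ) : ℝ) * Real.pi * (s + 1 / 2)) := fun s => by
    push_cast
    simp only [sub_mul, add_mul, Real.cos_add, Real.cos_sub, sinMode]
    ring
  have i : ∀ k : ℤ, IntegrableOn (fun s => Real.cos ((k : ℝ) * Real.pi * (s + 1 / 2))) crossSection :=
    fun k => (Continuous.integrableOn_Icc (by fun_prop)).mono_set Ioo_subset_Icc_self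
  simp_rw [e]
  rw [integral_sub ((i _).const_mul _) ((i _).const_mul _), integral_const_mul, integral_const_mul,
    integral_cos_int_mul, integral_cos_int_mul, if_neg (show ¬ ((m : ℤ) + n = 0) by omega)]
  by_cases h : m = n
  · simp [h]
  · rw [if_neg (show ¬ ((m : ℤ) - n = 0) by omega), if_neg h]
    simp

end Completeness

/-! ### A class of exponentially decaying functions closed under differentiation. -/

section Decaying

/-- The coordinate `exp (i π (ξ₁ + 1/2 + i ξ₂))`, which maps the half-strip to the half-disc. -/
noncomputable def discCoord (ξ : ℝ × ℝ) : ℂ :=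
  Complex.exp (Real.pi * Complex.I * ((ξ.1 : ℂ) + 1 / 2 + Complex.I * ξ.2))

/-- The open upper half-plane. -/
def upperHalf : Set (ℝ × ℝ) := {ξ | 0 < ξ.2}

theorem isOpen_upperHalf : IsOpen upperHalf := isOpen_lt continuous_const continuous_snd

theorem norm_discCoord (ξ : ℝ × ℝ) : ‖discCoord ξ‖ = Real.exp (-Real.pi * ξ.2) := by
  rw [discCoord, Complex.norm_exp]
  congr 1
  simp

theorem discCoord_mem_ball {ξ : ℝ × ℝ} (h : ξ ∈ upperHalf) : discCoord ξ ∈ Metric.ball (0 : ℂ) 1 := by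
  rw [mem_ball_zero_iff, norm_discCoord, Real.exp_lt_one_iff]
  have : 0 < ξ.2 := h
  nlinarith [Real.pi_pos]

theorem contDiff_discCoord : ContDiff ℝ ∞ discCoord := by
  unfold discCoord
  refine ContDiff.cexp (contDiff_const.mul ?_)
  exact ((Complex.ofRealCLM.contDiff.comp contDiff_fst).add contDiff_const).add
    (contDiff_const.mul (Complex.ofRealCLM.contDiff.comp contDiff_snd))

theorem discCoord_pow (ξ : ℝ × ℝ) (n : ℕ) : discCoord ξ ^ n =
    ((Real.exp (-(n * Real.pi) * ξ.2) * cosMode n ξ.1 : ℝ) : ℂ) +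
      ((Real.exp (-(n * Real.pi) * ξ.2) * sinMode n ξ.1 : ℝ) : ℂ) * Complex.I := by
  have : discCoord ξ ^ n = Complex.exp ((-(n * Real.pi) * ξ.2 : ℝ)) *
      Complex.exp (((n * Real.pi * (ξ.1 + 1 / 2) : ℝ) : ℂ) * Complex.I) := by
    rw [discCoord, ← Complex.exp_nat_mul, ← Complex.exp_add]
    congr 1
    push_cast
    linear_combination (n * Real.pi * ξ.2 : ℂ) * Complex.I_sq
  rw [this, Complex.exp_mul_I, cosMode, sinMode]
  push_cast
  ring

theorem hasDerivAt_discCoord_fst (ξ : ℝ × ℝ) :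
    HasDerivAt (fun t : ℝ => discCoord (t, ξ.2)) (Real.pi * Complex.I * discCoord ξ) ξ.1 := by
  have h : HasDerivAt (fun t : ℝ => (Real.pi : ℂ) * Complex.I * ((t : ℂ) + 1 / 2 + Complex.I * ξ.2))
      (Real.pi * Complex.I * 1) ξ.1 :=
    ((((hasDerivAt_id ξ.1).ofReal_comp).add_const _).add_const _).const_mul _
  refine h.cexp.congr_deriv ?_
  rw [discCoord]
  ring

theorem hasDerivAt_discCoord_snd (ξ : ℝ × ℝ) :
    HasDerivAt (fun t : ℝ => discCoord (ξ.1, t)) (-Real.pi * discCoord ξ) ξ.2 := by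
  have h : HasDerivAt (fun t : ℝ => (Real.pi : ℂ) * Complex.I * ((ξ.1 : ℂ) + 1 / 2 + Complex.I * t))
      (Real.pi * Complex.I * (Complex.I * 1)) ξ.2 :=
    ((((hasDerivAt_id ξ.2).ofReal_comp).const_mul _).const_add _).const_mul _
  refine h.cexp.congr_deriv ?_
  rw [discCoord]
  linear_combination (Real.pi * Complex.exp (Real.pi * Complex.I * ((ξ.1 : ℂ) + 1 / 2 + Complex.I * ξ.2)) : ℂ) * Complex.I_sq

/-- Finite sums of functions `ξ₂ ^ k * Re f (q)`, where `f` is holomorphic in the unit disc with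
`f 0 = 0` and `q` is the disc coordinate. -/
inductive IsDecaying : (ℝ × ℝ → ℝ) → Prop
  | term (k : ℕ) (f : ℂ → ℂ) (hf : DifferentiableOn ℂ f (Metric.ball 0 1)) (h0 : f 0 = 0) :
      IsDecaying fun ξ => ξ.2 ^ k * (f (discCoord ξ)).re
  | add {u v : ℝ × ℝ → ℝ} (hu : IsDecaying u) (hv : IsDecaying v) :
      IsDecaying fun ξ => u ξ + v ξ

theorem IsDecaying.contDiffOn {u : ℝ × ℝ → ℝ} (hu : IsDecaying u) :
    ContDiffOn ℝ ∞ u upperHalf := by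
  induction hu with
  | term k f hf h0 =>
    refine (contDiff_snd.pow k).contDiffOn.mul ?_
    have h1 : ContDiffOn ℝ ∞ f (Metric.ball 0 1) :=
      (hf.contDiffOn Metric.isOpen_ball).restrict_scalars ℝ
    exact Complex.reCLM.contDiff.comp_contDiffOn
      (h1.comp contDiff_discCoord.contDiffOn fun ξ hξ => discCoord_mem_ball hξ)
  | add _ _ hu hv => exact hu.add hv

/-- Differentiating `f(q)` in `ξ₁` gives `iπ q f'(q)`, again holomorphic in the disc and zero at the
origin. -/
theorem IsDecaying.exists_d1 {u : ℝ × ℝ → ℝ} (hu : IsDecaying u) :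
    ∃ v, IsDecaying v ∧ EqOn (d1 u) v upperHalf := by
  induction hu with
  | term k f hf h0 =>
    refine ⟨_, IsDecaying.term k (fun z => Real.pi * Complex.I * (z * deriv f z))
      ((differentiableOn_const _).mul (differentiableOn_id.mul (hf.deriv Metric.isOpen_ball)))
      (by simp), fun ξ hξ => ?_⟩
    have h1 := (hf.differentiableAt (Metric.isOpen_ball.mem_nhds (discCoord_mem_ball hξ))).hasDerivAt
    have h2 : HasDerivAt (fun t : ℝ => f (discCoord (t, ξ.2)))
        (deriv f (discCoord ξ) * (Real.pi * Complex.I * discCoord ξ)) ξ.1 :=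
      HasDerivAt.comp (h := fun t : ℝ => discCoord (t, ξ.2)) ξ.1 h1 (hasDerivAt_discCoord_fst ξ)
    have h3 := (Complex.reCLM.hasFDerivAt.comp_hasDerivAt ξ.1 h2).const_mul (ξ.2 ^ k)
    refine h3.deriv.trans ?_
    simp only [Complex.reCLM_apply]
    ring_nf
  | @add u v hu hv ihu ihv =>
    obtain ⟨u', hu', eu⟩ := ihu
    obtain ⟨v', hv', ev⟩ := ihv
    refine ⟨_, hu'.add hv', fun ξ hξ => ?_⟩
    rw [d1_add (differentiableAt_of_contDiffOn isOpen_upperHalf hu.contDiffOn hξ)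
      (differentiableAt_of_contDiffOn isOpen_upperHalf hv.contDiffOn hξ), eu hξ, ev hξ]

theorem IsDecaying.exists_d2 {u : ℝ × ℝ → ℝ} (hu : IsDecaying u) :
    ∃ v, IsDecaying v ∧ EqOn (d2 u) v upperHalf := by
  induction hu with
  | term k f hf h0 =>
    -- Besides `-π q f'(q)` the product rule yields `k ξ₂^(k-1) f(q)`. For `k = 0` the truncated
    -- exponent is harmless because the factor `k` vanishes.
    refine ⟨_, (IsDecaying.term (k - 1) (fun z => k * f z) ((differentiableOn_const _).mul hf)
      (by simp [h0])).add (IsDecaying.term k (fun z => -Real.pi * (z * deriv f z))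
      ((differentiableOn_const _).mul (differentiableOn_id.mul (hf.deriv Metric.isOpen_ball)))
      (by simp)), fun ξ hξ => ?_⟩
    have h1 := (hf.differentiableAt (Metric.isOpen_ball.mem_nhds (discCoord_mem_ball hξ))).hasDerivAt
    have h2 : HasDerivAt (fun t : ℝ => f (discCoord (ξ.1, t)))
        (deriv f (discCoord ξ) * (-Real.pi * discCoord ξ)) ξ.2 :=
      HasDerivAt.comp (h := fun t : ℝ => discCoord (ξ.1, t)) ξ.2 h1 (hasDerivAt_discCoord_snd ξ)
    have h3 := (hasDerivAt_pow k ξ.2).mul (Complex.reCLM.hasFDerivAt.comp_hasDerivAt ξ.2 h2)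
    refine h3.deriv.trans ?_
    have e : ((k : ℂ) * f (discCoord ξ)).re = k * (f (discCoord ξ)).re := by
      rw [← Complex.ofReal_natCast, Complex.re_ofReal_mul]
    simp only [Complex.reCLM_apply, Function.comp, e]
    ring_nf
  | @add u v hu hv ihu ihv =>
    obtain ⟨u', hu', eu⟩ := ihu
    obtain ⟨v', hv', ev⟩ := ihv
    refine ⟨_, hu'.add hv', fun ξ hξ => ?_⟩
    rw [d2_add (differentiableAt_of_contDiffOn isOpen_upperHalf hu.contDiffOn hξ)
      (differentiableAt_of_contDiffOn isOpen_upperHalf hv.contDiffOn hξ), eu hξ, ev hξ]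

/-- The quotient `f(z)/z` extends continuously over the origin, hence is bounded on the compact disc
of radius `r`. -/
theorem exists_le_mul_norm_of_differentiableOn {f : ℂ → ℂ}
    (hf : DifferentiableOn ℂ f (Metric.ball 0 1)) (h0 : f 0 = 0) {r : ℝ} (hr1 : r < 1) :
    ∃ K, 0 ≤ K ∧ ∀ z, ‖z‖ ≤ r → ‖f z‖ ≤ K * ‖z‖ := by
  have hd : ContinuousOn (dslope f 0) (Metric.closedBall 0 r) := by
    refine (((Complex.differentiableOn_dslope (Metric.ball_mem_nhds 0 one_pos)).2 hf).continuousOn).mono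
      (Metric.closedBall_subset_ball hr1)
  obtain ⟨K, hK⟩ := (isCompact_closedBall (0 : ℂ) r).exists_bound_of_continuousOn hd
  refine ⟨max K 0, le_max_right _ _, fun z hz => ?_⟩
  have h1 := sub_smul_dslope f 0 z
  rw [h0, sub_zero, sub_zero] at h1
  rw [← h1, norm_smul, mul_comm]
  exact mul_le_mul_of_nonneg_right ((hK z (by simpa using hz)).trans (le_max_left _ _)) (norm_nonneg _)

/-- On `ξ₂ ≥ δ` the variable `q` stays in a smaller disc, so `f(q)` is `O(exp(-πξ₂))`. One factor
`exp ξ₂` absorbs the power `ξ₂^k`, and `π ≥ 2` leaves the uniform rate `1` for all members of the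
class. -/
theorem IsDecaying.exists_bound {u : ℝ × ℝ → ℝ} (hu : IsDecaying u) {δ : ℝ} (hδ : 0 < δ) :
    ∃ K, ∀ ξ : ℝ × ℝ, δ ≤ ξ.2 → |u ξ| ≤ K * Real.exp (-1 * ξ.2) := by
  induction hu with
  | term k f hf h0 =>
    obtain ⟨K, hK0, hK⟩ := exists_le_mul_norm_of_differentiableOn hf h0
      (r := Real.exp (-Real.pi * δ)) (by rw [Real.exp_lt_one_iff]; nlinarith [Real.pi_pos])
    refine ⟨k.factorial * K, fun ξ hξ => ?_⟩
    have ht : 0 ≤ ξ.2 := hδ.le.trans hξ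
    have h1 : |(f (discCoord ξ)).re| ≤ K * Real.exp (-Real.pi * ξ.2) := by
      refine (Complex.abs_re_le_norm _).trans ((hK _ ?_).trans_eq (by rw [norm_discCoord]))
      rw [norm_discCoord]
      exact Real.exp_le_exp.2 (by nlinarith [Real.pi_pos])
    have h2 : ξ.2 ^ k ≤ k.factorial * Real.exp ξ.2 := by
      have := Real.pow_div_factorial_le_exp ξ.2 ht k
      rwa [div_le_iff₀' (by positivity)] at this
    have h3 : Real.exp ξ.2 * Real.exp (-Real.pi * ξ.2) ≤ Real.exp (-1 * ξ.2) := by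
      rw [← Real.exp_add]
      exact Real.exp_le_exp.2 (by nlinarith [Real.two_le_pi])
    rw [abs_mul, abs_of_nonneg (by positivity)]
    calc ξ.2 ^ k * |(f (discCoord ξ)).re|
        ≤ (k.factorial * Real.exp ξ.2) * (K * Real.exp (-Real.pi * ξ.2)) :=
          mul_le_mul h2 h1 (abs_nonneg _) (by positivity)
      _ = k.factorial * K * (Real.exp ξ.2 * Real.exp (-Real.pi * ξ.2)) := by ring
      _ ≤ k.factorial * K * Real.exp (-1 * ξ.2) := mul_le_mul_of_nonneg_left h3 (by positivity)
  | add _ _ hu hv =>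
    obtain ⟨K, hK⟩ := hu
    obtain ⟨L, hL⟩ := hv
    refine ⟨K + L, fun ξ hξ => (abs_add_le _ _).trans ?_⟩
    rw [add_mul]
    exact add_le_add (hK ξ hξ) (hL ξ hξ)

theorem eqOn_d1_iterate {U : Set (ℝ × ℝ)} (hU : IsOpen U) {u v : ℝ × ℝ → ℝ} (h : EqOn u v U) (i : ℕ) :
    EqOn (d1^[i] u) (d1^[i] v) U := by
  induction i with
  | zero => exact h
  | succ i ih => simpa only [Function.iterate_succ_apply'] using eqOn_d1 hU ih

theorem eqOn_d2_iterate {U : Set (ℝ × ℝ)} (hU : IsOpen U) {u v : ℝ × ℝ → ℝ} (h : EqOn u v U) (i : ℕ) :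
    EqOn (d2^[i] u) (d2^[i] v) U := by
  induction i with
  | zero => exact h
  | succ i ih => simpa only [Function.iterate_succ_apply'] using eqOn_d2 hU ih

theorem IsDecaying.exists_d1_iterate {u : ℝ × ℝ → ℝ} (hu : IsDecaying u) (i : ℕ) :
    ∃ v, IsDecaying v ∧ EqOn (d1^[i] u) v upperHalf := by
  induction i with
  | zero => exact ⟨u, hu, fun _ _ => rfl⟩
  | succ i ih =>
    obtain ⟨v, hv, e⟩ := ih
    obtain ⟨w, hw, e'⟩ := hv.exists_d1
    exact ⟨w, hw, by
      simpa only [Function.iterate_succ_apply'] using (eqOn_d1 isOpen_upperHalf e).trans e'⟩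

theorem IsDecaying.exists_d2_iterate {u : ℝ × ℝ → ℝ} (hu : IsDecaying u) (i : ℕ) :
    ∃ v, IsDecaying v ∧ EqOn (d2^[i] u) v upperHalf := by
  induction i with
  | zero => exact ⟨u, hu, fun _ _ => rfl⟩
  | succ i ih =>
    obtain ⟨v, hv, e⟩ := ih
    obtain ⟨w, hw, e'⟩ := hv.exists_d2
    exact ⟨w, hw, by
      simpa only [Function.iterate_succ_apply'] using (eqOn_d2 isOpen_upperHalf e).trans e'⟩

/-- Closure under differentiation turns the bound on a single function into bounds of every order,
with the common rate `1` independent of the order and of `δ`. -/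
theorem IsDecaying.eqUpToExp {F : ℝ → ℝ} (hF : Continuous F) {u v : ℝ × ℝ → ℝ} {c : ℝ}
    (hv : IsDecaying v) (h : ∀ ξ ∈ cell F, 0 < ξ.2 → u ξ = c + v ξ) : EqUpToExp F u c := by
  refine ⟨1, one_pos, fun δ hδ i j => ?_⟩
  have hU : IsOpen (cell F ∩ upperHalf) := (isOpen_cell hF).inter isOpen_upperHalf
  obtain ⟨w, hw, ew⟩ := hv.exists_d2_iterate j
  obtain ⟨z, hz, ez⟩ := hw.exists_d1_iterate i
  obtain ⟨K, hK⟩ := hz.exists_bound hδ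
  refine ⟨K, fun ξ hξ hδξ => ?_⟩
  have e1 : EqOn (fun η => u η - c) v (cell F ∩ upperHalf) := fun η hη => by
    simp [h η hη.1 hη.2]
  have hmem : ξ ∈ cell F ∩ upperHalf := ⟨hξ, hδ.trans_le hδξ⟩
  rw [eqOn_d1_iterate hU ((eqOn_d2_iterate hU e1 j).trans (ew.mono inter_subset_right)) i hmem,
    ez hmem.2]
  exact hK ξ hδξ

end Decaying

/-! ### Power series in the disc coordinate. -/

section PowerSeries

/-- Coefficient sequences of power series that converge in the unit disc. -/
def SubExp (c : ℕ → ℝ) : Prop := ∀ t : ℝ, 0 < t → ∃ K : ℝ, ∀ n : ℕ, |c n| ≤ K * Real.exp (n * Real.pi * t)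

theorem SubExp.const_mul {c : ℕ → ℝ} (hc : SubExp c) (a : ℝ) : SubExp fun n => a * c n := fun t ht => by
  obtain ⟨K, hK⟩ := hc t ht
  refine ⟨|a| * K, fun n => ?_⟩
  rw [abs_mul, mul_assoc]
  exact mul_le_mul_of_nonneg_left (hK n) (abs_nonneg _)

theorem SubExp.add {c d : ℕ → ℝ} (hc : SubExp c) (hd : SubExp d) : SubExp fun n => c n + d n :=
  fun t ht => by
    obtain ⟨K, hK⟩ := hc t ht
    obtain ⟨L, hL⟩ := hd t ht
    refine ⟨K + L, fun n => (abs_add_le _ _).trans ?_⟩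
    rw [add_mul]
    exact add_le_add (hK n) (hL n)

theorem SubExp.of_abs_le {c d : ℕ → ℝ} (hc : SubExp c) (h : ∀ n, |d n| ≤ |c n|) : SubExp d :=
  fun t ht => by
    obtain ⟨K, hK⟩ := hc t ht
    exact ⟨K, fun n => (h n).trans (hK n)⟩

/-- Using the subexponential bound at `t / 2` leaves half of the damping, a geometric series. -/
theorem SubExp.exists_summable_bound {c : ℕ → ℝ} (hc : SubExp c) {t : ℝ} (ht : 0 < t) :
    ∃ b : ℕ → ℝ, Summable b ∧ ∀ n, |c n| * Real.exp (-(n * Real.pi) * t) ≤ b n := by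
  obtain ⟨K, hK⟩ := hc (t / 2) (by positivity)
  refine ⟨fun n => K * Real.exp (-Real.pi * (t / 2)) ^ n, Summable.mul_left _
    (summable_geometric_of_lt_one (Real.exp_pos _).le
      (by rw [Real.exp_lt_one_iff]; nlinarith [Real.pi_pos])), fun n => ?_⟩
  have e : Real.exp (-Real.pi * (t / 2)) ^ n
      = Real.exp (n * Real.pi * (t / 2)) * Real.exp (-(n * Real.pi) * t) := by
    rw [← Real.exp_nat_mul, ← Real.exp_add]; ring_nf
  simp only
  rw [e, ← mul_assoc]
  exact mul_le_mul_of_nonneg_right (hK n) (Real.exp_pos _).le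

/-- At `z` choose `r` with `|z| < r < 1`. The height `t = -log r / π` satisfies `exp(-nπt) = r^n`,
so the summable bound dominates the series on the disc of radius `r`. -/
theorem SubExp.differentiableOn {c : ℕ → ℝ} (hc : SubExp c) :
    DifferentiableOn ℂ (fun z : ℂ => ∑' n, (c n : ℂ) * z ^ n) (Metric.ball 0 1) := by
  intro z hz
  rw [mem_ball_zero_iff] at hz
  obtain ⟨r, hzr, hr1⟩ := exists_between hz
  have hr : 0 < r := (norm_nonneg z).trans_lt hzr
  obtain ⟨b, hb, hcb⟩ := hc.exists_summable_bound (t := -Real.log r / Real.pi)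
    (div_pos (neg_pos.2 (Real.log_neg hr hr1)) Real.pi_pos)
  have key : DifferentiableOn ℂ (fun z : ℂ => ∑' n, (c n : ℂ) * z ^ n) (Metric.ball 0 r) := by
    refine Complex.differentiableOn_tsum_of_summable_norm hb
      (fun n => ((differentiable_const _).mul (differentiable_id.pow n)).differentiableOn)
      Metric.isOpen_ball fun n w hw => ?_
    refine le_trans ?_ (hcb n)
    rw [norm_mul, norm_pow, Complex.norm_real, Real.norm_eq_abs]
    refine mul_le_mul_of_nonneg_left ?_ (abs_nonneg _)
    have e : -(n * Real.pi) * (-Real.log r / Real.pi) = n * Real.log r := by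
      field_simp
    rw [e, Real.exp_nat_mul, Real.exp_log hr]
    exact pow_le_pow_left₀ (norm_nonneg _) (mem_ball_zero_iff.1 hw).le n
  exact (key.differentiableAt (Metric.isOpen_ball.mem_nhds (mem_ball_zero_iff.2 hzr))).differentiableWithinAt

theorem SubExp.summable_discCoord {c : ℕ → ℝ} (hc : SubExp c) {ξ : ℝ × ℝ} (hξ : ξ ∈ upperHalf) :
    Summable fun n => (c n : ℂ) * discCoord ξ ^ n := by
  obtain ⟨b, hb, hcb⟩ := hc.exists_summable_bound (show 0 < ξ.2 from hξ)
  refine Summable.of_norm_bounded hb fun n => ?_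
  rw [norm_mul, norm_pow, Complex.norm_real, Real.norm_eq_abs, norm_discCoord, ← Real.exp_nat_mul]
  convert hcb n using 3
  ring

theorem SubExp.isDecaying_cos {c : ℕ → ℝ} (hc : SubExp c) (h0 : c 0 = 0) (k : ℕ) :
    ∃ v, IsDecaying v ∧ ∀ ξ ∈ upperHalf,
      v ξ = ξ.2 ^ k * ∑' n, c n * Real.exp (-(n * Real.pi) * ξ.2) * cosMode n ξ.1 := by
  refine ⟨_, IsDecaying.term k _ hc.differentiableOn ?_, fun ξ hξ => ?_⟩
  · refine (tsum_congr fun n => ?_).trans tsum_zero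
    cases n <;> simp [h0]
  · rw [Complex.re_tsum (hc.summable_discCoord hξ)]
    congr 1
    refine tsum_congr fun n => ?_
    rw [discCoord_pow, Complex.re_ofReal_mul, mul_assoc]
    congr 1
    simp only [Complex.add_re, Complex.re_ofReal_mul, Complex.I_re, mul_zero, add_zero, Complex.ofReal_re]

/-- The sine is the imaginary part of `q^n`. The factor `-i` turns it into a real part, the form
that `IsDecaying` prescribes. -/
theorem SubExp.isDecaying_sin {c : ℕ → ℝ} (hc : SubExp c) (h0 : c 0 = 0) (k : ℕ) :
    ∃ v, IsDecaying v ∧ ∀ ξ ∈ upperHalf,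
      v ξ = ξ.2 ^ k * ∑' n, c n * Real.exp (-(n * Real.pi) * ξ.2) * sinMode n ξ.1 := by
  refine ⟨_, IsDecaying.term k (fun z => -Complex.I * ∑' n, (c n : ℂ) * z ^ n)
    ((differentiableOn_const _).mul hc.differentiableOn) ?_, fun ξ hξ => ?_⟩
  · refine mul_eq_zero_of_right _ ((tsum_congr fun n => ?_).trans tsum_zero)
    cases n <;> simp [h0]
  · have e : ∀ z : ℂ, (-Complex.I * z).re = z.im := fun z => by simp
    rw [e, Complex.im_tsum (hc.summable_discCoord hξ)]
    congr 1
    refine tsum_congr fun n => ?_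
    rw [discCoord_pow, Complex.im_ofReal_mul, mul_assoc]
    congr 1
    simp only [Complex.add_im, Complex.im_ofReal_mul, Complex.I_im, mul_one, Complex.ofReal_im,
      zero_add]

end PowerSeries

/-! ### Integration over the half-strip and Fourier coefficients at fixed height. -/

section HalfStrip

variable {F : ℝ → ℝ} {u f : ℝ × ℝ → ℝ} {M η : ℝ → ℝ}

/-- Integrability on the bounded parts of the half-strip. -/
def HalfStripIntegrable (u : ℝ × ℝ → ℝ) : Prop :=
  ∀ R : ℝ, IntegrableOn u (crossSection ×ˢ Ioo 0 R)

theorem IsProfile.halfStrip_subset (hF : IsProfile F) {R : ℝ} :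
    crossSection ×ˢ Ioo 0 R ⊆ cell F ∩ {ξ | ξ.2 < R} := fun _ hξ =>
  ⟨⟨⟨hξ.1.1, hξ.1.2⟩, (hF.neg _).trans hξ.2.1⟩, hξ.2.2⟩

theorem IsProfile.volume_cell_lt_top (hF : IsProfile F) (R : ℝ) :
    volume (cell F ∩ {ξ | ξ.2 < R}) < ⊤ := by
  obtain ⟨m, -, hm⟩ := hF.exists_lower_bound
  refine lt_of_le_of_lt (measure_mono (t := crossSection ×ˢ Ioo (-m) R) ?_) ?_
  · exact fun ξ hξ => ⟨⟨hξ.1.1.1, hξ.1.1.2⟩, (hm _).trans hξ.1.2, hξ.2⟩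
  · rw [Measure.volume_eq_prod, Measure.prod_prod]
    simp [ENNReal.mul_lt_top]

theorem IsProfile.integrableOn_of_memLp (hF : IsProfile F) {R : ℝ}
    (h : MemLp u 2 (volume.restrict (cell F ∩ {ξ | ξ.2 < R}))) :
    IntegrableOn u (cell F ∩ {ξ | ξ.2 < R}) := by
  have : IsFiniteMeasure (volume.restrict (cell F ∩ {ξ : ℝ × ℝ | ξ.2 < R})) :=
    ⟨by rw [Measure.restrict_apply_univ]; exact hF.volume_cell_lt_top R⟩
  exact h.integrable (by norm_num)

theorem LocallyH1.halfStripIntegrable (hF : IsProfile F) (h : LocallyH1 F u) :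
    HalfStripIntegrable u ∧ HalfStripIntegrable (d1 u) ∧ HalfStripIntegrable (d2 u) :=
  ⟨fun R => (hF.integrableOn_of_memLp (h R).1).mono_set hF.halfStrip_subset,
    fun R => (hF.integrableOn_of_memLp (h R).2.1).mono_set hF.halfStrip_subset,
    fun R => (hF.integrableOn_of_memLp (h R).2.2).mono_set hF.halfStrip_subset⟩

/-- A line test vanishes for `t ≤ 0`, so the integral never sees the region near the curved bottom,
and the cell may be replaced by a rectangle to which Fubini applies. -/
theorem exists_setIntegral_cell_eq (hF : IsProfile F) (hη : IsLineTest η) :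
    ∃ R, (∀ t, R ≤ t → η t = 0) ∧ ∀ (u : ℝ × ℝ → ℝ) (M : ℝ → ℝ),
      ∫ ξ in cell F, u ξ * (M ξ.1 * η ξ.2) =
        ∫ ξ in crossSection ×ˢ Ioo 0 R, u ξ * (M ξ.1 * η ξ.2) := by
  obtain ⟨a, b, ha, hηa, hηb⟩ := hη.exists_support_Icc
  refine ⟨b + 1, fun t ht => hηb t (by linarith), fun u M => ?_⟩
  refine setIntegral_eq_of_subset_of_forall_sdiff_eq_zero (measurableSet_cell hF.continuous)
    (hF.halfStrip_subset.trans inter_subset_left) fun ξ hξ => ?_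
  have : η ξ.2 = 0 := by
    by_cases h1 : 0 < ξ.2
    · refine hηb _ ?_
      by_contra h2
      exact hξ.2 ⟨⟨hξ.1.1.1, hξ.1.1.2⟩, h1, by linarith⟩
    · exact hη.eq_zero (not_lt.1 h1)
  simp [this]

theorem HalfStripIntegrable.integrableOn_mul (hu : HalfStripIntegrable u) (hM : Continuous M)
    (hη : IsLineTest η) {R : ℝ} :
    IntegrableOn (fun ξ => u ξ * (M ξ.1 * η ξ.2)) (crossSection ×ˢ Ioo 0 R) := by
  refine (hu R).mul_continuousOn_of_subset (K := Icc (-(1 / 2)) (1 / 2) ×ˢ Icc 0 R)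
    (Continuous.continuousOn ?_) (measurableSet_Ioo.prod measurableSet_Ioo)
    (isCompact_Icc.prod isCompact_Icc) (prod_mono Ioo_subset_Icc_self Ioo_subset_Icc_self)
  exact (hM.comp continuous_fst).mul (hη.smooth.continuous.comp continuous_snd)

theorem HalfStripIntegrable.integrableOn_cell (hF : IsProfile F) (hu : HalfStripIntegrable u)
    (hM : Continuous M) (hη : IsLineTest η) :
    IntegrableOn (fun ξ => u ξ * (M ξ.1 * η ξ.2)) (cell F) := by
  obtain ⟨a, b, ha, hηa, hηb⟩ := hη.exists_support_Icc
  refine (hu.integrableOn_mul hM hη (R := b + 1)).of_forall_sdiff_eq_zero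
    (measurableSet_cell hF.continuous) fun ξ hξ => ?_
  have : η ξ.2 = 0 := by
    by_cases h1 : 0 < ξ.2
    · refine hηb _ ?_
      by_contra h2
      exact hξ.2 ⟨⟨hξ.1.1.1, hξ.1.1.2⟩, h1, by linarith⟩
    · exact hη.eq_zero (not_lt.1 h1)
  simp [this]

/-- The generalized Fourier coefficient of `u` over the horizontal section at height `t`. -/
noncomputable def coef (M : ℝ → ℝ) (u : ℝ × ℝ → ℝ) (t : ℝ) : ℝ :=
  ∫ s in crossSection, u (s, t) * M s

theorem HalfStripIntegrable.ae_integrableOn (hu : HalfStripIntegrable u) :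
    ∀ᵐ t, t ∈ Ioi (0 : ℝ) → IntegrableOn (fun s => u (s, t)) crossSection := by
  have h : ∀ n : ℕ, ∀ᵐ t, t ∈ Ioo (0 : ℝ) n → IntegrableOn (fun s => u (s, t)) crossSection :=
    fun n => by
      have h1 := hu n
      rw [IntegrableOn, Measure.volume_eq_prod, ← Measure.prod_restrict] at h1
      exact (ae_restrict_iff' measurableSet_Ioo).1 h1.prod_left_ae
  filter_upwards [ae_all_iff.2 h] with t ht ht0
  obtain ⟨n, hn⟩ := exists_nat_gt t
  exact ht n ⟨ht0, hn⟩

theorem HalfStripIntegrable.locallyIntegrableOn_coef (hu : HalfStripIntegrable u)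
    (hM : Continuous M) : LocallyIntegrableOn (coef M u) (Ioi 0) := by
  rw [locallyIntegrableOn_iff isOpen_Ioi.isLocallyClosed]
  intro K hK hKc
  obtain ⟨b, hb⟩ := hKc.bddAbove
  have h1 : IntegrableOn (fun ξ => u ξ * M ξ.1) (crossSection ×ˢ Ioo 0 (b + 1)) :=
    (hu (b + 1)).mul_continuousOn_of_subset (K := Icc (-(1 / 2)) (1 / 2) ×ˢ Icc 0 (b + 1))
      (hM.comp continuous_fst).continuousOn (measurableSet_Ioo.prod measurableSet_Ioo)
      (isCompact_Icc.prod isCompact_Icc) (prod_mono Ioo_subset_Icc_self Ioo_subset_Icc_self)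
  rw [IntegrableOn, Measure.volume_eq_prod, ← Measure.prod_restrict] at h1
  have h2 : IntegrableOn (coef M u) (Ioo 0 (b + 1)) := h1.integral_prod_right
  exact h2.mono_set fun t ht => ⟨hK ht, by linarith [hb ht]⟩

/-- Fubini on that rectangle: testing with `M(ξ₁)η(ξ₂)` over the cell amounts to testing the
coefficient function with `η`. -/
theorem setIntegral_cell_eq_coef (hF : IsProfile F) (hu : HalfStripIntegrable u)
    (hM : Continuous M) (hη : IsLineTest η) :
    ∫ ξ in cell F, u ξ * (M ξ.1 * η ξ.2) = ∫ t, coef M u t * η t := by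
  obtain ⟨R, hR, h⟩ := exists_setIntegral_cell_eq hF hη
  have h1 := hu.integrableOn_mul hM hη (R := R)
  rw [h, Measure.volume_eq_prod]
  rw [IntegrableOn, Measure.volume_eq_prod] at h1
  rw [← Measure.prod_restrict] at h1 ⊢
  rw [integral_prod_symm _ h1]
  have e : ∀ t, ∫ s in crossSection, u (s, t) * (M s * η t) = coef M u t * η t := fun t => by
    simp_rw [coef, ← mul_assoc]
    rw [integral_mul_const]
  simp only [e]
  refine setIntegral_eq_integral_of_forall_compl_eq_zero fun t ht => ?_
  rw [mem_Ioo, not_and_or, not_lt, not_lt] at ht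
  rw [ht.elim hη.eq_zero (hR t), mul_zero]

theorem tendsto_setIntegral_cell (hF : IsProfile F) (hu : HalfStripIntegrable u) (hη : IsLineTest η)
    {ζ : ℕ → ℝ → ℝ} (hζ : ∀ k, Continuous (ζ k)) {C : ℝ} (hC : ∀ k, ∀ s ∈ crossSection, |ζ k s| ≤ C)
    (hlim : ∀ s ∈ crossSection, Tendsto (fun k => ζ k s) atTop (𝓝 (M s))) :
    Tendsto (fun k => ∫ ξ in cell F, u ξ * (ζ k ξ.1 * η ξ.2)) atTop
      (𝓝 (∫ ξ in cell F, u ξ * (M ξ.1 * η ξ.2))) := by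
  obtain ⟨R, -, h⟩ := exists_setIntegral_cell_eq hF hη
  simp only [h]
  have hb := (hu.integrableOn_mul (M := fun _ => C) continuous_const hη (R := R)).norm
  have hms : MeasurableSet (crossSection ×ˢ Ioo 0 R) := measurableSet_Ioo.prod measurableSet_Ioo
  refine tendsto_integral_of_dominated_convergence _
    (fun k => (hu.integrableOn_mul (hζ k) hη (R := R)).aestronglyMeasurable) hb (fun k => ?_) ?_
  · refine (ae_restrict_iff' hms).2 (Eventually.of_forall fun ξ hξ => ?_)
    simp only [norm_mul, Real.norm_eq_abs]
    refine mul_le_mul_of_nonneg_left (mul_le_mul_of_nonneg_right ?_ (abs_nonneg _)) (abs_nonneg _)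
    exact (hC k _ hξ.1).trans (le_abs_self C)
  · refine (ae_restrict_iff' hms).2 (Eventually.of_forall fun ξ hξ => ?_)
    exact ((hlim _ hξ.1).mul_const _).const_mul _

end HalfStrip

/-! ### Cutoffs near the lateral sides. -/

section Cutoff

/-- The derivative lives on `[0, 1]`. The factor `x + 1` is the scaled distance to the lateral side
in `lateralCutoff`. -/
theorem exists_bound_deriv_smoothTransition :
    ∃ C : ℝ, 0 ≤ C ∧ ∀ x : ℝ, |deriv Real.smoothTransition x| * |x + 1| ≤ C := by
  have hc : Continuous (deriv Real.smoothTransition) :=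
    (Real.smoothTransition.contDiff (n := 1)).continuous_deriv le_rfl
  obtain ⟨C, hC⟩ := (isCompact_Icc (a := (0 : ℝ)) (b := 1)).exists_bound_of_continuousOn
    (f := fun x => deriv Real.smoothTransition x * (x + 1)) (by fun_prop)
  refine ⟨max C 0, le_max_right _ _, fun x => ?_⟩
  rcases lt_or_ge x 0 with h | h
  · have : Real.smoothTransition =ᶠ[𝓝 x] fun _ => 0 :=
      (eventually_lt_nhds h).mono fun y hy => Real.smoothTransition.zero_of_nonpos hy.le
    simp [this.deriv_eq]
  rcases lt_or_ge 1 x with h1 | h1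
  · have : Real.smoothTransition =ᶠ[𝓝 x] fun _ => 1 :=
      (eventually_gt_nhds h1).mono fun y hy => Real.smoothTransition.one_of_one_le hy.le
    simp [this.deriv_eq]
  · rw [← abs_mul]
    exact (hC x ⟨h, h1⟩).trans (le_max_left _ _)

/-- Smooth cutoff functions of the cross section, equal to one outside of a neighbourhood of the
end points of size `2 / (k + 1)`. -/
noncomputable def lateralCutoff (k : ℕ) (s : ℝ) : ℝ :=
  Real.smoothTransition ((k + 1) * (1 / 2 - s) - 1) * Real.smoothTransition ((k + 1) * (1 / 2 + s) - 1)

theorem contDiff_lateralCutoff (k : ℕ) : ContDiff ℝ ∞ (lateralCutoff k) := by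
  unfold lateralCutoff
  exact (Real.smoothTransition.contDiff.comp (by fun_prop)).mul
    (Real.smoothTransition.contDiff.comp (by fun_prop))

theorem abs_lateralCutoff_le (k : ℕ) (s : ℝ) : |lateralCutoff k s| ≤ 1 := by
  rw [lateralCutoff, abs_mul, abs_of_nonneg (Real.smoothTransition.nonneg _),
    abs_of_nonneg (Real.smoothTransition.nonneg _)]
  exact mul_le_one₀ (Real.smoothTransition.le_one _) (Real.smoothTransition.nonneg _)
    (Real.smoothTransition.le_one _)

theorem tsupport_lateralCutoff_subset (k : ℕ) :
    tsupport (lateralCutoff k) ⊆ Icc (-(1 / 2) + 1 / (k + 1)) (1 / 2 - 1 / (k + 1)) := by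
  refine closure_minimal (fun s hs => ?_) isClosed_Icc
  have hk : (0 : ℝ) < k + 1 := by positivity
  by_contra h
  rw [mem_Icc, not_and_or, not_le, not_le] at h
  apply hs
  simp only [lateralCutoff]
  rcases h with h | h
  · rw [Real.smoothTransition.zero_of_nonpos (x := (k + 1) * (1 / 2 + s) - 1), mul_zero]
    have := mul_lt_mul_of_pos_left h hk
    rw [mul_add, mul_one_div_cancel hk.ne'] at this
    linarith
  · rw [Real.smoothTransition.zero_of_nonpos (x := (k + 1) * (1 / 2 - s) - 1), zero_mul]
    have := mul_lt_mul_of_pos_left h hk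
    rw [mul_sub, mul_one_div_cancel hk.ne'] at this
    linarith

theorem eventually_lateralCutoff_eq_one {s : ℝ} (hs : s ∈ crossSection) :
    ∀ᶠ k in atTop, lateralCutoff k =ᶠ[𝓝 s] fun _ => 1 := by
  obtain ⟨n, hn⟩ := exists_nat_gt (max (2 / (1 / 2 - s)) (2 / (1 / 2 + s)))
  have h1 := (le_max_left _ _).trans_lt hn
  have h2 := (le_max_right _ _).trans_lt hn
  rw [div_lt_iff₀ (by linarith [hs.2])] at h1
  rw [div_lt_iff₀ (by linarith [hs.1])] at h2
  filter_upwards [eventually_ge_atTop n] with k hk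
  have hk' : (n : ℝ) ≤ k := by exact_mod_cast hk
  have c1 : ∀ᶠ x in 𝓝 s, 2 < (k + 1 : ℝ) * (1 / 2 - x) :=
    (Continuous.tendsto (by fun_prop) s).eventually (lt_mem_nhds (by nlinarith [hs.2]))
  have c2 : ∀ᶠ x in 𝓝 s, 2 < (k + 1 : ℝ) * (1 / 2 + x) :=
    (Continuous.tendsto (by fun_prop) s).eventually (lt_mem_nhds (by nlinarith [hs.1]))
  filter_upwards [c1, c2] with x h1 h2
  rw [lateralCutoff, Real.smoothTransition.one_of_one_le (by linarith),
    Real.smoothTransition.one_of_one_le (by linarith), one_mul]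

/-- The derivative grows like `k + 1`, but only where the distance to a side is comparable to `1 /
(k + 1)`. Multiplied by a lower bound `d` for the distances it is bounded uniformly in `k`. -/
theorem exists_bound_deriv_lateralCutoff :
    ∃ C : ℝ, 0 ≤ C ∧ ∀ (k : ℕ) (s d : ℝ), 0 ≤ d → d ≤ 1 / 2 - s → d ≤ 1 / 2 + s →
      |deriv (lateralCutoff k) s| * d ≤ C := by
  obtain ⟨C, hC0, hC⟩ := exists_bound_deriv_smoothTransition
  refine ⟨C + C, by positivity, fun k s d hd h1 h2 => ?_⟩
  set a : ℝ := (k + 1) * (1 / 2 - s) - 1 with ha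
  set b : ℝ := (k + 1) * (1 / 2 + s) - 1 with hb
  have hσ : ∀ x, HasDerivAt Real.smoothTransition (deriv Real.smoothTransition x) x := fun x =>
    ((Real.smoothTransition.contDiff (n := 1)).differentiable (by simp) x).hasDerivAt
  have da : HasDerivAt (fun s : ℝ => ((k : ℝ) + 1) * (1 / 2 - s) - 1) (-(k + 1)) s :=
    ((((hasDerivAt_id s).const_sub (1 / 2)).const_mul ((k : ℝ) + 1)).sub_const 1).congr_deriv (by ring)
  have db : HasDerivAt (fun s : ℝ => ((k : ℝ) + 1) * (1 / 2 + s) - 1) (k + 1) s :=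
    ((((hasDerivAt_id s).const_add (1 / 2)).const_mul ((k : ℝ) + 1)).sub_const 1).congr_deriv (by ring)
  have hd1 := (((hσ a).comp s da).mul ((hσ b).comp s db)).deriv
  have e : deriv (lateralCutoff k) s =
      deriv Real.smoothTransition a * (-(k + 1)) * Real.smoothTransition b +
      Real.smoothTransition a * (deriv Real.smoothTransition b * (k + 1)) := hd1
  have hk : (0 : ℝ) < k + 1 := by positivity
  have n1 := Real.smoothTransition.nonneg a
  have n2 := Real.smoothTransition.nonneg b
  have l1 := Real.smoothTransition.le_one a
  have l2 := Real.smoothTransition.le_one b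
  have b1 : |deriv Real.smoothTransition a| * ((k + 1) * d) ≤ C := by
    refine le_trans (mul_le_mul_of_nonneg_left ?_ (abs_nonneg _)) (hC a)
    refine le_trans ?_ (le_abs_self _)
    rw [ha, sub_add_cancel]
    exact mul_le_mul_of_nonneg_left h1 hk.le
  have b2 : |deriv Real.smoothTransition b| * ((k + 1) * d) ≤ C := by
    refine le_trans (mul_le_mul_of_nonneg_left ?_ (abs_nonneg _)) (hC b)
    refine le_trans ?_ (le_abs_self _)
    rw [hb, sub_add_cancel]
    exact mul_le_mul_of_nonneg_left h2 hk.le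
  rw [e]
  calc _ ≤ (|deriv Real.smoothTransition a * (-(k + 1)) * Real.smoothTransition b| +
      |Real.smoothTransition a * (deriv Real.smoothTransition b * (k + 1))|) * d :=
        mul_le_mul_of_nonneg_right (abs_add_le _ _) hd
    _ = |deriv Real.smoothTransition a| * ((k + 1) * d) * Real.smoothTransition b +
      Real.smoothTransition a * (|deriv Real.smoothTransition b| * ((k + 1) * d)) := by
        simp only [abs_mul, abs_neg, abs_of_pos hk, abs_of_nonneg n1, abs_of_nonneg n2]
        ring
    _ ≤ C * 1 + 1 * C := by gcongr
    _ = C + C := by ring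

theorem isTest_prod {ζ η : ℝ → ℝ} {A B : Set ℝ} (hζ : ContDiff ℝ ∞ ζ) (hζc : HasCompactSupport ζ)
    (hζA : tsupport ζ ⊆ A) (hη : ContDiff ℝ ∞ η) (hηc : HasCompactSupport η) (hηB : tsupport η ⊆ B) :
    IsTest (A ×ˢ B) (fun ξ => ζ ξ.1 * η ξ.2) := by
  have hs : tsupport (fun ξ : ℝ × ℝ => ζ ξ.1 * η ξ.2) ⊆ tsupport ζ ×ˢ tsupport η := by
    refine closure_minimal (fun ξ hξ => ⟨subset_tsupport _ ?_, subset_tsupport _ ?_⟩)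
      ((isClosed_tsupport _).prod (isClosed_tsupport _))
    · exact left_ne_zero_of_mul hξ
    · exact right_ne_zero_of_mul hξ
  exact ⟨(hζ.comp contDiff_fst).mul (hη.comp contDiff_snd),
    (hζc.isCompact.prod hηc.isCompact).of_isClosed_subset (isClosed_tsupport _) hs,
    hs.trans (prod_mono hζA hηB)⟩

theorem d1_prod (ζ η : ℝ → ℝ) (ξ : ℝ × ℝ) :
    d1 (fun ξ => ζ ξ.1 * η ξ.2) ξ = deriv ζ ξ.1 * η ξ.2 := by
  simp [d1]

theorem d2_prod (ζ η : ℝ → ℝ) (ξ : ℝ × ℝ) :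
    d2 (fun ξ => ζ ξ.1 * η ξ.2) ξ = ζ ξ.1 * deriv η ξ.2 := by
  simp [d2]

variable {F : ℝ → ℝ} {u f : ℝ × ℝ → ℝ} {M η : ℝ → ℝ}

theorem isTest_lateralCutoff_mul (hF : IsProfile F) (hM : ContDiff ℝ ∞ M) (hη : IsLineTest η) (k : ℕ) :
    IsTest (cell F) (fun ξ => (lateralCutoff k ξ.1 * M ξ.1) * η ξ.2) := by
  have h1 := tsupport_lateralCutoff_subset k
  have hk : (0 : ℝ) < 1 / (k + 1) := by positivity
  refine (isTest_prod (ζ := fun s => lateralCutoff k s * M s) (A := crossSection)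
    ((contDiff_lateralCutoff k).mul hM) (HasCompactSupport.mul_right ?_) ?_ hη.smooth hη.compact
    hη.supp).mono ?_
  · exact isCompact_Icc.of_isClosed_subset (isClosed_tsupport _) h1
  · exact (tsupport_mul_subset_left.trans h1).trans (Icc_subset_Ioo (by linarith) (by linarith))
  · exact fun ξ hξ => ⟨⟨hξ.1.1, hξ.1.2⟩, (hF.neg _).trans hξ.2⟩

/-- A test function that agrees with a given product inside the strip. -/
theorem exists_isTest_eq_on_strip (hF : IsProfile F) (hM : ContDiff ℝ ∞ M) (hη : IsLineTest η) :
    ∃ φ, IsTest (aboveGraph F) φ ∧ ∀ ξ ∈ openStrip, φ ξ = M ξ.1 * η ξ.2 ∧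
      d1 φ ξ = deriv M ξ.1 * η ξ.2 ∧ d2 φ ξ = M ξ.1 * deriv η ξ.2 := by
  let f : ContDiffBump (0 : ℝ) := ⟨1, 2, one_pos, one_lt_two⟩
  refine ⟨_, (isTest_prod (ζ := fun s => f s * M s) (A := univ) (f.contDiff.mul hM)
    (f.hasCompactSupport.mul_right) (subset_univ _) hη.smooth hη.compact
    hη.supp).mono fun ξ hξ => (hF.neg _).trans hξ.2, fun ξ hξ => ?_⟩
  have h1 : ∀ᶠ s in 𝓝 ξ.1, f s * M s = M s := by
    filter_upwards [Ioo_mem_nhds hξ.1 hξ.2] with s hs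
    rw [f.one_of_mem_closedBall, one_mul]
    rw [mem_closedBall_zero_iff, Real.norm_eq_abs, abs_le]
    exact ⟨by show (-1 : ℝ) ≤ s; linarith [hs.1], by show s ≤ (1 : ℝ); linarith [hs.2]⟩
  refine ⟨by simp only [h1.self_of_nhds], ?_, ?_⟩
  · rw [d1_prod (fun s => f s * M s), Filter.EventuallyEq.deriv_eq h1]
  · rw [d2_prod (fun s => f s * M s), h1.self_of_nhds]

theorem tendsto_setIntegral_lateralCutoff (hF : IsProfile F) (hu : HalfStripIntegrable u)
    (hM : ContDiff ℝ ∞ M) (hη : IsLineTest η) :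
    Tendsto (fun k => ∫ ξ in cell F, u ξ * ((lateralCutoff k ξ.1 * M ξ.1) * η ξ.2)) atTop
      (𝓝 (∫ ξ in cell F, u ξ * (M ξ.1 * η ξ.2))) := by
  obtain ⟨C, hC⟩ := (isCompact_Icc (a := (-(1 / 2) : ℝ)) (b := 1 / 2)).exists_bound_of_continuousOn
    hM.continuous.continuousOn
  refine tendsto_setIntegral_cell hF hu hη (ζ := fun k s => lateralCutoff k s * M s) (C := C)
    (fun k => (contDiff_lateralCutoff k).continuous.mul hM.continuous) (fun k s hs => ?_)
    (fun s hs => ?_)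
  · rw [abs_mul]
    exact (mul_le_of_le_one_left (abs_nonneg _) (abs_lateralCutoff_le k s)).trans
      (hC s (Ioo_subset_Icc_self hs))
  · refine tendsto_const_nhds.congr' ((eventually_lateralCutoff_eq_one hs).mono fun k hk => ?_)
    simp only [hk.self_of_nhds, one_mul]

/-- The derivative of `ζₖM` contains `ζₖ'M`, which is bounded uniformly in `k` exactly because `M`
vanishes linearly at both sides; away from the sides it is eventually zero. Dominated convergence
does the rest. -/
theorem tendsto_setIntegral_deriv_lateralCutoff (hF : IsProfile F) (hu : HalfStripIntegrable u)
    (hM : ContDiff ℝ ∞ M) {K : ℝ} (hK : 0 ≤ K) (hMK : ∀ s ∈ crossSection, ∃ d, 0 ≤ d ∧ d ≤ 1 / 2 - s ∧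
      d ≤ 1 / 2 + s ∧ |M s| ≤ K * d) (hη : IsLineTest η) :
    Tendsto (fun k => ∫ ξ in cell F, u ξ * (deriv (fun s => lateralCutoff k s * M s) ξ.1 * η ξ.2)) atTop
      (𝓝 (∫ ξ in cell F, u ξ * (deriv M ξ.1 * η ξ.2))) := by
  have hM' : Continuous (deriv M) := (contDiff_infty_iff_deriv.1 hM).2.continuous
  obtain ⟨C, hC⟩ := (isCompact_Icc (a := (-(1 / 2) : ℝ)) (b := 1 / 2)).exists_bound_of_continuousOn
    hM'.continuousOn
  obtain ⟨D, hD0, hD⟩ := exists_bound_deriv_lateralCutoff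
  refine tendsto_setIntegral_cell hF hu hη (ζ := fun k => deriv fun s => lateralCutoff k s * M s)
    (C := D * K + C) (fun k => ?_) (fun k s hs => ?_) (fun s hs => ?_)
  · exact (contDiff_infty_iff_deriv.1 ((contDiff_lateralCutoff k).mul hM)).2.continuous
  · obtain ⟨d, hd0, hd1, hd2, hd⟩ := hMK s hs
    have dc := ((contDiff_lateralCutoff k).differentiable (by simp) s).hasDerivAt
    have dM := (hM.differentiable (by simp) s).hasDerivAt
    rw [(dc.fun_mul dM).deriv]
    refine (abs_add_le _ _).trans (add_le_add ?_ ?_)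
    · rw [abs_mul]
      calc _ ≤ |deriv (lateralCutoff k) s| * (K * d) := mul_le_mul_of_nonneg_left hd (abs_nonneg _)
        _ = |deriv (lateralCutoff k) s| * d * K := by ring
        _ ≤ D * K := mul_le_mul_of_nonneg_right (hD k s d hd0 hd1 hd2) hK
    · rw [abs_mul]
      exact (mul_le_of_le_one_left (abs_nonneg _) (abs_lateralCutoff_le k s)).trans
        (hC s (Ioo_subset_Icc_self hs))
  · refine tendsto_const_nhds.congr' ((eventually_lateralCutoff_eq_one hs).mono fun k hk => ?_)
    have : (fun s => lateralCutoff k s * M s) =ᶠ[𝓝 s] M := hk.mono fun x hx => by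
      simp only at hx ⊢
      rw [hx, one_mul]
    simp only [this.deriv_eq]

end Cutoff

/-! ### Derivatives and boundary behaviour of the modes. -/

section Modes

theorem contDiff_cosMode (n : ℕ) : ContDiff ℝ ∞ (cosMode n) := by unfold cosMode; fun_prop

theorem contDiff_sinMode (n : ℕ) : ContDiff ℝ ∞ (sinMode n) := by unfold sinMode; fun_prop

theorem deriv_cosMode (n : ℕ) : deriv (cosMode n) = fun s => -(n * Real.pi) * sinMode n s := by
  funext s
  refine ((((hasDerivAt_id s).add_const (1 / 2)).const_mul (n * Real.pi)).cos).deriv.trans ?_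
  simp [sinMode]
  ring

theorem deriv_sinMode (n : ℕ) : deriv (sinMode n) = fun s => n * Real.pi * cosMode n s := by
  funext s
  refine ((((hasDerivAt_id s).add_const (1 / 2)).const_mul (n * Real.pi)).sin).deriv.trans ?_
  simp [cosMode]
  ring

/-- The sine vanishes at both end points: near the right one, shifting the argument by `nπ` only
changes the sign. The distance to the nearer end point serves as `d`. -/
theorem abs_sinMode_le_dist (n : ℕ) {s : ℝ} (hs : s ∈ crossSection) :
    ∃ d, 0 ≤ d ∧ d ≤ 1 / 2 - s ∧ d ≤ 1 / 2 + s ∧ |sinMode n s| ≤ n * Real.pi * d := by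
  have h1 := hs.1
  have h2 := hs.2
  have hπ := Real.pi_pos
  refine ⟨min (1 / 2 - s) (1 / 2 + s), le_min (by linarith) (by linarith), min_le_left _ _,
    min_le_right _ _, ?_⟩
  rw [mul_min_of_nonneg _ _ (by positivity)]
  refine le_min ?_ ?_
  · have : sinMode n s = (-1) ^ n * Real.sin (n * Real.pi * (s - 1 / 2)) := by
      have e : n * Real.pi * (s + 1 / 2) = n * Real.pi * (s - 1 / 2) + n * Real.pi := by ring
      rw [sinMode, e, Real.sin_add_nat_mul_pi]
    rw [this, abs_mul, abs_pow, abs_neg, abs_one, one_pow, one_mul]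
    refine (Real.abs_sin_le_abs).trans ?_
    rw [abs_mul, abs_of_nonneg (by positivity), abs_sub_comm, abs_of_pos (by linarith)]
  · refine (Real.abs_sin_le_abs).trans ?_
    rw [abs_mul, abs_of_nonneg (by positivity), add_comm, abs_of_pos (by linarith)]

end Modes

/-! ### Weak equations satisfied by the Fourier coefficients. -/

section WeakIdentities

variable {F : ℝ → ℝ} {u f : ℝ × ℝ → ℝ} {M η : ℝ → ℝ}

theorem ZeroTraceIn.mono {S T : Set (ℝ × ℝ)} (h : ZeroTraceIn F T u) (hST : S ⊆ T) :
    ZeroTraceIn F S u := fun φ hφ => h φ (hφ.mono hST)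

theorem cell_subset_openStrip : cell F ⊆ openStrip := inter_subset_left

/-- A vertical derivative is tangential to the lateral sides, so `M` need not vanish there: the
lateral cutoffs are not differentiated and can be removed in the limit. -/
theorem setIntegral_mul_deriv_snd (hF : IsProfile F) (h0 : ZeroTraceIn F openStrip u)
    (hu : LocallyH1 F u) (hM : ContDiff ℝ ∞ M) (hη : IsLineTest η) :
    ∫ ξ in cell F, u ξ * (M ξ.1 * deriv η ξ.2) = -∫ ξ in cell F, d2 u ξ * (M ξ.1 * η ξ.2) := by
  obtain ⟨i0, -, i2⟩ := hu.halfStripIntegrable hF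
  refine tendsto_nhds_unique (tendsto_setIntegral_lateralCutoff hF i0 hM hη.deriv)
    (((tendsto_setIntegral_lateralCutoff hF i2 hM hη).neg).congr fun k => ?_)
  rw [← (h0 _ ((isTest_lateralCutoff_mul hF hM hη k).mono cell_subset_openStrip)).2]
  simp only [d2_prod (fun s => lateralCutoff k s * M s)]

/-- No condition on `u` at the lateral sides is needed, since the sine vanishes there. -/
theorem setIntegral_d1_mul_sinMode (hF : IsProfile F) (h0 : ZeroTraceIn F openStrip u)
    (hu : LocallyH1 F u) (n : ℕ) (hη : IsLineTest η) :
    ∫ ξ in cell F, d1 u ξ * (sinMode n ξ.1 * η ξ.2) =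
      -(n * Real.pi) * ∫ ξ in cell F, u ξ * (cosMode n ξ.1 * η ξ.2) := by
  obtain ⟨i0, i1, -⟩ := hu.halfStripIntegrable hF
  have h1 := tendsto_setIntegral_deriv_lateralCutoff hF i0 (contDiff_sinMode n)
    (K := n * Real.pi) (by positivity) (fun s hs => abs_sinMode_le_dist n hs) hη
  have h2 := tendsto_nhds_unique h1
    (((tendsto_setIntegral_lateralCutoff hF i1 (contDiff_sinMode n) hη).neg).congr fun k => by
      rw [← (h0 _ ((isTest_lateralCutoff_mul hF (contDiff_sinMode n) hη k).mono
        cell_subset_openStrip)).1]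
      simp only [d1_prod (fun s => lateralCutoff k s * sinMode n s)])
  rw [← neg_eq_iff_eq_neg] at h2
  rw [← h2, deriv_sinMode, neg_mul, ← integral_const_mul]
  congr 2
  funext ξ
  ring

/-- The cosine does not vanish on the lateral sides, so here the zero trace of `u` on the whole
boundary removes the boundary terms. For `n = 0` it says that `d1 u` has vanishing mean over the
cross sections, in the weak sense. -/
theorem setIntegral_d1_mul_cosMode (hF : IsProfile F) (h0 : ZeroTraceIn F univ u)
    (n : ℕ) (hη : IsLineTest η) :
    ∫ ξ in cell F, d1 u ξ * (cosMode n ξ.1 * η ξ.2) =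
      (n * Real.pi) * ∫ ξ in cell F, u ξ * (sinMode n ξ.1 * η ξ.2) := by
  obtain ⟨φ, hφ, e⟩ := exists_isTest_eq_on_strip hF (contDiff_cosMode n) hη
  have h1 := (h0 φ (hφ.mono (subset_univ _))).1
  rw [setIntegral_congr_fun (measurableSet_cell hF.continuous)
      (g := fun ξ => -(n * Real.pi) * (u ξ * (sinMode n ξ.1 * η ξ.2)))
      (fun ξ hξ => by simp only [(e ξ hξ.1).2.1, deriv_cosMode]; ring),
    integral_const_mul] at h1
  rw [setIntegral_congr_fun (measurableSet_cell hF.continuous)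
      (g := fun ξ => d1 u ξ * φ ξ) (fun ξ hξ => by simp only [(e ξ hξ.1).1])]
  linarith

/-- The product `cosMode n * η` is admissible in the variational identity. The horizontal derivative
of the cosine is a sine, against which `d1 u` may be integrated by parts without knowing the trace
of `u` on the sides. -/
theorem weak_ode_cosMode (hF : IsProfile F) (hu : IsMixedSolution F f u)
    (n : ℕ) (hη : IsLineTest η) :
    ∫ t, coef (cosMode n) u t * (deriv (deriv η) t - (n * Real.pi) ^ 2 * η t) =
      ∫ ξ in cell F, f ξ * (cosMode n ξ.1 * η ξ.2) := by
  obtain ⟨i0, i1, i2⟩ := hu.locallyH1.halfStripIntegrable hF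
  obtain ⟨φ, hφ, e⟩ := exists_isTest_eq_on_strip hF (contDiff_cosMode n) hη
  have h1 := hu.variational φ hφ
  rw [setIntegral_congr_fun (measurableSet_cell hF.continuous)
      (g := fun ξ => -(n * Real.pi) * (d1 u ξ * (sinMode n ξ.1 * η ξ.2)) +
        d2 u ξ * (cosMode n ξ.1 * deriv η ξ.2))
      (fun ξ hξ => by simp only [(e ξ hξ.1).2.1, (e ξ hξ.1).2.2, deriv_cosMode]; ring),
    integral_add ((i1.integrableOn_cell hF (continuous_sinMode n) hη).const_mul _)
      (i2.integrableOn_cell hF (continuous_cosMode n) hη.deriv), integral_const_mul,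
    setIntegral_d1_mul_sinMode hF hu.bottom hu.locallyH1 n hη] at h1
  have h2 := setIntegral_mul_deriv_snd hF hu.bottom hu.locallyH1 (contDiff_cosMode n) hη.deriv
  rw [setIntegral_congr_fun (measurableSet_cell hF.continuous)
      (g := fun ξ => f ξ * φ ξ) (fun ξ hξ => by simp only [(e ξ hξ.1).1])]
  have hc := i0.locallyIntegrableOn_coef (continuous_cosMode n)
  simp_rw [mul_sub, mul_left_comm (coef _ _ _) ((_ : ℝ) ^ 2)]
  rw [integral_sub (hη.deriv.deriv.integrable_mul hc) ((hη.integrable_mul hc).const_mul _),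
    integral_const_mul, ← setIntegral_cell_eq_coef hF i0 (continuous_cosMode n) hη,
    ← setIntegral_cell_eq_coef hF i0 (continuous_cosMode n) hη.deriv.deriv]
  linarith

/-- A Dirichlet solution comes with a pointwise equation only, so it is tested with sines cut off
near the sides. The cutoff is removed because the sine vanishes linearly there, and the zero lateral
trace of `u` permits the second integration by parts, now against a cosine. -/
theorem weak_ode_sinMode (hF : IsProfile F) (hu : IsDirichletSolution F f u)
    (hfi : HalfStripIntegrable f) (n : ℕ) (hη : IsLineTest η) :
    ∫ t, coef (sinMode n) u t * (deriv (deriv η) t - (n * Real.pi) ^ 2 * η t) =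
      ∫ ξ in cell F, f ξ * (sinMode n ξ.1 * η ξ.2) := by
  obtain ⟨i0, i1, i2⟩ := hu.locallyH1.halfStripIntegrable hF
  have hO := isOpen_cell hF.continuous
  have hms := measurableSet_cell hF.continuous
  have hS := contDiff_sinMode n
  have key : ∀ k, (∫ ξ in cell F, d1 u ξ * (deriv (fun s => lateralCutoff k s * sinMode n s) ξ.1 * η ξ.2)) +
      (∫ ξ in cell F, d2 u ξ * ((lateralCutoff k ξ.1 * sinMode n ξ.1) * deriv η ξ.2)) =
      -∫ ξ in cell F, f ξ * ((lateralCutoff k ξ.1 * sinMode n ξ.1) * η ξ.2) := fun k => by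
    have ht := isTest_lateralCutoff_mul hF hS hη k
    have e1 := integral_mul_d1 hO (contDiffOn_d1 hO hu.smooth) ht
    have e2 := integral_mul_d2 hO (contDiffOn_d2 hO hu.smooth) ht
    have a1 := integrable_mul_test (contDiffOn_d1 hO (contDiffOn_d1 hO hu.smooth)).continuousOn ht
    have a2 := integrable_mul_test (contDiffOn_d2 hO (contDiffOn_d2 hO hu.smooth)).continuousOn ht
    rw [← ht.d1.setIntegral_eq] at e1
    rw [← ht.d2.setIntegral_eq] at e2
    rw [← ht.setIntegral_eq] at e1 e2
    simp only [d1_prod (fun s => lateralCutoff k s * sinMode n s)] at e1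
    simp only [d2_prod (fun s => lateralCutoff k s * sinMode n s)] at e2
    rw [e1, e2, ← neg_add, ← integral_add a1.integrableOn a2.integrableOn]
    congr 1
    refine setIntegral_congr_fun hms fun ξ hξ => ?_
    rw [← hu.equation ξ hξ, lap]
    ring
  have l1 := tendsto_setIntegral_deriv_lateralCutoff hF i1 hS (K := n * Real.pi) (by positivity)
    (fun s hs => abs_sinMode_le_dist n hs) hη
  have l2 := tendsto_setIntegral_lateralCutoff hF i2 hS hη.deriv
  have l3 := (tendsto_setIntegral_lateralCutoff hF hfi hS hη).neg
  have h1 := tendsto_nhds_unique ((l1.add l2).congr key) l3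
  have h2 := setIntegral_mul_deriv_snd hF (hu.boundary.mono (subset_univ _)) hu.locallyH1 hS hη.deriv
  have h3 : ∫ ξ in cell F, d1 u ξ * (deriv (sinMode n) ξ.1 * η ξ.2) =
      n * Real.pi * ∫ ξ in cell F, d1 u ξ * (cosMode n ξ.1 * η ξ.2) := by
    rw [deriv_sinMode, ← integral_const_mul]
    congr 1
    funext ξ
    ring
  rw [h3, setIntegral_d1_mul_cosMode hF hu.boundary n hη] at h1
  have hc := i0.locallyIntegrableOn_coef (continuous_sinMode n)
  simp_rw [mul_sub, mul_left_comm (coef _ _ _) ((_ : ℝ) ^ 2)]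
  rw [integral_sub (hη.deriv.deriv.integrable_mul hc) ((hη.integrable_mul hc).const_mul _),
    integral_const_mul, ← setIntegral_cell_eq_coef hF i0 (continuous_sinMode n) hη,
    ← setIntegral_cell_eq_coef hF i0 (continuous_sinMode n) hη.deriv.deriv]
  linarith

end WeakIdentities

/-! ### Recovering a function from exponentially damped coefficients. -/

section Series

variable {M : ℕ → ℝ → ℝ}

/-- A bounded, orthogonal and complete system of modes whose exponentially damped series are
decaying functions. -/
structure IsModeSystem (M : ℕ → ℝ → ℝ) : Prop where
  continuous : ∀ n, Continuous (M n)
  abs_le : ∀ n s, |M n s| ≤ 1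
  orthogonal : ∀ m n, n ≠ 0 → ∫ s in crossSection, M m s * M n s = if m = n then 1 / 2 else 0
  complete : ∀ g : ℝ → ℝ, IntegrableOn g crossSection →
    (∀ n, ∫ s in crossSection, g s * M n s = 0) → ∀ᵐ s, s ∈ crossSection → g s = 0
  decaying : ∀ c : ℕ → ℝ, SubExp c → c 0 = 0 → ∀ k : ℕ, ∃ v, IsDecaying v ∧ ∀ ξ ∈ upperHalf,
    v ξ = ξ.2 ^ k * ∑' n, c n * Real.exp (-(n * Real.pi) * ξ.2) * M n ξ.1

theorem isModeSystem_cosMode : IsModeSystem cosMode :=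
  ⟨continuous_cosMode, abs_cosMode_le, integral_cosMode_mul_cosMode,
    fun _ => ae_eq_zero_of_cosMode, fun _ hc h0 k => hc.isDecaying_cos h0 k⟩

theorem isModeSystem_sinMode : IsModeSystem sinMode :=
  ⟨continuous_sinMode, abs_sinMode_le, integral_sinMode_mul_sinMode,
    fun _ => ae_eq_zero_of_sinMode, fun _ hc h0 k => hc.isDecaying_sin h0 k⟩

theorem IsModeSystem.continuous_tsum (hM : IsModeSystem M) {y : ℕ → ℝ} (hy : Summable fun n => |y n|) :
    Continuous fun s => ∑' n, y n * M n s :=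
  _root_.continuous_tsum (fun n => continuous_const.mul (hM.continuous n)) hy fun n s => by
    rw [norm_mul]
    exact mul_le_of_le_one_right (norm_nonneg _) (hM.abs_le n s)

/-- Termwise integration against an orthogonal system. The condition `y 0 = 0` is needed because the
mode of order zero is not normalised to `1/2`. -/
theorem IsModeSystem.integral_tsum_mul (hM : IsModeSystem M) {y : ℕ → ℝ}
    (hy : Summable fun n => |y n|) (h0 : y 0 = 0) (m : ℕ) :
    ∫ s in crossSection, (∑' n, y n * M n s) * M m s = y m / 2 := by
  have hvol : (volume.real crossSection) = 1 := by
    simp [measureReal_def]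
    norm_num
  have hint : ∀ {f : ℝ → ℝ}, Continuous f → IntegrableOn f crossSection := fun hf =>
    (hf.integrableOn_Icc).mono_set Ioo_subset_Icc_self
  have i1 : ∀ n, IntegrableOn (fun s => y n * M n s * M m s) crossSection := fun n =>
    hint ((continuous_const.mul (hM.continuous n)).mul (hM.continuous m))
  have hs : Summable fun n => ∫ s in crossSection, ‖y n * M n s * M m s‖ := by
    refine Summable.of_nonneg_of_le (fun n => integral_nonneg fun _ => norm_nonneg _) (fun n => ?_) hy
    calc _ ≤ ∫ s in crossSection, |y n| := by
          refine integral_mono (i1 n).norm (hint continuous_const) fun s => ?_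
          simp only [norm_mul, Real.norm_eq_abs]
          rw [mul_assoc]
          exact mul_le_of_le_one_right (abs_nonneg _)
            (mul_le_one₀ (hM.abs_le n s) (abs_nonneg _) (hM.abs_le m s))
      _ = |y n| := by rw [setIntegral_const, hvol, one_smul]
  simp_rw [← tsum_mul_right]
  rw [← integral_tsum_of_summable_integral_norm i1 hs, tsum_eq_single m]
  · simp_rw [mul_assoc]
    rw [integral_const_mul]
    rcases eq_or_ne m 0 with rfl | hm
    · simp [h0]
    · rw [hM.orthogonal m m hm, if_pos rfl]
      ring
  · intro n hn
    simp_rw [mul_assoc]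
    rw [integral_const_mul]
    rcases eq_or_ne n 0 with rfl | hn0
    · simp [h0]
    · simp_rw [mul_comm (M n _)]
      rw [hM.orthogonal m n hn0, if_neg hn.symm, mul_zero]

/-- A function on the half-strip whose coefficients are exponentially damped polynomials is a
decaying function. -/
theorem IsModeSystem.exists_isDecaying (hM : IsModeSystem M) {u : ℝ × ℝ → ℝ}
    (hu : ContinuousOn u (openStrip ∩ upperHalf)) (hi : HalfStripIntegrable u) {c₀ c₁ c₂ : ℕ → ℝ}
    (h₁ : SubExp c₁) (h₂ : SubExp c₂) (z₀ : c₀ 0 = 0) (z₁ : c₁ 0 = 0) (z₂ : c₂ 0 = 0)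
    (hc : ∀ n, ∀ᵐ t, t ∈ Ioi (0 : ℝ) →
      coef (M n) u t = (c₀ n + c₁ n * t + c₂ n * t ^ 2) * Real.exp (-(n * Real.pi) * t)) :
    SubExp c₀ ∧ ∃ v, IsDecaying v ∧ EqOn u v (openStrip ∩ upperHalf) := by
  have hgood : ∀ᵐ t, t ∈ Ioi (0 : ℝ) → IntegrableOn (fun s => u (s, t)) crossSection ∧
      ∀ n, coef (M n) u t = (c₀ n + c₁ n * t + c₂ n * t ^ 2) * Real.exp (-(n * Real.pi) * t) := by
    filter_upwards [hi.ae_integrableOn, ae_all_iff.2 hc] with t h1 h2 ht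
    exact ⟨h1 ht, fun n => h2 n ht⟩
  have h₀ : SubExp c₀ := by
    intro t₀ ht₀
    -- At one good height `t < t₀` all coefficients are bounded by the `L¹` norm of the slice.
    -- Solving for `c₀ n` costs a factor `exp(nπt) ≤ exp(nπt₀)`, which is the subexponential bound.
    obtain ⟨t, ht0, htt, ht⟩ := exists_gt_of_ae hgood ht₀
    obtain ⟨hti, htc⟩ := ht ht0
    obtain ⟨K₁, hK₁⟩ := h₁ t₀ ht₀
    obtain ⟨K₂, hK₂⟩ := h₂ t₀ ht₀
    set N := ∫ s in crossSection, |u (s, t)| with hN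
    have hN0 : 0 ≤ N := integral_nonneg fun _ => abs_nonneg _
    refine ⟨N + K₁ * t + K₂ * t ^ 2, fun n => ?_⟩
    have e1 : |coef (M n) u t| ≤ N := by
      refine (abs_integral_le_integral_abs).trans
        (integral_mono (integrableOn_crossSection_mul hti (hM.continuous n)).abs hti.abs fun s => ?_)
      simp only [abs_mul]
      exact mul_le_of_le_one_right (abs_nonneg _) (hM.abs_le n s)
    have e2 : c₀ n = coef (M n) u t * Real.exp (n * Real.pi * t) - c₁ n * t - c₂ n * t ^ 2 := by
      rw [htc n, mul_assoc, ← Real.exp_add]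
      simp
      ring
    have e3 : Real.exp (n * Real.pi * t) ≤ Real.exp (n * Real.pi * t₀) :=
      Real.exp_le_exp.2 (mul_le_mul_of_nonneg_left htt.le (by positivity))
    have e4 : |coef (M n) u t * Real.exp (n * Real.pi * t)| ≤ N * Real.exp (n * Real.pi * t₀) := by
      rw [abs_mul, abs_of_pos (Real.exp_pos _)]
      exact mul_le_mul e1 e3 (Real.exp_pos _).le hN0
    have e5 : |c₁ n * t| ≤ K₁ * t * Real.exp (n * Real.pi * t₀) := by
      rw [abs_mul, abs_of_pos ht0, mul_right_comm]
      exact mul_le_mul_of_nonneg_right (hK₁ n) ht0.le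
    have e6 : |c₂ n * t ^ 2| ≤ K₂ * t ^ 2 * Real.exp (n * Real.pi * t₀) := by
      rw [abs_mul, abs_of_pos (pow_pos ht0 2), mul_right_comm]
      exact mul_le_mul_of_nonneg_right (hK₂ n) (sq_nonneg t)
    rw [e2]
    refine (abs_sub _ _).trans ((add_le_add (abs_sub _ _) le_rfl).trans ?_)
    linarith
  refine ⟨h₀, ?_⟩
  -- The factor `2` compensates the normalisation `1/2` of the modes.
  obtain ⟨v₀, hv₀, ev₀⟩ := hM.decaying _ (h₀.const_mul 2) (by simp [z₀]) 0
  obtain ⟨v₁, hv₁, ev₁⟩ := hM.decaying _ (h₁.const_mul 2) (by simp [z₁]) 1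
  obtain ⟨v₂, hv₂, ev₂⟩ := hM.decaying _ (h₂.const_mul 2) (by simp [z₂]) 2
  refine ⟨_, (hv₀.add hv₁).add hv₂, ?_⟩
  set v := fun ξ => v₀ ξ + v₁ ξ + v₂ ξ with hv
  have hvc : ContinuousOn v upperHalf := ((hv₀.add hv₁).add hv₂).contDiffOn.continuousOn
  have hsum : ∀ {c : ℕ → ℝ}, SubExp c → ∀ {t : ℝ}, 0 < t →
      Summable fun n => |c n * Real.exp (-(n * Real.pi) * t)| := fun {c} hc t ht => by
    obtain ⟨b, hb, hcb⟩ := hc.exists_summable_bound ht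
    refine Summable.of_nonneg_of_le (fun n => abs_nonneg _) (fun n => ?_) hb
    rw [abs_mul, abs_of_pos (Real.exp_pos _)]
    exact hcb n
  have key : ∀ᵐ t, t ∈ Ioi (0 : ℝ) → ∀ s ∈ crossSection, u (s, t) = v (s, t) := by
    filter_upwards [hgood] with t ht ht0
    obtain ⟨hti, htc⟩ := ht ht0
    have ht0' : (0 : ℝ) < t := ht0
    set y : ℕ → ℝ := fun n => (2 * c₀ n) * Real.exp (-(n * Real.pi) * t) +
      t * ((2 * c₁ n) * Real.exp (-(n * Real.pi) * t)) +
      t ^ 2 * ((2 * c₂ n) * Real.exp (-(n * Real.pi) * t)) with hy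
    have s0 := (hsum (h₀.const_mul 2) ht0')
    have s1 := (hsum (h₁.const_mul 2) ht0')
    have s2 := (hsum (h₂.const_mul 2) ht0')
    have hys : Summable fun n => |y n| := by
      refine Summable.of_nonneg_of_le (fun n => abs_nonneg _) (fun n => ?_)
        ((s0.add (s1.mul_left t)).add (s2.mul_left (t ^ 2)))
      refine (abs_add_le _ _).trans (add_le_add ((abs_add_le _ _).trans (add_le_add le_rfl ?_)) ?_)
      · rw [abs_mul, abs_of_pos ht0']
      · rw [abs_mul, abs_of_pos (pow_pos ht0' 2)]
    have hsM : ∀ {z : ℕ → ℝ}, (Summable fun n => |z n|) → ∀ s, Summable fun n => z n * M n s :=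
      fun hz s => Summable.of_norm_bounded hz fun n => by
        rw [norm_mul]
        exact mul_le_of_le_one_right (norm_nonneg _) (hM.abs_le n s)
    have hvy : ∀ s, v (s, t) = ∑' n, y n * M n s := fun s => by
      have hmem : (s, t) ∈ upperHalf := ht0'
      rw [hv]
      simp only
      rw [ev₀ _ hmem, ev₁ _ hmem, ev₂ _ hmem]
      simp only [pow_zero, one_mul, pow_one]
      rw [← tsum_mul_left, ← tsum_mul_left, ← (hsM s0 s).tsum_add ((hsM s1 s).mul_left t),
        ← ((hsM s0 s).add ((hsM s1 s).mul_left t)).tsum_add ((hsM s2 s).mul_left (t ^ 2))]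
      refine tsum_congr fun n => ?_
      rw [hy]
      ring
    have hvc' : Continuous fun s => ∑' n, y n * M n s := hM.continuous_tsum hys
    have hvi : IntegrableOn (fun s => ∑' n, y n * M n s) crossSection :=
      hvc'.integrableOn_Icc.mono_set Ioo_subset_Icc_self
    -- At a good height `u` and the series have the same coefficients, so completeness makes them
    -- equal almost everywhere on the slice, and continuity in `s` makes them equal everywhere on
    -- it.
    have hae := hM.complete (fun s => u (s, t) - ∑' n, y n * M n s) (hti.sub hvi) fun n => by
      simp_rw [sub_mul]
      rw [integral_sub (integrableOn_crossSection_mul hti (hM.continuous n))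
        (integrableOn_crossSection_mul hvi (hM.continuous n)),
        hM.integral_tsum_mul hys (by simp [hy, z₀, z₁, z₂]) n]
      have := htc n
      rw [coef] at this
      rw [this, hy]
      ring
    have huc : ContinuousOn (fun s => u (s, t)) crossSection :=
      hu.comp (by fun_prop) fun s hs => ⟨⟨hs.1, hs.2⟩, ht0'⟩
    have := Measure.eqOn_open_of_ae_eq (μ := volume) (U := crossSection) (f := fun s => u (s, t))
      (g := fun s => ∑' n, y n * M n s)
      ((ae_restrict_iff' measurableSet_Ioo).2 (hae.mono fun s hs h => sub_eq_zero.1 (hs h)))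
      isOpen_Ioo huc hvc'.continuousOn
    intro s hs
    exact (this hs).trans (hvy s).symm
  -- The exceptional heights do not depend on `s`; continuity in `t` for fixed `s` removes them.
  rintro ⟨s, t⟩ ⟨hs, ht⟩
  have huc : ContinuousOn (fun t => u (s, t)) (Ioi 0) :=
    hu.comp (by fun_prop) fun t ht => ⟨hs, ht⟩
  have hvc : ContinuousOn (fun t => v (s, t)) (Ioi 0) :=
    hvc.comp (by fun_prop) fun t ht => ht
  exact Measure.eqOn_open_of_ae_eq (μ := volume) (U := Ioi 0) (f := fun t => u (s, t))
    (g := fun t => v (s, t))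
    ((ae_restrict_iff' measurableSet_Ioi).2 (key.mono fun t h ht => h ht s ⟨hs.1, hs.2⟩))
    isOpen_Ioi huc hvc ht

end Series

/-! ### Expansions of `X`, `X̃` and `Y` in the half-strip. -/

section Expansion

variable {F : ℝ → ℝ} {u X Xt Y : ℝ × ℝ → ℝ}

theorem HalfStripIntegrable.sub_affine (hi : HalfStripIntegrable u) (A B : ℝ) :
    HalfStripIntegrable fun ξ => u ξ - (A + B * ξ.2) := fun R =>
  (hi R).sub (((Continuous.continuousOn (by fun_prop)).integrableOn_compact
    (isCompact_Icc.prod isCompact_Icc)).mono_set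
    (prod_mono Ioo_subset_Icc_self Ioo_subset_Icc_self))

/-- The constant cosine mode is not damped. Subtracting its affine coefficient changes no other
coefficient and leaves a function to which the mode expansion applies. -/
theorem exists_isDecaying_cosMode (hu : ContinuousOn u (openStrip ∩ upperHalf))
    (hi : HalfStripIntegrable u) {A B : ℝ} {c₀ c₁ c₂ : ℕ → ℝ}
    (h₁ : SubExp c₁) (h₂ : SubExp c₂) (z₀ : c₀ 0 = 0) (z₁ : c₁ 0 = 0) (z₂ : c₂ 0 = 0)
    (hAB : ∀ᵐ t, t ∈ Ioi (0 : ℝ) → coef (cosMode 0) u t = A + B * t)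
    (hc : ∀ n, n ≠ 0 → ∀ᵐ t, t ∈ Ioi (0 : ℝ) →
      coef (cosMode n) u t = (c₀ n + c₁ n * t + c₂ n * t ^ 2) * Real.exp (-(n * Real.pi) * t)) :
    SubExp c₀ ∧ ∃ v, IsDecaying v ∧ ∀ ξ ∈ openStrip ∩ upperHalf, u ξ = A + B * ξ.2 + v ξ := by
  have hvol : (volume.real crossSection) = 1 := by
    simp [measureReal_def]
    norm_num
  have key := isModeSystem_cosMode.exists_isDecaying
    (u := fun ξ => u ξ - (A + B * ξ.2)) (hu.sub (Continuous.continuousOn (by fun_prop)))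
    (hi.sub_affine A B) h₁ h₂ z₀ z₁ z₂ fun n => ?_
  · obtain ⟨h0, v, hv, e⟩ := key
    exact ⟨h0, v, hv, fun ξ hξ => by rw [← e hξ]; ring⟩
  have hcoef : ∀ t, IntegrableOn (fun s => u (s, t)) crossSection →
      coef (cosMode n) (fun ξ => u ξ - (A + B * ξ.2)) t =
        coef (cosMode n) u t - (A + B * t) * ∫ s in crossSection, cosMode n s := fun t ht => by
    simp only [coef, sub_mul]
    have i2 : IntegrableOn (cosMode n) crossSection :=
      (continuous_cosMode n).integrableOn_Icc.mono_set Ioo_subset_Icc_self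
    rw [integral_sub (integrableOn_crossSection_mul ht (continuous_cosMode n)) (i2.const_mul _),
      integral_const_mul]
  rcases eq_or_ne n 0 with rfl | hn
  · filter_upwards [hi.ae_integrableOn, hAB] with t h1 h2 ht
    rw [hcoef t (h1 ht), h2 ht, cosMode_zero, setIntegral_const, hvol]
    simp [z₀, z₁, z₂]
  · filter_upwards [hi.ae_integrableOn, hc n hn] with t h1 h2 ht
    have := integral_cosMode_mul_cosMode 0 n hn
    simp only [cosMode_zero, one_mul] at this
    rw [hcoef t (h1 ht), h2 ht, this, if_neg hn.symm, mul_zero, sub_zero]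

theorem abs_coef_le {M : ℝ → ℝ} (hM : ∀ s, |M s| ≤ 1) {t K : ℝ}
    (h : ∀ s ∈ crossSection, |u (s, t)| ≤ K) : |coef M u t| ≤ K := by
  have hvol : (volume.real crossSection) = 1 := by
    simp [measureReal_def]
    norm_num
  have := norm_setIntegral_le_of_norm_le_const (μ := volume) (s := crossSection)
    (f := fun s => u (s, t) * M s) (C := K) (by simp) fun s hs => by
      rw [norm_mul]
      exact (mul_le_of_le_one_right (norm_nonneg _) (hM s)).trans (h s hs)
  rwa [hvol, mul_one] at this

theorem mem_cell_of_pos (hF : IsProfile F) {s t : ℝ} (hs : s ∈ crossSection) (ht : 0 < t) :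
    (s, t) ∈ cell F := ⟨⟨hs.1, hs.2⟩, (hF.neg s).trans ht⟩

theorem eventually_atInfty {P : ℝ × ℝ → Prop} (hF : IsProfile F) (h : ∀ᶠ ξ in atInfty F, P ξ) :
    ∀ᶠ t in atTop, ∀ s ∈ crossSection, P (s, t) := by
  rw [atInfty, eventually_inf_principal, eventually_comap] at h
  filter_upwards [h, eventually_gt_atTop 0] with t ht ht0 s hs
  exact ht (s, t) rfl (mem_cell_of_pos hF hs ht0)

theorem openStrip_inter_upperHalf_subset (hF : IsProfile F) : openStrip ∩ upperHalf ⊆ cell F :=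
  fun _ hξ => ⟨hξ.1, (hF.neg _).trans hξ.2⟩

theorem IsX.expansion (hF : IsProfile F) (hX : IsX F X) :
    ∃ (A : ℝ) (a : ℕ → ℝ), SubExp a ∧ a 0 = 0 ∧
      (∀ n, n ≠ 0 → ∀ᵐ t, t ∈ Ioi (0 : ℝ) →
        coef (cosMode n) X t = a n * Real.exp (-(n * Real.pi) * t)) ∧
      ∃ v, IsDecaying v ∧ ∀ ξ ∈ openStrip ∩ upperHalf, X ξ = A + 1 * ξ.2 + v ξ := by
  obtain ⟨hX, hasy⟩ := hX
  obtain ⟨i0, -, -⟩ := hX.locallyH1.halfStripIntegrable hF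
  have hgrow : ∀ ε : ℝ, 0 < ε → ∀ᶠ t in atTop, ∀ s ∈ crossSection, |X (s, t) - t| ≤ ε * |t| :=
    fun ε hε => eventually_atInfty hF ((IsEquivalent.isLittleO hasy).bound hε)
  have hweak : ∀ n : ℕ, ∀ η, IsLineTest η →
      ∫ t, coef (cosMode n) X t * (deriv (deriv η) t - (n * Real.pi) ^ 2 * η t) = 0 :=
    fun n η hη => by rw [weak_ode_cosMode hF hX n hη]; simp
  have hloc := fun n => i0.locallyIntegrableOn_coef (continuous_cosMode n)
  have hcoef : ∀ n : ℕ, ∃ a : ℝ, n ≠ 0 → ∀ᵐ t, t ∈ Ioi (0 : ℝ) →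
      coef (cosMode n) X t = a * Real.exp (-(n * Real.pi) * t) := fun n => by
    rcases eq_or_ne n 0 with hn | hn
    · exact ⟨0, fun h => (h hn).elim⟩
    have hκ : 0 < n * Real.pi := mul_pos (by exact_mod_cast Nat.pos_of_ne_zero hn) Real.pi_pos
    obtain ⟨a, B, hae⟩ := ae_eq_exp_of_weak_ode hκ (hloc n) (hweak n)
    -- The asymptotics give `|X| ≤ 2t` at large heights, hence the same bound for the coefficient,
    -- which a nonzero `B` would violate.
    have hB : B = 0 := by
      by_contra hB
      obtain ⟨t, ht, h1, h2, h3⟩ := ((frequently_of_ae hae).and_eventually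
        ((eventually_mul_lt_abs_exp hκ hB a 0 0 2).and
          ((hgrow 1 one_pos).and (eventually_gt_atTop 0)))).exists
      have h4 : |coef (cosMode n) X t| ≤ 2 * t := abs_coef_le (abs_cosMode_le n) fun s hs => by
        have h5 := h2 s hs
        rw [abs_of_pos h3, one_mul] at h5
        have := abs_le.1 h5
        exact abs_le.2 ⟨by linarith, by linarith⟩
      rw [ht h3] at h4
      simp only [zero_mul, add_zero] at h1
      linarith
    refine ⟨a, fun _ => hae.mono fun t ht h0 => ?_⟩
    rw [ht h0, hB]
    ring
  choose a ha using hcoef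
  obtain ⟨A, B, hAB⟩ := ae_eq_affine_of_weak_ode (hloc 0) fun η hη => by simpa using hweak 0 η hη
  -- The mean of `X - t` over the section is `A + (B - 1)t`, while `X ∼ ξ₂` bounds it by `|B -
  -- 1|t/2` for large `t`; this is impossible once `t > 2|A|/|B - 1|`.
  have hB : B = 1 := by
    by_contra hB
    have hB' : 0 < |B - 1| := abs_pos.2 (sub_ne_zero.2 hB)
    obtain ⟨t, ht, h1, h2, h3⟩ := ((frequently_of_ae hAB).and_eventually
      ((hgrow (|B - 1| / 2) (by positivity)).and ((eventually_gt_atTop 0).and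
        (eventually_gt_atTop (2 * |A| / |B - 1|))))).exists
    rw [div_lt_iff₀ hB'] at h3
    have h4 : |coef (cosMode 0) (fun ξ => X ξ - t) t| ≤ |B - 1| / 2 * t :=
      abs_coef_le (abs_cosMode_le 0) fun s hs => by simpa only [abs_of_pos h2] using h1 s hs
    have h5 : coef (cosMode 0) (fun ξ => X ξ - t) t = A + B * t - t := by
      rw [← ht h2]
      have hvol : (volume.real crossSection) = 1 := by
        simp [measureReal_def]
        norm_num
      have hXi : IntegrableOn (fun s => X (s, t)) crossSection := by
        have hco : ContinuousOn (fun s => X (s, t)) crossSection :=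
          hX.smooth.continuousOn.comp (by fun_prop) fun s hs => mem_cell_of_pos hF hs h2
        refine IntegrableOn.of_bound (by simp) (hco.aestronglyMeasurable measurableSet_Ioo)
          ((|B - 1| / 2 + 1) * t) ?_
        refine (ae_restrict_iff' measurableSet_Ioo).2 (Eventually.of_forall fun s hs => ?_)
        have := h1 s hs
        rw [abs_of_pos h2] at this
        have := abs_le.1 this
        exact abs_le.2 ⟨by nlinarith, by nlinarith⟩
      simp only [coef, cosMode_zero, mul_one]
      rw [integral_sub hXi (integrableOn_const (by simp)), setIntegral_const, hvol, one_smul]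
    rw [h5] at h4
    have h6 : |(B - 1) * t| ≤ |A + B * t - t| + |A| := by
      have := abs_sub (A + B * t - t) A
      rwa [show A + B * t - t - A = (B - 1) * t by ring] at this
    rw [abs_mul, abs_of_pos h2] at h6
    nlinarith
  have hX' : ContinuousOn X (openStrip ∩ upperHalf) :=
    hX.smooth.continuousOn.mono (openStrip_inter_upperHalf_subset hF)
  have h0 : SubExp fun _ => 0 := fun t _ => ⟨0, fun n => by simp⟩
  obtain ⟨hS, hv⟩ := exists_isDecaying_cosMode (A := A) (B := 1)
    (c₀ := fun n => if n = 0 then 0 else a n) hX' i0 h0 h0 (by simp) rfl rfl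
    (by rwa [hB] at hAB) fun n hn => (ha n hn).mono fun t ht h => by simpa [hn] using ht h
  exact ⟨A, _, hS, by simp, fun n hn => (ha n hn).mono fun t ht h => by simpa [hn] using ht h, hv⟩

theorem hasDerivAt_poly_mul_exp (κ p₀ p₁ p₂ t : ℝ) :
    HasDerivAt (fun t => (p₀ + p₁ * t + p₂ * t ^ 2) * Real.exp (-κ * t))
      (((p₁ - κ * p₀) + (2 * p₂ - κ * p₁) * t + (-κ * p₂) * t ^ 2) * Real.exp (-κ * t)) t := by
  have h1 : HasDerivAt (fun t : ℝ => p₀ + p₁ * t + p₂ * t ^ 2) (p₁ * 1 + p₂ * (2 * t)) t := by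
    simpa using ((((hasDerivAt_id t).const_mul p₁).const_add p₀).fun_add
      ((hasDerivAt_pow 2 t).const_mul p₂))
  have h2 : HasDerivAt (fun t : ℝ => Real.exp (-κ * t)) (Real.exp (-κ * t) * (-κ * 1)) t :=
    ((hasDerivAt_id t).const_mul (-κ)).exp
  exact (h1.mul h2).congr_deriv (by ring)

/-- Coefficients of a weak solution whose right-hand side is an exponentially damped affine
function, when exponential growth is excluded. -/
theorem exists_coef_of_weak_ode {g f : ℝ → ℝ} {κ r₀ r₁ : ℝ} (hκ : 0 < κ)
    (hg : LocallyIntegrableOn g (Ioi 0))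
    (hf : ∀ᵐ t, t ∈ Ioi (0 : ℝ) → f t = (r₀ + r₁ * t) * Real.exp (-κ * t))
    (h : ∀ η, IsLineTest η → ∫ t, g t * (deriv (deriv η) t - κ ^ 2 * η t) = ∫ t, f t * η t)
    (hgrow : ∀ d α β B : ℝ, B ≠ 0 → (∀ᵐ t, t ∈ Ioi (0 : ℝ) →
      g t = (d + α * t + β * t ^ 2) * Real.exp (-κ * t) + B * Real.exp (κ * t)) → False) :
    ∃ d, ∀ᵐ t, t ∈ Ioi (0 : ℝ) → g t = (d + (-(r₀ / (2 * κ)) - r₁ / (4 * κ ^ 2)) * t +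
      -(r₁ / (4 * κ)) * t ^ 2) * Real.exp (-κ * t) := by
  -- The particular solution `(αt + βt²) exp(-κt)` requires `-4κβ = r₁` and `2β - 2κα = r₀`.
  set β := -(r₁ / (4 * κ)) with hβ
  set α := -(r₀ / (2 * κ)) - r₁ / (4 * κ ^ 2) with hα
  obtain ⟨A, B, hAB⟩ := ae_eq_of_weak_ode hκ hg (fun t => hasDerivAt_poly_mul_exp κ 0 α β t)
    (fun t => hasDerivAt_poly_mul_exp κ _ _ _ t) (by fun_prop) (f := f)
    (hf.mono fun t ht h0 => by
      rw [ht h0, ← mul_assoc (κ ^ 2), ← sub_mul]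
      congr 1
      rw [hα, hβ]
      field_simp
      ring) h
  have hAB' : ∀ᵐ t, t ∈ Ioi (0 : ℝ) →
      g t = (A + α * t + β * t ^ 2) * Real.exp (-κ * t) + B * Real.exp (κ * t) :=
    hAB.mono fun t ht h0 => by rw [ht h0]; ring
  have hB : B = 0 := by
    by_contra hB
    exact hgrow A α β B hB hAB'
  refine ⟨A, hAB'.mono fun t ht h0 => ?_⟩
  rw [ht h0, hB]
  ring

/-- Solving the equation for `Y` puts the frequency into a denominator. The quotient is harmless
from `n = 1` on, and at `n = 0` it is `0` because `c 0 = 0`. -/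
theorem SubExp.div_nat {c : ℕ → ℝ} (hc : SubExp c) (z : c 0 = 0) {b : ℝ} (hb : 1 ≤ b) :
    SubExp fun n => c n / (b * (n * Real.pi)) := by
  refine hc.of_abs_le fun n => ?_
  rcases Nat.eq_zero_or_pos n with rfl | hn
  · simp [z]
  · have h1 : (1 : ℝ) ≤ n := by exact_mod_cast hn
    have h2 : 1 ≤ b * (n * Real.pi) :=
      one_le_mul_of_one_le_of_one_le hb
        (one_le_mul_of_one_le_of_one_le h1 (by linarith [Real.two_le_pi]))
    rw [abs_div, abs_of_pos (lt_of_lt_of_le one_pos h2)]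
    exact div_le_self (abs_nonneg _) h2

/-- Integration by parts turns the sine coefficient of `∂X/∂ξ₁` into `-nπ` times the cosine
coefficient of `X`, that is, `-nπ aₙ exp(-nπt)`. The right-hand side is resonant, whence the linear
factor `aₙt/2`. -/
theorem IsXtilde.expansion (hF : IsProfile F) (hX : IsMixedSolution F (fun _ => 0) X)
    (hXt : IsXtilde F X Xt) {a : ℕ → ℝ} (ha : SubExp a) (a0 : a 0 = 0)
    (hac : ∀ n, n ≠ 0 → ∀ᵐ t, t ∈ Ioi (0 : ℝ) →
        coef (cosMode n) X t = a n * Real.exp (-(n * Real.pi) * t)) :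
    ∃ b : ℕ → ℝ, SubExp b ∧ b 0 = 0 ∧
      (∀ n, n ≠ 0 → ∀ᵐ t, t ∈ Ioi (0 : ℝ) →
        coef (sinMode n) Xt t = (b n + a n / 2 * t) * Real.exp (-(n * Real.pi) * t)) ∧
      ∃ v, IsDecaying v ∧ EqOn Xt v (openStrip ∩ upperHalf) := by
  obtain ⟨hXt, ς, hς, hO⟩ := hXt
  obtain ⟨i0, -, -⟩ := hXt.locallyH1.halfStripIntegrable hF
  obtain ⟨j0, j1, -⟩ := hX.locallyH1.halfStripIntegrable hF
  obtain ⟨K, hK⟩ := hO.bound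
  -- A linear bound is enough to exclude `exp(κt)`, and it is the form in which
  -- `eventually_mul_lt_abs_exp` applies.
  have hbd : ∀ᶠ t in atTop, ∀ s ∈ crossSection, |Xt (s, t)| ≤ |K| * t := by
    filter_upwards [eventually_atInfty hF hK, eventually_ge_atTop 1] with t ht h1 s hs
    refine (ht s hs).trans ?_
    have : Real.exp (-ς * t) ≤ t := (Real.exp_le_one_iff.2 (by nlinarith)).trans h1
    rw [Real.norm_eq_abs, Real.abs_exp]
    exact mul_le_mul (le_abs_self K) this (Real.exp_pos _).le (abs_nonneg _)
  have hloc := fun n => i0.locallyIntegrableOn_coef (continuous_sinMode n)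
  have hcoef : ∀ n : ℕ, ∃ b : ℝ, n ≠ 0 → ∀ᵐ t, t ∈ Ioi (0 : ℝ) →
      coef (sinMode n) Xt t = (b + a n / 2 * t) * Real.exp (-(n * Real.pi) * t) := fun n => by
    rcases eq_or_ne n 0 with hn | hn
    · exact ⟨0, fun h => (h hn).elim⟩
    have hκ : 0 < n * Real.pi := mul_pos (by exact_mod_cast Nat.pos_of_ne_zero hn) Real.pi_pos
    obtain ⟨b, hb⟩ := exists_coef_of_weak_ode hκ (hloc n) (r₀ := -(n * Real.pi) * a n) (r₁ := 0)
      (f := fun t => -(n * Real.pi) * coef (cosMode n) X t)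
      ((hac n hn).mono fun t ht h0 => by simp only [ht h0]; ring)
      (fun η hη => by
        rw [weak_ode_sinMode hF hXt j1 n hη,
          setIntegral_d1_mul_sinMode hF hX.bottom hX.locallyH1 n hη,
          setIntegral_cell_eq_coef hF j0 (continuous_cosMode n) hη, ← integral_const_mul]
        simp only [mul_assoc])
      (fun d α β B hB hae => by
        obtain ⟨t, ht, h1, h2, h3⟩ := ((frequently_of_ae hae).and_eventually
          ((eventually_mul_lt_abs_exp hκ hB d α β |K|).and
            (hbd.and (eventually_gt_atTop 0)))).exists
        have h4 : |coef (sinMode n) Xt t| ≤ |K| * t := abs_coef_le (abs_sinMode_le n) h2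
        rw [ht h3] at h4
        linarith)
    refine ⟨b, fun _ => hb.mono fun t ht h0 => ?_⟩
    rw [ht h0]
    congr 1
    field_simp
    ring
  choose b hb using hcoef
  have h0 : SubExp fun _ => 0 := fun t _ => ⟨0, fun n => by simp⟩
  obtain ⟨hS, hv⟩ := isModeSystem_sinMode.exists_isDecaying
    (c₀ := fun n => if n = 0 then 0 else b n) (c₁ := fun n => 2⁻¹ * a n)
    (hXt.smooth.continuousOn.mono (openStrip_inter_upperHalf_subset hF)) i0 (ha.const_mul _) h0
    (by simp) (by simp [a0]) rfl fun n => by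
      rcases eq_or_ne n 0 with rfl | hn
      · exact Eventually.of_forall fun t _ => by simp [coef, sinMode, a0]
      · exact (hb n hn).mono fun t ht h => by
          rw [ht h]
          simp only [hn, if_false]
          ring
  exact ⟨_, hS, by simp, fun n hn => (hb n hn).mono fun t ht h => by simpa [hn] using ht h, hv⟩

/-- For `t ≥ c` one has `(t + c)² ≤ 4t²`, so growth beyond `4t` makes the quotient at least `1/t`.
-/
theorem not_integrable_of_eventually_lt {g : ℝ → ℝ} {c : ℝ} (hc : 0 < c)
    (hg : IntegrableOn (fun t => g t / (t + c) ^ 2) (Ioi 0)) {p : ℝ → ℝ}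
    (hp : ∀ᵐ t, t ∈ Ioi (0 : ℝ) → g t = p t) (h : ∀ᶠ t in atTop, 4 * t < |p t|) : False := by
  have h1 : IntegrableOn (fun t => p t / (t + c) ^ 2) (Ioi 0) :=
    hg.congr ((ae_restrict_iff' measurableSet_Ioi).2 (hp.mono fun t ht h0 => by
      simp only [ht h0]))
  refine not_integrableOn_of_eventually_inv_le ?_ h1
  filter_upwards [h, eventually_ge_atTop c] with t ht htc
  have ht0 : 0 < t := hc.trans_le htc
  rw [abs_div, abs_of_pos (show 0 < (t + c) ^ 2 by positivity), le_div_iff₀ (by positivity),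
    inv_mul_le_iff₀ ht0]
  nlinarith

/-- The growth condition on `Y` is the weighted integrability inherited from the energy space. It
excludes the exponentially growing solutions in positive orders and the linear one in order zero,
but leaves the constant. -/
theorem IsMixedSolution.expansion_of_isXtilde (hF : IsProfile F) (hXt : IsDirichletSolution F (d1 X) Xt)
    {a b : ℕ → ℝ} (ha : SubExp a) (hb : SubExp b) (a0 : a 0 = 0) (b0 : b 0 = 0)
    (hbc : ∀ n, n ≠ 0 → ∀ᵐ t, t ∈ Ioi (0 : ℝ) →
        coef (sinMode n) Xt t = (b n + a n / 2 * t) * Real.exp (-(n * Real.pi) * t))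
    (hY : IsMixedSolution F (d1 Xt) Y) {c : ℝ} (hc : 0 < c)
    (hYc : IntegrableOn (fun ξ => Y ξ / (ξ.2 + c) ^ 2) (crossSection ×ˢ Ioi 0)) :
    ∃ C v, IsDecaying v ∧ ∀ ξ ∈ openStrip ∩ upperHalf, Y ξ = C + v ξ := by
  obtain ⟨i0, -, -⟩ := hY.locallyH1.halfStripIntegrable hF
  obtain ⟨j0, j1, -⟩ := hXt.locallyH1.halfStripIntegrable hF
  have hloc := fun n => i0.locallyIntegrableOn_coef (continuous_cosMode n)
  have hint : ∀ n, IntegrableOn (fun t => coef (cosMode n) Y t / (t + c) ^ 2) (Ioi 0) := fun n => by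
    have h1 : IntegrableOn (fun ξ => Y ξ / (ξ.2 + c) ^ 2 * cosMode n ξ.1) (crossSection ×ˢ Ioi 0) :=
      hYc.mul_bdd ((continuous_cosMode n).comp continuous_fst).aestronglyMeasurable
        (Eventually.of_forall fun ξ => abs_cosMode_le n ξ.1)
    rw [IntegrableOn, Measure.volume_eq_prod, ← Measure.prod_restrict] at h1
    refine h1.integral_prod_right.congr (Eventually.of_forall fun t => ?_)
    simp only [coef]
    rw [← integral_div]
    congr 1
    funext s
    ring
  have hrhs : ∀ n : ℕ, ∀ η, IsLineTest η →
      ∫ t, coef (cosMode n) Y t * (deriv (deriv η) t - (n * Real.pi) ^ 2 * η t) =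
        ∫ t, (n * Real.pi) * coef (sinMode n) Xt t * η t := fun n η hη => by
    rw [weak_ode_cosMode hF hY n hη, setIntegral_d1_mul_cosMode hF hXt.boundary n hη,
      setIntegral_cell_eq_coef hF j0 (continuous_sinMode n) hη, ← integral_const_mul]
    simp only [mul_assoc]
  -- These are the values of `β` and `α` in `exists_coef_of_weak_ode` for `r₀ = nπ bₙ` and `r₁ = nπ
  -- aₙ/2`.
  set c₂ : ℕ → ℝ := fun n => -(1 / 8) * a n with hc₂
  set c₁ : ℕ → ℝ := fun n => -(1 / 2) * b n + -1 * (a n / (8 * (n * Real.pi))) with hc₁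
  have hcoef : ∀ n : ℕ, ∃ d : ℝ, n ≠ 0 → ∀ᵐ t, t ∈ Ioi (0 : ℝ) →
      coef (cosMode n) Y t = (d + c₁ n * t + c₂ n * t ^ 2) * Real.exp (-(n * Real.pi) * t) := fun n => by
    rcases eq_or_ne n 0 with hn | hn
    · exact ⟨0, fun h => (h hn).elim⟩
    have hκ : 0 < n * Real.pi := mul_pos (by exact_mod_cast Nat.pos_of_ne_zero hn) Real.pi_pos
    obtain ⟨d, hd⟩ := exists_coef_of_weak_ode hκ (hloc n) (r₀ := n * Real.pi * b n)
      (r₁ := n * Real.pi * (a n / 2)) (f := fun t => (n * Real.pi) * coef (sinMode n) Xt t)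
      ((hbc n hn).mono fun t ht h0 => by simp only [ht h0]; ring) (hrhs n)
      (fun d α β B hB hae => not_integrable_of_eventually_lt hc (hint n) hae
        (eventually_mul_lt_abs_exp hκ hB d α β 4))
    refine ⟨d, fun _ => hd.mono fun t ht h0 => ?_⟩
    rw [ht h0, hc₁, hc₂]
    congr 1
    field_simp
    ring
  choose d hd using hcoef
  -- In order zero the factor `nπ` annihilates the right-hand side, so the mean of `Y` is affine.
  -- Its value `C` is the constant sought.
  obtain ⟨C, B, hCB⟩ := ae_eq_affine_of_weak_ode (hloc 0) fun η hη => by simpa using hrhs 0 η hη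
  have hB : B = 0 := by
    by_contra hB
    have h1 : IntegrableOn (fun t => (C + B * t) / (t + c) ^ 2) (Ioi 0) :=
      (hint 0).congr ((ae_restrict_iff' measurableSet_Ioi).2 (hCB.mono fun t ht h0 => by
        simp only [ht h0]))
    have hB' : 0 < |B| := abs_pos.2 hB
    -- For large `t` both `|C + Bt| ≥ |B|t/2` and `(t + c)² ≤ 4t²` hold; the factor `8/|B|`
    -- normalises the quotient to at least `1/t`.
    refine not_integrableOn_of_eventually_inv_le ?_ (h1.const_mul (8 / |B|))
    filter_upwards [eventually_ge_atTop c, eventually_ge_atTop (2 * |C| / |B|)] with t htc ht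
    have ht0 : 0 < t := hc.trans_le htc
    rw [div_le_iff₀ hB'] at ht
    have h2 : |B| * t ≤ |C + B * t| + |C| := by
      have := abs_sub (C + B * t) C
      rwa [add_sub_cancel_left, abs_mul, abs_of_pos ht0] at this
    rw [abs_mul, abs_div, abs_div, abs_abs, abs_of_pos (show (0 : ℝ) < 8 by norm_num),
      abs_of_pos (show 0 < (t + c) ^ 2 by positivity), div_mul_div_comm, le_div_iff₀ (by positivity),
      inv_mul_le_iff₀ ht0]
    have h3 : |B| * t ≤ 2 * |C + B * t| := by linarith
    have h4 : (t + c) ^ 2 ≤ 4 * t ^ 2 := by nlinarith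
    calc |B| * (t + c) ^ 2 ≤ |B| * (4 * t ^ 2) := mul_le_mul_of_nonneg_left h4 hB'.le
      _ = 4 * t * (|B| * t) := by ring
      _ ≤ 4 * t * (2 * |C + B * t|) := mul_le_mul_of_nonneg_left h3 (by positivity)
      _ = t * (8 * |C + B * t|) := by ring
  obtain ⟨-, v, hv, e⟩ := exists_isDecaying_cosMode (A := C) (B := 0)
    (c₀ := fun n => if n = 0 then 0 else d n)
    (hY.smooth.continuousOn.mono (openStrip_inter_upperHalf_subset hF)) i0
    ((hb.const_mul _).add ((ha.div_nat a0 (b := 8) (by norm_num)).const_mul _)) (ha.const_mul _)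
    (by simp) (by simp [a0, b0]) (by simp [a0]) (by rwa [hB] at hCB)
    fun n hn => (hd n hn).mono fun t ht h => by simpa [hn] using ht h
  exact ⟨C, v, hv, fun ξ hξ => by rw [e ξ hξ]; ring⟩

end Expansion

/-! ### Hardy's inequality in the vertical direction. -/

section Hardy

variable {F : ℝ → ℝ} {U : Set (ℝ × ℝ)} {u φ ψ : ℝ × ℝ → ℝ} {c : ℝ}

theorem IsTest.mul_contDiffOn (h : IsTest U φ) (hU : IsOpen U) (hu : ContDiffOn ℝ ∞ u U) :
    IsTest U (fun x => u x * φ x) := by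
  refine ⟨contDiff_iff_contDiffAt.2 fun x => ?_, h.compact.mul_left,
    tsupport_mul_subset_right.trans h.supp⟩
  by_cases hx : x ∈ tsupport φ
  · exact ((hu x (h.supp hx)).contDiffAt (hU.mem_nhds (h.supp hx))).mul h.smooth.contDiffAt
  · refine (contDiffAt_const (c := (0 : ℝ))).congr_of_eventuallyEq ?_
    filter_upwards [notMem_tsupport_iff_eventuallyEq.1 hx] with y hy
    rw [hy, Pi.zero_apply, mul_zero]

theorem integral_openStrip_d2 (h : IsTest U φ) : ∫ ξ in openStrip, d2 φ ξ = 0 := by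
  have e : openStrip = crossSection ×ˢ (univ : Set ℝ) := by
    ext ξ
    simp [openStrip]
  have hi : Integrable (d2 φ) := h.d2.integrable
  rw [e, Measure.volume_eq_prod, setIntegral_prod _ (by
    rw [← Measure.volume_eq_prod]; exact hi.integrableOn)]
  refine integral_eq_zero_of_ae (Eventually.of_forall fun s => ?_)
  rw [Measure.restrict_univ]
  have hd : ∀ t, HasDerivAt (fun t => φ (s, t)) (d2 φ (s, t)) t := fun t =>
    hasDerivAt_d2 (ξ := (s, t)) (h.differentiable _)
  have hemb : Topology.IsClosedEmbedding fun t : ℝ => (s, t) :=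
    Topology.IsClosedEmbedding.of_continuous_injective_isClosedMap (by fun_prop)
      (fun a b hab => (Prod.ext_iff.1 hab).2) (isClosedMap_prodMk_left s)
  refine integral_eq_zero_of_hasDerivAt_of_integrable hd ?_ ?_
  · exact (h.d2.smooth.continuous.comp (by fun_prop)).integrable_of_hasCompactSupport
      (h.d2.compact.comp_isClosedEmbedding hemb)
  · exact (h.smooth.continuous.comp (by fun_prop)).integrable_of_hasCompactSupport
      (h.compact.comp_isClosedEmbedding hemb)

theorem IsTest.setIntegral_cell_eq_openStrip (h : IsTest (aboveGraph F) φ) :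
    ∫ ξ in cell F, φ ξ = ∫ ξ in openStrip, φ ξ := by
  refine (setIntegral_eq_of_subset_of_forall_sdiff_eq_zero isOpen_openStrip.measurableSet
    inter_subset_left fun ξ hξ => h.eq_zero fun h' => hξ.2 ⟨hξ.1, h'⟩).symm

theorem contDiffOn_inv_snd (hc : ∀ ξ ∈ aboveGraph F, 0 < ξ.2 + c) :
    ContDiffOn ℝ ∞ (fun ξ : ℝ × ℝ => (ξ.2 + c)⁻¹) (aboveGraph F) :=
  (contDiff_snd.add contDiff_const).contDiffOn.inv fun ξ hξ => (hc ξ hξ).ne'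

/-- The vertical derivative of `φ²/(ξ₂ + c)` has integral zero: `φ` vanishes near the graph and for
large `ξ₂`, and the lateral sides play no role. Expanding gives `∫ φ²/(ξ₂ + c)² = 2 ∫ φ d2φ/(ξ₂ +
c)`, and Young's inequality with weight `1/4` absorbs half of the left side. -/
theorem hardy_inequality (hF : Continuous F) (hc : ∀ ξ ∈ aboveGraph F, 0 < ξ.2 + c)
    (h : IsTest (aboveGraph F) φ) :
    ∫ ξ in cell F, (φ ξ * (ξ.2 + c)⁻¹) ^ 2 ≤ 4 * ∫ ξ in cell F, d2 φ ξ ^ 2 := by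
  have hO := isOpen_aboveGraph hF
  have hw := contDiffOn_inv_snd hc
  have hφw : IsTest (aboveGraph F) fun ξ => (ξ.2 + c)⁻¹ * φ ξ := h.mul_contDiffOn hO hw
  have hψ : IsTest (aboveGraph F) fun ξ => φ ξ * ((ξ.2 + c)⁻¹ * φ ξ) := hφw.mul_left h.smooth
  have e0 : ∫ ξ in cell F, d2 (fun ξ => φ ξ * ((ξ.2 + c)⁻¹ * φ ξ)) ξ = 0 := by
    rw [hψ.d2.setIntegral_cell_eq_openStrip, integral_openStrip_d2 hψ]
  have e1 : ∀ ξ ∈ cell F, d2 (fun ξ => φ ξ * ((ξ.2 + c)⁻¹ * φ ξ)) ξ =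
      2 * (((ξ.2 + c)⁻¹ * φ ξ) * d2 φ ξ) - ((ξ.2 + c)⁻¹ * φ ξ) ^ 2 := fun ξ hξ => by
    have hpos := hc ξ hξ.2
    have hd : HasDerivAt (fun t : ℝ => (t + c)⁻¹) (-1 / (ξ.2 + c) ^ 2) ξ.2 :=
      ((hasDerivAt_id ξ.2).add_const c).inv hpos.ne'
    have e2 : d2 (fun ξ : ℝ × ℝ => (ξ.2 + c)⁻¹) ξ = -1 / (ξ.2 + c) ^ 2 := hd.deriv
    have hdw := (hw.contDiffAt (hO.mem_nhds hξ.2)).differentiableAt (by simp)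
    rw [d2_mul (h.differentiable ξ) (hφw.differentiable ξ), d2_mul hdw (h.differentiable ξ), e2]
    field_simp
    ring
  rw [setIntegral_congr_fun (measurableSet_cell hF) e1] at e0
  have i1 : IntegrableOn (fun ξ => ((ξ.2 + c)⁻¹ * φ ξ) * d2 φ ξ) (cell F) :=
    (h.d2.mul_left hφw.smooth).integrable.integrableOn
  have i2 : IntegrableOn (fun ξ => ((ξ.2 + c)⁻¹ * φ ξ) ^ 2) (cell F) := by
    simp_rw [pow_two]
    exact (hφw.mul_left hφw.smooth).integrable.integrableOn
  have i3 : IntegrableOn (fun ξ => d2 φ ξ ^ 2) (cell F) := by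
    simp_rw [pow_two]
    exact (h.d2.mul_left h.d2.smooth).integrable.integrableOn
  rw [integral_sub (i1.const_mul 2) i2, integral_const_mul] at e0
  have e3 : ∫ ξ in cell F, ((ξ.2 + c)⁻¹ * φ ξ) * d2 φ ξ ≤
      ∫ ξ in cell F, (4⁻¹ * ((ξ.2 + c)⁻¹ * φ ξ) ^ 2 + d2 φ ξ ^ 2) := by
    refine integral_mono i1 ((i2.const_mul _).add i3) fun ξ => ?_
    simp only
    nlinarith [sq_nonneg (2⁻¹ * ((ξ.2 + c)⁻¹ * φ ξ) - d2 φ ξ)]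
  rw [integral_add (i2.const_mul _) i3, integral_const_mul] at e3
  simp_rw [mul_comm (φ _)]
  linarith

end Hardy

/-! ### Lax–Milgram for the mixed problem. -/

section Variational

/-- The completion of the energy space is realised as a closed subspace of three copies of an `L²`
space: weighted value and two derivatives. The bound on the component `0` survives the closure and
makes the form on the components `1` and `2` coercive. -/
theorem exists_mem_closure_of_coercive {L : Type*} [NormedAddCommGroup L] [InnerProductSpace ℝ L]
    [CompleteSpace L] (G : Submodule ℝ (PiLp 2 fun _ : Fin 3 => L))
    (hG : ∀ x ∈ G, ‖x 0‖ ^ 2 ≤ 4 * ‖x 2‖ ^ 2) (ℓ : L) :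
    ∃ x ∈ G.topologicalClosure, ∀ y ∈ G,
      inner ℝ (x 1) (y 1) + inner ℝ (x 2) (y 2) = inner ℝ ℓ (y 0) := by
  set K := G.topologicalClosure with hK
  have hKc : CompleteSpace K := G.isClosed_topologicalClosure.completeSpace_coe
  have hcont : ∀ i : Fin 3, Continuous fun x : PiLp 2 fun _ : Fin 3 => L => x i := fun i =>
    (PiLp.continuous_apply 2 _ i)
  have hKG : ∀ x ∈ K, ‖x 0‖ ^ 2 ≤ 4 * ‖x 2‖ ^ 2 := by
    intro x hx
    have hcl : IsClosed {x : PiLp 2 fun _ : Fin 3 => L | ‖x 0‖ ^ 2 ≤ 4 * ‖x 2‖ ^ 2} :=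
      isClosed_le ((hcont 0).norm.pow 2) (continuous_const.mul ((hcont 2).norm.pow 2))
    exact closure_minimal (fun y hy => hG y hy) hcl hx
  have hle : ∀ (x : PiLp 2 fun _ : Fin 3 => L) (i : Fin 3), ‖x i‖ ≤ ‖x‖ := fun x i =>
    PiLp.norm_apply_le x i
  let B₀ : K →ₗ[ℝ] K →ₗ[ℝ] ℝ := LinearMap.mk₂ ℝ
    (fun x y => inner ℝ (x.1 1) (y.1 1) + inner ℝ (x.1 2) (y.1 2))
    (fun x y z => by simp [inner_add_left]; ring)
    (fun a x y => by simp [inner_smul_left]; ring)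
    (fun x y z => by simp [inner_add_right]; ring)
    (fun a x y => by simp [inner_smul_right]; ring)
  let B : K →L[ℝ] K →L[ℝ] ℝ := B₀.mkContinuous₂ 2 fun x y => by
    have h1 := (norm_inner_le_norm (𝕜 := ℝ) (x.1 1) (y.1 1)).trans
      (mul_le_mul (hle x.1 1) (hle y.1 1) (norm_nonneg _) (norm_nonneg _))
    have h2 := (norm_inner_le_norm (𝕜 := ℝ) (x.1 2) (y.1 2)).trans
      (mul_le_mul (hle x.1 2) (hle y.1 2) (norm_nonneg _) (norm_nonneg _))
    refine (norm_add_le _ _).trans ((add_le_add h1 h2).trans_eq ?_)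
    simp only [Submodule.coe_norm]
    ring
  have hBapp : ∀ x y : K, B x y = inner ℝ (x.1 1) (y.1 1) + inner ℝ (x.1 2) (y.1 2) := fun _ _ => rfl
  have hB : IsCoercive B := by
    -- The component `0` costs `4‖x 2‖²`, so `‖x‖² ≤ ‖x 1‖² + 5‖x 2‖²`.
    refine ⟨1 / 5, by norm_num, fun x => ?_⟩
    rw [hBapp, real_inner_self_eq_norm_sq, real_inner_self_eq_norm_sq]
    have h1 : ‖x‖ * ‖x‖ = ‖x.1 0‖ ^ 2 + ‖x.1 1‖ ^ 2 + ‖x.1 2‖ ^ 2 := by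
      have := PiLp.norm_sq_eq_of_L2 (fun _ : Fin 3 => L) x.1
      rw [← pow_two, Submodule.coe_norm, this, Fin.sum_univ_three]
    have h2 := hKG x.1 x.2
    rw [mul_assoc, h1]
    nlinarith [sq_nonneg ‖x.1 1‖]
  let f : K →L[ℝ] ℝ := (innerSL ℝ ℓ).comp ((PiLp.proj 2 (fun _ : Fin 3 => L) (0 : Fin 3)).comp K.subtypeL)
  let z : K := (InnerProductSpace.toDual ℝ K).symm f
  let x : K := hB.continuousLinearEquivOfBilin.symm z
  refine ⟨x.1, x.2, fun y hy => ?_⟩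
  have hy' : y ∈ K := G.le_topologicalClosure hy
  have h1 := hB.continuousLinearEquivOfBilin_apply x ⟨y, hy'⟩
  rw [ContinuousLinearEquiv.apply_symm_apply, InnerProductSpace.toDual_symm_apply, hBapp] at h1
  exact h1.symm

variable {F : ℝ → ℝ} {c : ℝ} {φ ψ h : ℝ × ℝ → ℝ}

/-- The product of a test function above the graph with one in the strip is supported in the cell,
so the integral extends to the whole plane. -/
theorem setIntegral_test_mul_d1 (hφ : IsTest (aboveGraph F) φ)
    (hψ : IsTest openStrip ψ) :
    ∫ ξ in cell F, φ ξ * d1 ψ ξ = -∫ ξ in cell F, d1 φ ξ * ψ ξ := by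
  have e : ∀ {f g : ℝ × ℝ → ℝ}, IsTest (aboveGraph F) f → IsTest openStrip g →
      ∫ ξ in cell F, f ξ * g ξ = ∫ ξ, f ξ * g ξ := fun hf hg =>
    setIntegral_eq_integral_of_forall_compl_eq_zero fun ξ hξ => by
      by_cases h1 : ξ ∈ openStrip
      · rw [hf.eq_zero fun h2 => hξ ⟨h1, h2⟩, zero_mul]
      · rw [hg.eq_zero h1, mul_zero]
  rw [e hφ hψ.d1, e hφ.d1 hψ]
  exact integral_mul_d1 isOpen_univ hφ.smooth.contDiffOn (hψ.mono (subset_univ _))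

theorem setIntegral_test_mul_d2 (hφ : IsTest (aboveGraph F) φ)
    (hψ : IsTest openStrip ψ) :
    ∫ ξ in cell F, φ ξ * d2 ψ ξ = -∫ ξ in cell F, d2 φ ξ * ψ ξ := by
  have e : ∀ {f g : ℝ × ℝ → ℝ}, IsTest (aboveGraph F) f → IsTest openStrip g →
      ∫ ξ in cell F, f ξ * g ξ = ∫ ξ, f ξ * g ξ := fun hf hg =>
    setIntegral_eq_integral_of_forall_compl_eq_zero fun ξ hξ => by
      by_cases h1 : ξ ∈ openStrip
      · rw [hf.eq_zero fun h2 => hξ ⟨h1, h2⟩, zero_mul]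
      · rw [hg.eq_zero h1, mul_zero]
  rw [e hφ hψ.d2, e hφ.d2 hψ]
  exact integral_mul_d2 isOpen_univ hφ.smooth.contDiffOn (hψ.mono (subset_univ _))

theorem inner_Lp_eq {α : Type*} [MeasurableSpace α] {μ : Measure α} (x : Lp ℝ 2 μ) {f : α → ℝ}
    (hf : MemLp f 2 μ) : inner ℝ x (hf.toLp f) = ∫ a, x a * f a ∂μ := by
  rw [L2.inner_def]
  refine integral_congr_ae ?_
  filter_upwards [hf.coeFn_toLp] with a ha
  rw [ha]
  simp [mul_comm]

theorem norm_sq_Lp_eq {α : Type*} [MeasurableSpace α] {μ : Measure α} (x : Lp ℝ 2 μ) {f : α → ℝ}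
    (hf : x =ᵐ[μ] f) : ‖x‖ ^ 2 = ∫ a, f a ^ 2 ∂μ := by
  rw [← real_inner_self_eq_norm_sq, L2.inner_def]
  refine integral_congr_ae ?_
  filter_upwards [hf] with a ha
  rw [ha]
  simp [pow_two]

/-- The weighted values and the gradients of test functions. -/
noncomputable def gradientSpace (F : ℝ → ℝ) (c : ℝ) :
    Submodule ℝ (PiLp 2 fun _ : Fin 3 => Lp ℝ 2 (volume.restrict (cell F))) where
  carrier := {x | ∃ φ, IsTest (aboveGraph F) φ ∧
    x 0 =ᵐ[volume.restrict (cell F)] (fun ξ => φ ξ * (ξ.2 + c)⁻¹) ∧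
    x 1 =ᵐ[volume.restrict (cell F)] d1 φ ∧ x 2 =ᵐ[volume.restrict (cell F)] d2 φ}
  add_mem' := by
    rintro x y ⟨φ, hφ, x0, x1, x2⟩ ⟨ψ, hψ, y0, y1, y2⟩
    refine ⟨fun ξ => φ ξ + ψ ξ, ⟨hφ.smooth.add hψ.smooth, hφ.compact.add hψ.compact,
      (tsupport_add φ ψ).trans (union_subset hφ.supp hψ.supp)⟩, ?_, ?_, ?_⟩
    · filter_upwards [x0, y0, Lp.coeFn_add (x 0) (y 0)] with ξ h1 h2 h3
      rw [PiLp.add_apply, h3, Pi.add_apply, h1, h2]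
      ring
    · filter_upwards [x1, y1, Lp.coeFn_add (x 1) (y 1)] with ξ h1 h2 h3
      rw [PiLp.add_apply, h3, Pi.add_apply, h1, h2,
        d1_add (hφ.differentiable ξ) (hψ.differentiable ξ)]
    · filter_upwards [x2, y2, Lp.coeFn_add (x 2) (y 2)] with ξ h1 h2 h3
      rw [PiLp.add_apply, h3, Pi.add_apply, h1, h2,
        d2_add (hφ.differentiable ξ) (hψ.differentiable ξ)]
  zero_mem' := by
    have h0 : ∀ i : Fin 3, (0 : PiLp 2 fun _ : Fin 3 => Lp ℝ 2 (volume.restrict (cell F))) i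
        =ᵐ[volume.restrict (cell F)] fun _ => 0 := fun i => Lp.coeFn_zero _ _ _
    refine ⟨fun _ => 0, ⟨contDiff_const, HasCompactSupport.zero, by
      rw [show (fun _ : ℝ × ℝ => (0 : ℝ)) = 0 from rfl, tsupport_zero]; exact empty_subset _⟩,
      ?_, ?_, ?_⟩
    · simpa using h0 0
    · exact (h0 1).trans (EventuallyEq.of_eq (funext fun ξ => by simp [d1]))
    · exact (h0 2).trans (EventuallyEq.of_eq (funext fun ξ => by simp [d2]))
  smul_mem' := by
    rintro a x ⟨φ, hφ, x0, x1, x2⟩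
    refine ⟨fun ξ => a * φ ξ, hφ.mul_left contDiff_const, ?_, ?_, ?_⟩
    · filter_upwards [x0, Lp.coeFn_smul a (x 0)] with ξ h1 h3
      rw [PiLp.smul_apply, h3, Pi.smul_apply, h1, smul_eq_mul]
      ring
    · filter_upwards [x1, Lp.coeFn_smul a (x 1)] with ξ h1 h3
      rw [PiLp.smul_apply, h3, Pi.smul_apply, h1, d1_const_mul, smul_eq_mul]
    · filter_upwards [x2, Lp.coeFn_smul a (x 2)] with ξ h1 h3
      rw [PiLp.smul_apply, h3, Pi.smul_apply, h1, d2_const_mul, smul_eq_mul]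

/-- Existence of a variational solution of the mixed problem. -/
theorem exists_variational_solution (hF : Continuous F) (hc : ∀ ξ ∈ aboveGraph F, 0 < ξ.2 + c)
    (hh : MemLp (fun ξ => h ξ * (ξ.2 + c)) 2 (volume.restrict (cell F))) :
    ∃ u g₁ g₂ : ℝ × ℝ → ℝ, MemLp (fun ξ => u ξ * (ξ.2 + c)⁻¹) 2 (volume.restrict (cell F)) ∧
      MemLp g₁ 2 (volume.restrict (cell F)) ∧ MemLp g₂ 2 (volume.restrict (cell F)) ∧
      (∀ ψ, IsTest openStrip ψ → ∫ ξ in cell F, u ξ * d1 ψ ξ = -∫ ξ in cell F, g₁ ξ * ψ ξ ∧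
        ∫ ξ in cell F, u ξ * d2 ψ ξ = -∫ ξ in cell F, g₂ ξ * ψ ξ) ∧
      ∀ φ, IsTest (aboveGraph F) φ →
        ∫ ξ in cell F, (g₁ ξ * d1 φ ξ + g₂ ξ * d2 φ ξ) = -∫ ξ in cell F, h ξ * φ ξ := by
  have hms := measurableSet_cell hF
  set μ := volume.restrict (cell F) with hμ
  have hmem : ∀ {U : Set (ℝ × ℝ)} {φ : ℝ × ℝ → ℝ}, IsTest U φ → MemLp φ 2 μ := fun h =>
    (h.memLp 2).restrict _
  have hw := contDiffOn_inv_snd hc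
  have hcell : ∀ᵐ ξ ∂μ, ξ ∈ cell F := ae_restrict_mem hms
  have hG : ∀ x ∈ gradientSpace F c, ‖x 0‖ ^ 2 ≤ 4 * ‖x 2‖ ^ 2 := by
    rintro x ⟨φ, hφ, x0, x1, x2⟩
    rw [norm_sq_Lp_eq _ x0, norm_sq_Lp_eq _ x2]
    exact hardy_inequality hF hc hφ
  -- The functional `-∫ hφ` is the pairing of `-h(ξ₂ + c)`, square integrable by hypothesis, with
  -- the weighted value `φ/(ξ₂ + c)`.
  obtain ⟨x, hx, hxG⟩ := exists_mem_closure_of_coercive (gradientSpace F c) hG (-(hh.toLp _))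
  have hcont : ∀ i : Fin 3, Continuous fun x : PiLp 2 fun _ : Fin 3 => Lp ℝ 2 μ => x i := fun i =>
    (PiLp.continuous_apply 2 _ i)
  have eu : ∀ ξ ∈ cell F, x 0 ξ * (ξ.2 + c) * (ξ.2 + c)⁻¹ = x 0 ξ := fun ξ hξ => by
    rw [mul_assoc, mul_inv_cancel₀ (hc ξ hξ.2).ne', mul_one]
  refine ⟨fun ξ => x 0 ξ * (ξ.2 + c), x 1, x 2, ?_, Lp.memLp _, Lp.memLp _, fun ψ hψ => ?_,
    fun φ hφ => ?_⟩
  · exact (memLp_congr_ae (hcell.mono fun ξ hξ => eu ξ hξ)).2 (Lp.memLp (x 0))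
  · have hs : ContDiff ℝ ∞ fun ξ : ℝ × ℝ => ξ.2 + c := contDiff_snd.add contDiff_const
    have m0 := hmem hψ
    have m1 := hmem (hψ.d1.mul_left hs)
    have m2 := hmem (hψ.d2.mul_left hs)
    -- Written as inner products with fixed `L²` vectors, the integration by parts formulas are
    -- closed conditions on the triple and pass from test functions to the closure. They encode both
    -- the weak gradient and the zero trace on the bottom.
    have key : ∀ y ∈ gradientSpace F c, inner ℝ (y 0) (m1.toLp _) = -inner ℝ (y 1) (m0.toLp _) ∧
        inner ℝ (y 0) (m2.toLp _) = -inner ℝ (y 2) (m0.toLp _) := by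
      rintro y ⟨φ, hφ, y0, y1, y2⟩
      simp only [inner_Lp_eq]
      have a0 : ∀ f : ℝ × ℝ → ℝ, ∫ ξ, y 0 ξ * ((ξ.2 + c) * f ξ) ∂μ = ∫ ξ in cell F, φ ξ * f ξ := fun f => by
        refine integral_congr_ae ?_
        filter_upwards [y0, hcell] with ξ h1 h2
        have := (hc ξ h2.2).ne'
        rw [h1]
        field_simp
      rw [a0, a0]
      constructor
      · rw [setIntegral_test_mul_d1 hφ hψ]
        congr 1
        exact integral_congr_ae (y1.mono fun ξ h1 => by simp only [h1])
      · rw [setIntegral_test_mul_d2 hφ hψ]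
        congr 1
        exact integral_congr_ae (y2.mono fun ξ h1 => by simp only [h1])
    have hcl : IsClosed {y : PiLp 2 fun _ : Fin 3 => Lp ℝ 2 μ |
        inner ℝ (y 0) (m1.toLp _) = -inner ℝ (y 1) (m0.toLp _) ∧
        inner ℝ (y 0) (m2.toLp _) = -inner ℝ (y 2) (m0.toLp _)} :=
      (isClosed_eq ((hcont 0).inner continuous_const) ((hcont 1).inner continuous_const).neg).inter
      (isClosed_eq ((hcont 0).inner continuous_const) ((hcont 2).inner continuous_const).neg)
    obtain ⟨h1, h2⟩ := closure_minimal (fun y hy => key y hy) hcl hx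
    simp only [inner_Lp_eq] at h1 h2
    simp only [mul_assoc]
    exact ⟨h1, h2⟩
  · have m0 := hmem (hφ.mul_contDiffOn (isOpen_aboveGraph hF) hw)
    have m1 := hmem hφ.d1
    have m2 := hmem hφ.d2
    have hy := hxG (WithLp.toLp 2 ![m0.toLp _, m1.toLp _, m2.toLp _])
      ⟨φ, hφ, m0.coeFn_toLp.trans (EventuallyEq.of_eq (funext fun ξ => mul_comm _ _)), m1.coeFn_toLp, m2.coeFn_toLp⟩
    simp only [Matrix.cons_val_zero, Matrix.cons_val_one, Matrix.cons_val] at hy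
    rw [inner_neg_left, inner_Lp_eq, inner_Lp_eq, inner_Lp_eq] at hy
    have i1 : Integrable (fun ξ => x 1 ξ * d1 φ ξ) μ := (Lp.memLp (x 1)).integrable_mul m1
    have i2 : Integrable (fun ξ => x 2 ξ * d2 φ ξ) μ := (Lp.memLp (x 2)).integrable_mul m2
    rw [integral_add i1 i2, hy]
    congr 1
    refine integral_congr_ae ?_
    filter_upwards [hh.coeFn_toLp, hcell] with ξ h1 h2
    have := (hc ξ h2.2).ne'
    rw [h1]
    field_simp

end Variational

/-! ### The logarithm as fundamental solution and a compactly supported parametrix. -/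

section FundamentalSolution

/-- The regularised logarithmic kernel. -/
noncomputable def logKernel (δ : ℝ) (y : ℝ × ℝ) : ℝ := Real.log (y.1 ^ 2 + y.2 ^ 2 + δ)

theorem contDiffOn_logKernel {δ : ℝ} {U : Set (ℝ × ℝ)} (h : ∀ y ∈ U, y.1 ^ 2 + y.2 ^ 2 + δ ≠ 0) :
    ContDiffOn ℝ ∞ (logKernel δ) U := by
  refine ContDiffOn.log ?_ h
  fun_prop

theorem d1_logKernel {δ : ℝ} (hδ : 0 < δ) :
    d1 (logKernel δ) = fun y => 2 * y.1 / (y.1 ^ 2 + y.2 ^ 2 + δ) := funext fun y => by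
  have h : HasDerivAt (fun t : ℝ => t ^ 2 + y.2 ^ 2 + δ) (2 * y.1) y.1 := by
    simpa using ((hasDerivAt_pow 2 y.1).add_const (y.2 ^ 2)).add_const δ
  exact (h.log (by positivity)).deriv

theorem d2_logKernel {δ : ℝ} (hδ : 0 < δ) :
    d2 (logKernel δ) = fun y => 2 * y.2 / (y.1 ^ 2 + y.2 ^ 2 + δ) := funext fun y => by
  have h : HasDerivAt (fun t : ℝ => y.1 ^ 2 + t ^ 2 + δ) (2 * y.2) y.2 := by
    simpa using ((hasDerivAt_pow 2 y.2).const_add (y.1 ^ 2)).add_const δ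
  exact (h.log (by positivity)).deriv

theorem lap_logKernel {δ : ℝ} (hδ : 0 < δ) (y : ℝ × ℝ) :
    lap (logKernel δ) y = 4 * δ / (y.1 ^ 2 + y.2 ^ 2 + δ) ^ 2 := by
  have h0 : y.1 ^ 2 + y.2 ^ 2 + δ ≠ 0 := by positivity
  have h1 : HasDerivAt (fun t : ℝ => t ^ 2 + y.2 ^ 2 + δ) (2 * y.1) y.1 := by
    simpa using ((hasDerivAt_pow 2 y.1).add_const (y.2 ^ 2)).add_const δ
  have h2 : HasDerivAt (fun t : ℝ => y.1 ^ 2 + t ^ 2 + δ) (2 * y.2) y.2 := by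
    simpa using ((hasDerivAt_pow 2 y.2).const_add (y.1 ^ 2)).add_const δ
  have e1 := (((hasDerivAt_id y.1).const_mul 2).div h1 h0).deriv
  have e2 := (((hasDerivAt_id y.2).const_mul 2).div h2 h0).deriv
  rw [lap, d1_logKernel hδ, d2_logKernel hδ]
  refine (congrArg₂ (· + ·) e1 e2).trans ?_
  simp only [id]
  field_simp
  ring

/-- A bound independent of `δ`, for dominated convergence. Its singularity depends on `y.1` alone,
so local integrability reduces to that of the logarithm on the line. -/
theorem abs_logKernel_le {δ : ℝ} (h0 : 0 ≤ δ) (h1 : δ ≤ 1) {y : ℝ × ℝ} (hy : y.1 ≠ 0) :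
    |logKernel δ y| ≤ 2 * |Real.log y.1| + (y.1 ^ 2 + y.2 ^ 2 + 1) := by
  have hp : 0 < y.1 ^ 2 := by positivity
  have hs : 0 < y.1 ^ 2 + y.2 ^ 2 + δ := by positivity
  have e1 : Real.log (y.1 ^ 2 + y.2 ^ 2 + δ) ≤ y.1 ^ 2 + y.2 ^ 2 + 1 := by
    linarith [Real.log_le_sub_one_of_pos hs]
  have e2 : 2 * Real.log y.1 ≤ Real.log (y.1 ^ 2 + y.2 ^ 2 + δ) := by
    have := Real.log_le_log hp (by nlinarith [sq_nonneg y.2] : y.1 ^ 2 ≤ y.1 ^ 2 + y.2 ^ 2 + δ)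
    simpa [Real.log_pow] using this
  rw [logKernel, abs_le]
  constructor
  · nlinarith [neg_abs_le (Real.log y.1), sq_nonneg y.1, sq_nonneg y.2]
  · nlinarith [abs_nonneg (Real.log y.1)]

theorem ae_fst_ne_zero : ∀ᵐ y : ℝ × ℝ, y.1 ≠ 0 := by
  rw [Measure.volume_eq_prod]
  exact Measure.quasiMeasurePreserving_fst.ae (Measure.ae_ne volume (0 : ℝ))

theorem locallyIntegrable_log_fst : LocallyIntegrable fun y : ℝ × ℝ => Real.log y.1 := by
  intro x
  have h1 : IntegrableOn Real.log (Ioo (x.1 - 1) (x.1 + 1)) :=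
    ((intervalIntegrable_iff_integrableOn_Ioo_of_le (by linarith)).1
      intervalIntegral.intervalIntegrable_log')
  have h2 : IntegrableOn (fun _ : ℝ => (1 : ℝ)) (Ioo (x.2 - 1) (x.2 + 1)) :=
    integrableOn_const measure_Ioo_lt_top.ne
  refine ⟨Ioo (x.1 - 1) (x.1 + 1) ×ˢ Ioo (x.2 - 1) (x.2 + 1), prod_mem_nhds
    (Ioo_mem_nhds (by linarith) (by linarith)) (Ioo_mem_nhds (by linarith) (by linarith)), ?_⟩
  have := Integrable.mul_prod h1 h2
  rw [Measure.prod_restrict, ← Measure.volume_eq_prod] at this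
  simpa [IntegrableOn] using this

theorem measurable_logKernel (δ : ℝ) : Measurable (logKernel δ) := by
  unfold logKernel
  fun_prop

theorem locallyIntegrable_logBound : LocallyIntegrable
    fun y : ℝ × ℝ => 2 * |Real.log y.1| + (y.1 ^ 2 + y.2 ^ 2 + 1) := by
  have h1 : LocallyIntegrable fun y : ℝ × ℝ => 2 * |Real.log y.1| := fun x =>
    let ⟨s, hs, h⟩ := locallyIntegrable_log_fst x
    ⟨s, hs, h.abs.const_mul 2⟩
  exact h1.add (by fun_prop : Continuous fun y : ℝ × ℝ => y.1 ^ 2 + y.2 ^ 2 + 1).locallyIntegrable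

theorem locallyIntegrable_logKernel : LocallyIntegrable (logKernel 0) := fun x => by
  obtain ⟨s, hs, h⟩ := locallyIntegrable_logBound x
  refine ⟨s, hs, h.mono' (measurable_logKernel 0).aestronglyMeasurable ?_⟩
  exact ae_restrict_of_ae (ae_fst_ne_zero.mono fun y hy => abs_logKernel_le le_rfl zero_le_one hy)

/-- The function is dominated by a multiple of `(1 + ‖y‖)⁻⁴`, integrable in dimension two; the norm
of the product is the maximum norm, hence the comparison `‖y‖² ≤ y.1² + y.2²`. -/
theorem integrable_bump : Integrable fun y : ℝ × ℝ => 4 / (y.1 ^ 2 + y.2 ^ 2 + 1) ^ 2 := by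
  have h := (integrable_one_add_norm (E := ℝ × ℝ) (μ := volume) (r := 4) (by
    simp [Module.finrank_prod]; norm_num)).const_mul 16
  refine h.mono' (by fun_prop : Measurable _).aestronglyMeasurable (Eventually.of_forall fun y => ?_)
  rw [Real.norm_of_nonneg (by positivity), Real.rpow_neg (by positivity)]
  have e : (1 + ‖y‖) ^ (4 : ℝ) = (1 + ‖y‖) ^ 4 := by
    rw [← Real.rpow_natCast]; norm_num
  rw [e, ← div_eq_mul_inv, div_le_div_iff₀ (by positivity) (by positivity)]
  have h1 : ‖y‖ ^ 2 ≤ y.1 ^ 2 + y.2 ^ 2 := by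
    rw [Prod.norm_def]
    rcases max_cases ‖y.1‖ ‖y.2‖ with ⟨h, -⟩ | ⟨h, -⟩ <;> rw [h, Real.norm_eq_abs, sq_abs] <;>
      nlinarith [sq_nonneg y.1, sq_nonneg y.2]
  have h2 : (1 + ‖y‖) ^ 2 ≤ 2 * (y.1 ^ 2 + y.2 ^ 2 + 1) := by nlinarith [sq_nonneg (1 - ‖y‖)]
  have h3 : ((1 + ‖y‖) ^ 2) ^ 2 ≤ (2 * (y.1 ^ 2 + y.2 ^ 2 + 1)) ^ 2 :=
    pow_le_pow_left₀ (by positivity) h2 2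
  nlinarith

theorem integral_bump_pos : 0 < ∫ y : ℝ × ℝ, 4 / (y.1 ^ 2 + y.2 ^ 2 + 1) ^ 2 := by
  rw [integral_pos_iff_support_of_nonneg (fun y => by simp only [Pi.zero_apply]; positivity)
    integrable_bump]
  have : (Function.support fun y : ℝ × ℝ => 4 / (y.1 ^ 2 + y.2 ^ 2 + 1) ^ 2) = univ :=
    eq_univ_of_forall fun y => by
      rw [Function.mem_support]
      positivity
  simp [this]

theorem integral_mul_lap {u φ : ℝ × ℝ → ℝ} {U : Set (ℝ × ℝ)} (hU : IsOpen U)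
    (hu : ContDiffOn ℝ ∞ u U) (h : IsTest U φ) : ∫ x, u x * lap φ x = ∫ x, lap u x * φ x := by
  have i1 : Integrable fun x => u x * d1 (d1 φ) x := integrable_mul_test hu.continuousOn h.d1.d1
  have i2 : Integrable fun x => u x * d2 (d2 φ) x := integrable_mul_test hu.continuousOn h.d2.d2
  have c1 := contDiffOn_d1 hU hu
  have c2 := contDiffOn_d2 hU hu
  have i3 : Integrable fun x => d1 (d1 u) x * φ x :=
    integrable_mul_test (contDiffOn_d1 hU c1).continuousOn h
  have i4 : Integrable fun x => d2 (d2 u) x * φ x :=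
    integrable_mul_test (contDiffOn_d2 hU c2).continuousOn h
  simp only [lap, mul_add, add_mul]
  rw [integral_add i1 i2, integral_add i3 i4, integral_mul_d1 hU hu h.d1, integral_mul_d1 hU c1 h,
    integral_mul_d2 hU hu h.d2, integral_mul_d2 hU c2 h, neg_neg, neg_neg]

theorem IsTest.lap' {φ : ℝ × ℝ → ℝ} {U : Set (ℝ × ℝ)} (h : IsTest U φ) :
    IsTest U (CellStrip.lap φ) :=
  ⟨h.d1.d1.smooth.add h.d2.d2.smooth, h.d1.d1.compact.add h.d2.d2.compact,
    (tsupport_add _ _).trans (union_subset h.d1.d1.supp h.d2.d2.supp)⟩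

/-- The logarithm is a multiple of the fundamental solution of the Laplacian. -/
theorem integral_logKernel_mul_lap {f : ℝ × ℝ → ℝ} (hf : IsTest univ f) :
    ∫ y, logKernel 0 y * lap f y = (∫ y : ℝ × ℝ, 4 / (y.1 ^ 2 + y.2 ^ 2 + 1) ^ 2) * f 0 := by
  obtain ⟨C, hC0, hC⟩ := hf.exists_bound
  have hlap := hf.lap'
  have t1 : Tendsto (fun ε : ℝ => ∫ y, logKernel (ε ^ 2) y * lap f y) (𝓝[>] 0)
      (𝓝 (∫ y, logKernel 0 y * lap f y)) := by
    refine tendsto_integral_filter_of_dominated_convergence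
      (fun y => |lap f y| * (2 * |Real.log y.1| + (y.1 ^ 2 + y.2 ^ 2 + 1))) ?_ ?_ ?_ ?_
    · exact Eventually.of_forall fun ε => (measurable_logKernel _).aestronglyMeasurable.mul
        hlap.smooth.continuous.aestronglyMeasurable
    · filter_upwards [Ioo_mem_nhdsGT (zero_lt_one (α := ℝ))] with ε hε
      filter_upwards [ae_fst_ne_zero] with y hy
      rw [norm_mul, mul_comm]
      exact mul_le_mul_of_nonneg_left (abs_logKernel_le (sq_nonneg ε)
        (pow_le_one₀ hε.1.le hε.2.le) hy) (abs_nonneg _)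
    · exact locallyIntegrable_logBound.integrable_smul_left_of_hasCompactSupport
        hlap.smooth.continuous.abs hlap.compact.abs
    · filter_upwards [ae_fst_ne_zero] with y hy
      have hp : y.1 ^ 2 + y.2 ^ 2 + 0 ≠ 0 := by positivity
      refine Tendsto.mul_const _ ?_
      refine (Real.continuousAt_log hp).tendsto.comp ?_
      have : Continuous fun ε : ℝ => y.1 ^ 2 + y.2 ^ 2 + ε ^ 2 := by fun_prop
      exact (this.tendsto' 0 _ (by simp)).mono_left nhdsWithin_le_nhds
  -- After the substitution `y = εz` the Laplacian of the kernel regularised by `ε²` becomes a fixed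
  -- integrable bump, so it concentrates at the origin as `ε → 0`. The total mass only matters
  -- through being positive.
  have e : ∀ ε : ℝ, 0 < ε → ∫ y, logKernel (ε ^ 2) y * lap f y =
      ∫ z : ℝ × ℝ, 4 / (z.1 ^ 2 + z.2 ^ 2 + 1) ^ 2 * f (ε • z) := fun ε hε => by
    have hp : 0 < ε ^ 2 := by positivity
    rw [integral_mul_lap isOpen_univ (contDiffOn_logKernel fun y _ => by positivity) hf]
    have h := Measure.integral_comp_smul volume (fun y => lap (logKernel (ε ^ 2)) y * f y) ε
    rw [Module.finrank_prod, Module.finrank_self, abs_of_pos (by positivity), smul_eq_mul] at h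
    rw [← mul_inv_cancel_left₀ (pow_ne_zero (1 + 1) hε.ne')
      (∫ y, lap (logKernel (ε ^ 2)) y * f y), ← h, ← integral_const_mul]
    refine integral_congr_ae (Eventually.of_forall fun z => ?_)
    simp only [lap_logKernel hp, Prod.smul_fst, Prod.smul_snd, smul_eq_mul]
    field_simp
  have t2 : Tendsto (fun ε : ℝ => ∫ z : ℝ × ℝ, 4 / (z.1 ^ 2 + z.2 ^ 2 + 1) ^ 2 * f (ε • z)) (𝓝[>] 0)
      (𝓝 (∫ z : ℝ × ℝ, 4 / (z.1 ^ 2 + z.2 ^ 2 + 1) ^ 2 * f 0)) := by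
    refine tendsto_integral_filter_of_dominated_convergence
      (fun z => 4 / (z.1 ^ 2 + z.2 ^ 2 + 1) ^ 2 * C) ?_ ?_ (integrable_bump.mul_const C) ?_
    · exact Eventually.of_forall fun ε => integrable_bump.aestronglyMeasurable.mul
        (hf.smooth.continuous.comp (continuous_const_smul ε)).aestronglyMeasurable
    · refine Eventually.of_forall fun ε => Eventually.of_forall fun z => ?_
      rw [norm_mul, Real.norm_of_nonneg (by positivity)]
      exact mul_le_mul_of_nonneg_left (hC _) (by positivity)
    · refine Eventually.of_forall fun z => Tendsto.const_mul _ ?_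
      have : Continuous fun ε : ℝ => f (ε • z) :=
        hf.smooth.continuous.comp (continuous_id.smul continuous_const)
      exact (this.tendsto' 0 _ (by simp)).mono_left nhdsWithin_le_nhds
  rw [integral_mul_const] at t2
  refine tendsto_nhds_unique t1 (t2.congr' ?_)
  filter_upwards [self_mem_nhdsWithin] with ε hε
  exact (e ε hε).symm

theorem isTest_bump {x : ℝ × ℝ} (χ : ContDiffBump x) : IsTest (Metric.closedBall x χ.rOut) χ :=
  ⟨χ.contDiff, χ.hasCompactSupport, χ.tsupport_eq.subset⟩

/-- Truncating the logarithm by a bump `χ` that equals `1` near the origin changes its Laplacian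
only by terms with derivatives of `χ`. These vanish near the singularity, so the error `θ` is a test
function. -/
theorem exists_parametrix {r : ℝ} (hr : 0 < r) : ∃ (E θ : ℝ × ℝ → ℝ) (κ : ℝ), κ ≠ 0 ∧
    Integrable E ∧ (∀ y, r < ‖y‖ → E y = 0) ∧ IsTest univ θ ∧
    ∀ f, IsTest univ f → ∫ y, E y * lap f y = κ * f 0 + ∫ y, θ y * f y := by
  let χ : ContDiffBump (0 : ℝ × ℝ) := ⟨r / 2, r, by positivity, by linarith⟩
  have hχ := isTest_bump χ
  have hO : IsOpen ({0}ᶜ : Set (ℝ × ℝ)) := isOpen_compl_singleton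
  have hN : ContDiffOn ℝ ∞ (logKernel 0) {0}ᶜ := contDiffOn_logKernel fun y hy h => hy <| by
    have h1 : y.1 = 0 := by nlinarith [sq_nonneg y.1, sq_nonneg y.2]
    have h2 : y.2 = 0 := by nlinarith [sq_nonneg y.1, sq_nonneg y.2]
    exact Prod.ext h1 h2
  have hc : (χ : ℝ × ℝ → ℝ) =ᶠ[𝓝 0] fun _ => 1 := χ.eventuallyEq_one
  -- A test function vanishing near the origin is a test function in the punctured plane, where
  -- `logKernel 0` is smooth.
  have off : ∀ {g : ℝ × ℝ → ℝ}, IsTest (Metric.closedBall 0 χ.rOut) g → g =ᶠ[𝓝 0] (fun _ => 0) →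
      IsTest {0}ᶜ g := fun hg h0 => ⟨hg.smooth, hg.compact, fun y hy h => by
    rw [h] at hy
    exact notMem_tsupport_iff_eventuallyEq.2 h0 hy⟩
  have z1 : d1 χ =ᶠ[𝓝 0] fun _ => 0 := (d1_eventuallyEq hc).trans (EventuallyEq.of_eq (by ext; simp [d1]))
  have z2 : d2 χ =ᶠ[𝓝 0] fun _ => 0 := (d2_eventuallyEq hc).trans (EventuallyEq.of_eq (by ext; simp [d2]))
  have z11 : d1 (d1 χ) =ᶠ[𝓝 0] fun _ => 0 :=
    (d1_eventuallyEq z1).trans (EventuallyEq.of_eq (by ext; simp [d1]))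
  have z22 : d2 (d2 χ) =ᶠ[𝓝 0] fun _ => 0 :=
    (d2_eventuallyEq z2).trans (EventuallyEq.of_eq (by ext; simp [d2]))
  have t1 := off hχ.d1 z1
  have t2 := off hχ.d2 z2
  have t3 : IsTest {0}ᶜ (lap χ) := off hχ.lap' (by
    filter_upwards [z11, z22] with y h1 h2
    rw [lap, h1, h2, add_zero])
  have w1 := t1.mul_contDiffOn hO (contDiffOn_d1 hO hN)
  have w2 := t2.mul_contDiffOn hO (contDiffOn_d2 hO hN)
  have w3 := t3.mul_contDiffOn hO hN
  refine ⟨fun y => χ y * logKernel 0 y,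
    fun y => 2 * (d1 (logKernel 0) y * d1 χ y + d2 (logKernel 0) y * d2 χ y)
      + logKernel 0 y * lap χ y, _, integral_bump_pos.ne',
    locallyIntegrable_logKernel.integrable_smul_left_of_hasCompactSupport χ.continuous
      χ.hasCompactSupport, fun y hy => ?_, ?_, fun f hf => ?_⟩
  · simp only [χ.zero_of_le_dist (x := y) (by simpa using hy.le), zero_mul]
  · refine ⟨(contDiff_const.mul (w1.smooth.add w2.smooth)).add w3.smooth,
      ((w1.compact.add w2.compact).mul_left (f := fun _ => 2)).add w3.compact, subset_univ _⟩
  · have hχf : IsTest univ fun y => χ y * f y := hf.mul_left χ.contDiff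
    have h0 := integral_logKernel_mul_lap hχf
    simp only [hc.eq_of_nhds, one_mul] at h0
    rw [← h0]
    have p1 : IsTest {0}ᶜ fun y => f y * d1 χ y := t1.mul_left hf.smooth
    have p2 : IsTest {0}ᶜ fun y => f y * d2 χ y := t2.mul_left hf.smooth
    have p3 : IsTest {0}ᶜ fun y => f y * lap χ y := t3.mul_left hf.smooth
    have e : ∀ y, logKernel 0 y * lap (fun y => χ y * f y) y = χ y * logKernel 0 y * lap f y +
        (2 * (logKernel 0 y * d1 (fun y => f y * d1 χ y) y) +
        2 * (logKernel 0 y * d2 (fun y => f y * d2 χ y) y) - logKernel 0 y * (f y * lap χ y)) :=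
      fun y => by
        rw [lap_mul isOpen_univ χ.contDiff.contDiffOn hf.smooth.contDiffOn (mem_univ y),
          d1_mul (hf.differentiable y) (hχ.d1.differentiable y),
          d2_mul (hf.differentiable y) (hχ.d2.differentiable y), lap, lap]
        ring
    have j0 : Integrable fun y => χ y * logKernel 0 y * lap f y := by
      have := locallyIntegrable_logKernel.integrable_smul_left_of_hasCompactSupport
        (hf.lap'.mul_left χ.contDiff).smooth.continuous (hf.lap'.mul_left χ.contDiff).compact
      refine this.congr (Eventually.of_forall fun y => ?_)
      simp only [smul_eq_mul]
      ring
    have j1 : Integrable fun y => logKernel 0 y * d1 (fun y => f y * d1 χ y) y :=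
      integrable_mul_test hN.continuousOn p1.d1
    have j2 : Integrable fun y => logKernel 0 y * d2 (fun y => f y * d2 χ y) y :=
      integrable_mul_test hN.continuousOn p2.d2
    have j3 : Integrable fun y => logKernel 0 y * (f y * lap χ y) :=
      integrable_mul_test hN.continuousOn p3
    have k1 : Integrable fun y => d1 (logKernel 0) y * (f y * d1 χ y) :=
      integrable_mul_test (contDiffOn_d1 hO hN).continuousOn p1
    have k2 : Integrable fun y => d2 (logKernel 0) y * (f y * d2 χ y) :=
      integrable_mul_test (contDiffOn_d2 hO hN).continuousOn p2
    have e' : ∀ y, (2 * (d1 (logKernel 0) y * d1 χ y + d2 (logKernel 0) y * d2 χ y)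
        + logKernel 0 y * lap χ y) * f y = 2 * (d1 (logKernel 0) y * (f y * d1 χ y)) +
        2 * (d2 (logKernel 0) y * (f y * d2 χ y)) + logKernel 0 y * (f y * lap χ y) :=
      fun y => by ring
    have j12 : Integrable fun y => 2 * (logKernel 0 y * d1 (fun y => f y * d1 χ y) y) +
        2 * (logKernel 0 y * d2 (fun y => f y * d2 χ y) y) := (j1.const_mul 2).add (j2.const_mul 2)
    have j123 : Integrable fun y => 2 * (logKernel 0 y * d1 (fun y => f y * d1 χ y) y) +
        2 * (logKernel 0 y * d2 (fun y => f y * d2 χ y) y) - logKernel 0 y * (f y * lap χ y) :=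
      j12.sub j3
    have k12 : Integrable fun y => 2 * (d1 (logKernel 0) y * (f y * d1 χ y)) +
        2 * (d2 (logKernel 0) y * (f y * d2 χ y)) := (k1.const_mul 2).add (k2.const_mul 2)
    simp only [e, e']
    rw [integral_add j0 j123, integral_sub j12 j3, integral_add (j1.const_mul 2) (j2.const_mul 2),
      integral_add k12 j3, integral_add (k1.const_mul 2) (k2.const_mul 2)]
    simp only [integral_const_mul]
    rw [integral_mul_d1 hO hN p1, integral_mul_d2 hO hN p2]
    ring

end FundamentalSolution

/-! ### Convolution with test functions. -/

section Conv

variable {a b φ : ℝ × ℝ → ℝ} {S : Set (ℝ × ℝ)}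

/-- The convolution of two functions on the plane. -/
noncomputable def conv (a b : ℝ × ℝ → ℝ) (x : ℝ × ℝ) : ℝ := ∫ t, a t * b (x - t)

theorem conv_eq_convolution : conv a b = convolution a b (ContinuousLinearMap.mul ℝ ℝ) volume := rfl

theorem conv_comm (a b : ℝ × ℝ → ℝ) : conv a b = conv b a := funext fun x => by
  rw [conv, conv, ← integral_sub_left_eq_self _ volume x]
  simp [mul_comm]

theorem contDiff_conv (ha : LocallyIntegrable a) (h : IsTest S φ) : ContDiff ℝ ∞ (conv a φ) := by
  rw [conv_eq_convolution]
  exact h.compact.contDiff_convolution_right _ ha h.smooth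

theorem d1_conv (ha : LocallyIntegrable a) (h : IsTest S φ) : d1 (conv a φ) = conv a (d1 φ) :=
  funext fun x => by
    rw [conv_eq_convolution, d1_eq_of_hasFDerivAt (h.compact.hasFDerivAt_convolution_right
      (ContinuousLinearMap.mul ℝ ℝ) ha (h.smooth.of_le (by simp)) x),
      convolution_precompR_apply _ ha (h.compact.fderiv ℝ)
        (h.smooth.continuous_fderiv (by simp))]
    refine integral_congr_ae (Eventually.of_forall fun t => ?_)
    simp only [ContinuousLinearMap.mul_apply', d1_eq_fderiv (h.differentiable _)]

theorem d2_conv (ha : LocallyIntegrable a) (h : IsTest S φ) : d2 (conv a φ) = conv a (d2 φ) :=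
  funext fun x => by
    rw [conv_eq_convolution, d2_eq_of_hasFDerivAt (h.compact.hasFDerivAt_convolution_right
      (ContinuousLinearMap.mul ℝ ℝ) ha (h.smooth.of_le (by simp)) x),
      convolution_precompR_apply _ ha (h.compact.fderiv ℝ)
        (h.smooth.continuous_fderiv (by simp))]
    refine integral_congr_ae (Eventually.of_forall fun t => ?_)
    simp only [ContinuousLinearMap.mul_apply', d2_eq_fderiv (h.differentiable _)]

theorem integrable_conv_integrand (ha : LocallyIntegrable a) (h : IsTest S φ) (x : ℝ × ℝ) :
    Integrable fun t => a t * φ (x - t) :=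
  ha.integrable_smul_right_of_hasCompactSupport (h.smooth.continuous.comp (by fun_prop))
    (h.compact.comp_homeomorph (Homeomorph.subLeft x))

theorem lap_conv (ha : LocallyIntegrable a) (h : IsTest S φ) : lap (conv a φ) = conv a (lap φ) :=
  funext fun x => by
    rw [lap, d1_conv ha h, d1_conv ha h.d1, d2_conv ha h, d2_conv ha h.d2, conv, conv, conv,
      ← integral_add (integrable_conv_integrand ha h.d1.d1 x) (integrable_conv_integrand ha h.d2.d2 x)]
    simp only [lap, mul_add]

theorem IsTest.conv {r ρ : ℝ} {x₀ : ℝ × ℝ} (h : IsTest (Metric.closedBall x₀ ρ) φ)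
    (ha : LocallyIntegrable a) (har : ∀ t, r < ‖t‖ → a t = 0) :
    IsTest (Metric.closedBall x₀ (ρ + r)) (conv a φ) := by
  have hz : ∀ x, x ∉ Metric.closedBall x₀ (ρ + r) → CellStrip.conv a φ x = 0 := fun x hx => by
    refine integral_eq_zero_of_ae (Eventually.of_forall fun t => ?_)
    by_cases ht : r < ‖t‖
    · simp [har t ht]
    · have : x - t ∉ Metric.closedBall x₀ ρ := fun hm => hx <| by
        rw [Metric.mem_closedBall] at hm ⊢
        have h1 := dist_triangle x (x - t) x₀
        have h2 : dist x (x - t) = ‖t‖ := by simp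
        linarith [not_lt.1 ht]
      simp [h.eq_zero this]
  have hs : Function.support (CellStrip.conv a φ) ⊆ Metric.closedBall x₀ (ρ + r) := fun x hx =>
    by_contra fun h' => hx (hz x h')
  exact ⟨contDiff_conv ha h, HasCompactSupport.of_support_subset_isCompact
    (isCompact_closedBall _ _) hs, closure_minimal hs Metric.isClosed_closedBall⟩

/-- Fubini moves the convolution to the other factor at the price of reflecting the kernel. -/
theorem integral_mul_conv (ha : Integrable a) (hb : Integrable b) (h : IsTest S φ) :
    ∫ x, a x * conv b φ x = ∫ y, φ y * conv a (fun t => b (-t)) y := by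
  have hi : Integrable (Function.uncurry fun y x : ℝ × ℝ => φ y * (a x * b (-(y - x))))
      (volume.prod volume) := by
    have h0 := ha.convolution_integrand (ContinuousLinearMap.mul ℝ ℝ) hb.comp_neg
    obtain ⟨C, -, hC⟩ := h.exists_bound
    exact h0.bdd_mul (h.smooth.continuous.comp continuous_fst).aestronglyMeasurable
      (Eventually.of_forall fun p => hC p.1)
  have e : ∀ x, a x * conv b φ x = ∫ y, φ y * (a x * b (-(y - x))) := fun x => by
    rw [conv_comm, conv, ← integral_const_mul]
    refine integral_congr_ae (Eventually.of_forall fun y => ?_)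
    simp only [neg_sub]
    ring
  rw [integral_congr_ae (Eventually.of_forall e), ← integral_integral_swap hi]
  simp only [conv, ← integral_const_mul, neg_sub]

theorem d1_comp_const_sub (φ : ℝ × ℝ → ℝ) (x y : ℝ × ℝ) :
    d1 (fun y => φ (x - y)) y = -d1 φ (x - y) :=
  deriv_comp_const_sub (f := fun t => φ (t, x.2 - y.2)) x.1 y.1

theorem d2_comp_const_sub (φ : ℝ × ℝ → ℝ) (x y : ℝ × ℝ) :
    d2 (fun y => φ (x - y)) y = -d2 φ (x - y) :=
  deriv_comp_const_sub (f := fun t => φ (x.1 - y.1, t)) x.2 y.2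

theorem lap_comp_const_sub (φ : ℝ × ℝ → ℝ) (x y : ℝ × ℝ) :
    lap (fun y => φ (x - y)) y = lap φ (x - y) := by
  have e1 : d1 (fun y => φ (x - y)) = fun y => (-1) * d1 φ (x - y) :=
    funext fun y => by rw [d1_comp_const_sub]; ring
  have e2 : d2 (fun y => φ (x - y)) = fun y => (-1) * d2 φ (x - y) :=
    funext fun y => by rw [d2_comp_const_sub]; ring
  rw [lap, e1, e2, d1_const_mul, d2_const_mul, d1_comp_const_sub, d2_comp_const_sub, lap]
  ring

theorem IsTest.comp_const_sub (h : IsTest S φ) (x : ℝ × ℝ) : IsTest univ fun y => φ (x - y) :=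
  ⟨h.smooth.comp (contDiff_const.sub contDiff_id),
    h.compact.comp_homeomorph (Homeomorph.subLeft x), subset_univ _⟩

end Conv

/-! ### Weyl's lemma. -/

section Weyl

variable {u h : ℝ × ℝ → ℝ} {U : Set (ℝ × ℝ)}

/-- Testing the equation with `E * φ` for the parametrix `E` gives `κ ∫ uφ = ∫ h (E * φ) - ∫ u (θ *
φ)`. Moving the convolutions off `φ` exhibits `u` as a combination of two convolutions, one with the
smooth `h` and one with the smooth `θ`. -/
theorem exists_contDiff_ae_eq_near (hU : IsOpen U) (hu : LocallyIntegrableOn u U)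
    (hh : ContDiffOn ℝ ∞ h U) (hw : ∀ φ, IsTest U φ → ∫ x, u x * lap φ x = ∫ x, h x * φ x)
    {x₀ : ℝ × ℝ} (hx₀ : x₀ ∈ U) : ∃ r > 0, ∃ V : ℝ × ℝ → ℝ, ContDiff ℝ ∞ V ∧
      ∀ᵐ x, x ∈ Metric.ball x₀ r → u x = V x := by
  obtain ⟨ε, hε, hεU⟩ := Metric.nhds_basis_closedBall.mem_iff.1 (hU.mem_nhds hx₀)
  -- The function `φ` lives in the ball of radius `r` and `E` has radius `r`, so `E * φ` lives in
  -- radius `2r`, where the cutoff `χ` equals `1`; `χ` is supported in radius `3r`, inside `U`.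
  set r := ε / 3 with hr
  have hr0 : 0 < r := by positivity
  let χ : ContDiffBump x₀ := ⟨2 * r, 3 * r, by positivity, by linarith⟩
  have hsub : Metric.closedBall x₀ (3 * r) ⊆ U := by
    rwa [show 3 * r = ε by rw [hr]; ring]
  have hχ : IsTest (Metric.closedBall x₀ (3 * r)) χ := isTest_bump χ
  obtain ⟨E, θ, κ, hκ, hE, hEr, hθ, hpar⟩ := exists_parametrix hr0
  have hĥ := (hχ.mono hsub).mul_contDiffOn hU hh
  have hû : Integrable fun x => χ x * u x := by
    rw [← integrableOn_iff_integrable_of_support_subset (s := Metric.closedBall x₀ (3 * r))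
      fun x hx => by_contra fun h' => hx (by simp [hχ.eq_zero h'])]
    exact (hu.integrableOn_compact_subset hsub (isCompact_closedBall _ _)).continuousOn_mul
      χ.continuous.continuousOn (isCompact_closedBall _ _)
  have hθn : IsTest univ fun t => θ (-t) := by simpa using hθ.comp_const_sub 0
  have s1 : ContDiff ℝ ∞ (conv (fun x => h x * χ x) fun t => E (-t)) := by
    rw [conv_comm]
    exact contDiff_conv hE.comp_neg.locallyIntegrable hĥ
  have s2 : ContDiff ℝ ∞ (conv (fun x => χ x * u x) fun t => θ (-t)) :=
    contDiff_conv hû.locallyIntegrable hθn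
  set V : ℝ × ℝ → ℝ := fun x => κ⁻¹ * (conv (fun x => h x * χ x) (fun t => E (-t)) x -
    conv (fun x => χ x * u x) (fun t => θ (-t)) x) with hV
  have sV : ContDiff ℝ ∞ V := contDiff_const.mul (s1.sub s2)
  refine ⟨r, hr0, V, sV, ?_⟩
  have hz : ∀ᵐ x, x ∈ Metric.ball x₀ r → χ x * u x - V x = 0 := by
    refine IsOpen.ae_eq_zero_of_integral_contDiff_smul_eq_zero Metric.isOpen_ball
      ((hû.locallyIntegrable.sub sV.continuous.locallyIntegrable).locallyIntegrableOn _)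
      fun φ φs φc φt => ?_
    have hφ : IsTest (Metric.closedBall x₀ r) φ := ⟨φs, φc, φt.trans Metric.ball_subset_closedBall⟩
    have hΦ := hφ.conv hE.locallyIntegrable hEr
    have hΦ1 : ∀ {g : ℝ × ℝ → ℝ}, IsTest (Metric.closedBall x₀ (r + r)) g → ∀ x, χ x * g x = g x :=
      fun {g} hg x => by
        by_cases hx : x ∈ Metric.closedBall x₀ (r + r)
        · rw [χ.one_of_mem_closedBall (by rwa [← two_mul] at hx), one_mul]
        · rw [hg.eq_zero hx, mul_zero]
    have e0 := hw _ (hΦ.mono ((Metric.closedBall_subset_closedBall (by linarith)).trans hsub))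
    have e1 : ∫ x, u x * lap (conv E φ) x = ∫ x, (χ x * u x) * lap (conv E φ) x := by
      refine integral_congr_ae (Eventually.of_forall fun x => ?_)
      simp only
      linear_combination -u x * hΦ1 hΦ.lap' x
    have e2 : ∫ x, h x * conv E φ x = ∫ x, (h x * χ x) * conv E φ x := by
      refine integral_congr_ae (Eventually.of_forall fun x => ?_)
      simp only
      rw [mul_assoc, hΦ1 hΦ x]
    have e3 : ∀ x, lap (conv E φ) x = κ * φ x + conv θ φ x := fun x => by
      rw [lap_conv hE.locallyIntegrable hφ]
      have := hpar _ (hφ.comp_const_sub x)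
      simpa only [lap_comp_const_sub, sub_zero, conv] using this
    have bdd : ∀ {S : Set (ℝ × ℝ)} {g : ℝ × ℝ → ℝ}, IsTest S g →
        Integrable fun x => χ x * u x * g x := fun hg =>
      let ⟨C, _, hC⟩ := hg.exists_bound
      hû.mul_bdd hg.smooth.continuous.aestronglyMeasurable (Eventually.of_forall hC)
    have i1 : Integrable fun x => χ x * u x * (κ * φ x) := bdd (hφ.mul_left contDiff_const)
    have i2 : Integrable fun x => φ x * conv (fun x => χ x * u x) (fun t => θ (-t)) x :=
      (s2.continuous.mul φs.continuous).integrable_of_hasCompactSupport φc.mul_left |>.congr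
        (Eventually.of_forall fun x => mul_comm _ _)
    have i3 : Integrable fun x => φ x * conv (fun x => h x * χ x) (fun t => E (-t)) x :=
      (s1.continuous.mul φs.continuous).integrable_of_hasCompactSupport φc.mul_left |>.congr
        (Eventually.of_forall fun x => mul_comm _ _)
    have i4 : Integrable fun x => χ x * u x * conv θ φ x := by
      refine ((bdd hΦ.lap').sub i1).congr (Eventually.of_forall fun x => ?_)
      simp only [e3, Pi.sub_apply]
      ring
    rw [e1, e2, integral_mul_conv hĥ.integrable hE hφ] at e0
    simp only [e3, mul_add] at e0
    rw [integral_add i1 i4, integral_mul_conv hû hθ.integrable hφ] at e0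
    have e4 : ∀ x, φ x • (χ x * u x - V x) = κ⁻¹ * (χ x * u x * (κ * φ x)) -
        κ⁻¹ * (φ x * conv (fun x => h x * χ x) (fun t => E (-t)) x -
          φ x * conv (fun x => χ x * u x) (fun t => θ (-t)) x) := fun x => by
      rw [hV, smul_eq_mul]
      field_simp
    calc ∫ x, φ x • (χ x * u x - V x) = _ := integral_congr_ae (Eventually.of_forall e4)
      _ = 0 := by
        have i5 : Integrable fun x => κ⁻¹ * (φ x * conv (fun x => h x * χ x) (fun t => E (-t)) x -
            φ x * conv (fun x => χ x * u x) (fun t => θ (-t)) x) := (i3.sub i2).const_mul _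
        rw [integral_sub (i1.const_mul _) i5, integral_const_mul, integral_const_mul,
          integral_sub i3 i2, ← e0]
        ring
  filter_upwards [hz] with x hx hxr
  have := hx hxr
  rw [χ.one_of_mem_closedBall (Metric.ball_subset_closedBall
    (Metric.ball_subset_ball (by linarith : r ≤ 2 * r) hxr)), one_mul] at this
  linarith

/-- Two local representatives agree almost everywhere on the overlap of their balls, hence
everywhere there by continuity, so `y ↦ V y y` is smooth. -/
theorem exists_contDiffOn_ae_eq (hU : IsOpen U) (hu : LocallyIntegrableOn u U)
    (hh : ContDiffOn ℝ ∞ h U) (hw : ∀ φ, IsTest U φ → ∫ x, u x * lap φ x = ∫ x, h x * φ x) :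
    ∃ v : ℝ × ℝ → ℝ, ContDiffOn ℝ ∞ v U ∧ u =ᵐ[volume.restrict U] v := by
  choose! r hr V hV hVu using fun x hx =>
    exists_contDiff_ae_eq_near (x₀ := x) hU hu hh hw hx
  have key : ∀ x ∈ U, EqOn (fun y => V y y) (V x) (U ∩ Metric.ball x (r x)) := fun x hx y hy => by
    refine Measure.eqOn_open_of_ae_eq (μ := volume) (U := Metric.ball y (r y) ∩ Metric.ball x (r x))
      ?_ (Metric.isOpen_ball.inter Metric.isOpen_ball) (hV y hy.1).continuous.continuousOn
      (hV x hx).continuous.continuousOn ⟨Metric.mem_ball_self (hr y hy.1), hy.2⟩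
    refine (ae_restrict_iff' (Metric.isOpen_ball.inter Metric.isOpen_ball).measurableSet).2 ?_
    filter_upwards [hVu x hx, hVu y hy.1] with z h1 h2 hz
    rw [← h1 hz.2, h2 hz.1]
  refine ⟨fun y => V y y, fun x hx => ?_, ?_⟩
  · refine ((hV x hx).contDiffAt.congr_of_eventuallyEq ?_).contDiffWithinAt
    exact (key x hx).eventuallyEq_of_mem
      (inter_mem (hU.mem_nhds hx) (Metric.ball_mem_nhds x (hr x hx)))
  · refine (ae_restrict_iff' hU.measurableSet).2 ?_
    refine measure_null_of_locally_null _ fun x hx => ?_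
    have hxU : x ∈ U := by_contra fun h' => hx fun h'' => absurd h'' h'
    refine ⟨_, inter_mem_nhdsWithin _ (Metric.ball_mem_nhds x (hr x hxU)), ?_⟩
    refine measure_mono_null (t := {y | y ∈ Metric.ball x (r x) → u y = V x y}ᶜ)
      (fun y hy hy' => hy.1 fun hyU => ?_) (mem_ae_iff.1 (hVu x hxU))
    rw [hy' hy.2, ← key x hxU ⟨hyU, hy.2⟩]

end Weyl

/-! ### Locally integrable functions against test functions. -/

section LocallyIntegrable

variable {u f g φ : ℝ × ℝ → ℝ} {U : Set (ℝ × ℝ)}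

theorem integrable_mul_test_of_locallyIntegrableOn (hu : LocallyIntegrableOn u U)
    (h : IsTest U φ) : Integrable fun x => u x * φ x := by
  rw [← integrableOn_iff_integrable_of_support_subset (s := tsupport φ)
    ((Function.support_mul_subset_right u φ).trans (subset_tsupport φ))]
  exact (hu.integrableOn_compact_subset h.supp h.compact).mul_continuousOn
    h.smooth.continuous.continuousOn h.compact

theorem ae_eq_of_forall_integral_mul_test (hU : IsOpen U) (hf : LocallyIntegrableOn f U)
    (hg : LocallyIntegrableOn g U) (h : ∀ φ, IsTest U φ → ∫ x, f x * φ x = ∫ x, g x * φ x) :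
    f =ᵐ[volume.restrict U] g := by
  have := hU.ae_eq_zero_of_integral_contDiff_smul_eq_zero (hf.sub hg) fun φ φs φc φt => by
    have hφ : IsTest U φ := ⟨φs, φc, φt⟩
    have e : ∀ x, φ x • (f - g) x = f x * φ x - g x * φ x := fun x => by
      simp only [smul_eq_mul, Pi.sub_apply]
      ring
    simp only [e]
    rw [integral_sub (integrable_mul_test_of_locallyIntegrableOn hf hφ)
      (integrable_mul_test_of_locallyIntegrableOn hg hφ), h φ hφ, sub_self]
  refine (ae_restrict_iff' hU.measurableSet).2 (this.mono fun x hx hxU => ?_)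
  simpa [sub_eq_zero] using hx hxU

theorem MemLp.locallyIntegrableOn_of_restrict (h : MemLp f 2 (volume.restrict U)) :
    LocallyIntegrableOn f U :=
  locallyIntegrableOn_of_locallyIntegrable_restrict (h.locallyIntegrable (by norm_num))

theorem _root_.ContDiffOn.locallyIntegrableOn (hU : IsOpen U) (hf : ContDiffOn ℝ ∞ f U) :
    LocallyIntegrableOn f U :=
  hf.continuousOn.locallyIntegrableOn hU.measurableSet

end LocallyIntegrable

/-! ### Smooth solutions of the mixed problem. -/

section Existence

variable {F : ℝ → ℝ} {c : ℝ} {h : ℝ × ℝ → ℝ}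

/-- The variational solution is regularised by Weyl's lemma. The bound on `Y * (ξ.2 + c)⁻¹` is
retained as the only growth information at infinity. -/
theorem exists_isMixedSolution (hF : Continuous F) (hc : ∀ ξ ∈ aboveGraph F, 0 < ξ.2 + c)
    (hs : ContDiffOn ℝ ∞ h (cell F))
    (hh : MemLp (fun ξ => h ξ * (ξ.2 + c)) 2 (volume.restrict (cell F))) :
    ∃ Y, IsMixedSolution F h Y ∧
      MemLp (fun ξ => Y ξ * (ξ.2 + c)⁻¹) 2 (volume.restrict (cell F)) := by
  obtain ⟨u, g₁, g₂, hu, hg₁, hg₂, hweak, hvar⟩ := exists_variational_solution hF hc hh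
  have hO := isOpen_cell hF
  have hm := measurableSet_cell hF
  have lg₁ := MemLp.locallyIntegrableOn_of_restrict hg₁
  have lg₂ := MemLp.locallyIntegrableOn_of_restrict hg₂
  have lu : LocallyIntegrableOn u (cell F) := by
    have h1 := (MemLp.locallyIntegrableOn_of_restrict hu).mul_continuousOn
      (g := fun ξ : ℝ × ℝ => ξ.2 + c) (by fun_prop) hO.isLocallyClosed
    intro x hx
    obtain ⟨s, hs, hi⟩ := h1 x hx
    refine ⟨s ∩ cell F, inter_mem hs self_mem_nhdsWithin, ?_⟩
    refine (hi.mono_set inter_subset_left).congr (ae_restrict_of_ae_restrict_of_subset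
      inter_subset_right (ae_restrict_of_forall_mem hm fun ξ hξ => ?_))
    exact inv_mul_cancel_right₀ (hc ξ hξ.2).ne' _
  have cs : ∀ {φ : ℝ × ℝ → ℝ}, IsTest (cell F) φ → IsTest openStrip φ := fun hφ =>
    hφ.mono inter_subset_left
  have ca : ∀ {φ : ℝ × ℝ → ℝ}, IsTest (cell F) φ → IsTest (aboveGraph F) φ := fun hφ =>
    hφ.mono inter_subset_right
  have hw : ∀ φ, IsTest (cell F) φ → ∫ x, u x * lap φ x = ∫ x, h x * φ x := fun φ hφ => by
    have i1 := integrable_mul_test_of_locallyIntegrableOn lu hφ.d1.d1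
    have i2 := integrable_mul_test_of_locallyIntegrableOn lu hφ.d2.d2
    have j1 := integrable_mul_test_of_locallyIntegrableOn lg₁ hφ.d1
    have j2 := integrable_mul_test_of_locallyIntegrableOn lg₂ hφ.d2
    have e := hvar φ (ca hφ)
    rw [integral_add j1.integrableOn j2.integrableOn, hφ.setIntegral_eq] at e
    have e1 := (hweak _ (cs hφ.d1)).1
    have e2 := (hweak _ (cs hφ.d2)).2
    rw [hφ.d1.d1.setIntegral_eq] at e1
    rw [hφ.d2.d2.setIntegral_eq] at e2
    simp only [lap, mul_add]
    rw [integral_add i1 i2, e1, e2]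
    linarith
  obtain ⟨Y, hY, huY⟩ := exists_contDiffOn_ae_eq hO lu hs hw
  have dY₁ := contDiffOn_d1 hO hY
  have dY₂ := contDiffOn_d2 hO hY
  have eY : ∀ ψ : ℝ × ℝ → ℝ, ∫ ξ in cell F, Y ξ * ψ ξ = ∫ ξ in cell F, u ξ * ψ ξ := fun ψ =>
    integral_congr_ae (huY.mono fun ξ hξ => by simp only [hξ])
  -- Classical and weak gradient agree almost everywhere in the cell, so integrability, trace and
  -- variational identity carry over to `Y`.
  have e1 : d1 Y =ᵐ[volume.restrict (cell F)] g₁ :=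
    ae_eq_of_forall_integral_mul_test hO (dY₁.locallyIntegrableOn hO) lg₁ fun φ hφ => by
      have h1 := integral_mul_d1 hO hY hφ
      have h2 := (hweak _ (cs hφ)).1
      rw [← eY, hφ.d1.setIntegral_eq, hφ.setIntegral_eq] at h2
      linarith
  have e2 : d2 Y =ᵐ[volume.restrict (cell F)] g₂ :=
    ae_eq_of_forall_integral_mul_test hO (dY₂.locallyIntegrableOn hO) lg₂ fun φ hφ => by
      have h1 := integral_mul_d2 hO hY hφ
      have h2 := (hweak _ (cs hφ)).2
      rw [← eY, hφ.d2.setIntegral_eq, hφ.setIntegral_eq] at h2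
      linarith
  have hYw : MemLp (fun ξ => Y ξ * (ξ.2 + c)⁻¹) 2 (volume.restrict (cell F)) :=
    (memLp_congr_ae (huY.mono fun ξ hξ => by simp only [hξ])).1 hu
  refine ⟨Y, ⟨hY, fun R => ⟨?_, ?_, ?_⟩, ?_, fun φ hφ => ⟨?_, ?_⟩, fun φ hφ => ?_⟩, hYw⟩
  · refine (hYw.mono_measure (Measure.restrict_mono inter_subset_left le_rfl)).of_le_mul
      (c := R + c) ((hY.continuousOn.mono inter_subset_left).aestronglyMeasurable
        (hm.inter (isOpen_snd_lt R).measurableSet)) ?_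
    filter_upwards [ae_restrict_mem (hm.inter (isOpen_snd_lt R).measurableSet)] with ξ hξ
    have h1 := hc ξ hξ.1.2
    have h2 : ξ.2 < R := hξ.2
    rw [norm_mul, norm_inv, Real.norm_of_nonneg h1.le]
    have h3 : ‖Y ξ‖ = (ξ.2 + c) * (‖Y ξ‖ * (ξ.2 + c)⁻¹) := by field_simp
    exact h3.trans_le <| mul_le_mul_of_nonneg_right (by linarith) (by positivity)
  · exact ((memLp_congr_ae e1).2 hg₁).mono_measure (Measure.restrict_mono inter_subset_left le_rfl)
  · exact ((memLp_congr_ae e2).2 hg₂).mono_measure (Measure.restrict_mono inter_subset_left le_rfl)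
  · have lY := contDiffOn_lap hO hY
    refine Measure.eqOn_open_of_ae_eq (μ := volume) ?_ hO lY.continuousOn hs.continuousOn
    refine ae_eq_of_forall_integral_mul_test hO (lY.locallyIntegrableOn hO)
      (hs.locallyIntegrableOn hO) fun φ hφ => ?_
    rw [← integral_mul_lap hO hY hφ, ← hw φ hφ, ← hφ.lap'.setIntegral_eq, ← hφ.lap'.setIntegral_eq,
      eY]
  · rw [eY, (hweak φ hφ).1]
    exact congrArg _ (integral_congr_ae (e1.mono fun ξ hξ => by simp only [hξ]))
  · rw [eY, (hweak φ hφ).2]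
    exact congrArg _ (integral_congr_ae (e2.mono fun ξ hξ => by simp only [hξ]))
  · rw [← hvar φ hφ]
    refine integral_congr_ae ?_
    filter_upwards [e1, e2] with ξ h1 h2
    rw [h1, h2]

end Existence

/-! ### Continuity in `L²` of dilations and translations. -/

section AffineMaps

variable {b g : ℝ × ℝ → ℝ} {l h : ℝ} {τ : ℝ × ℝ}

/-- The dilation by `l` in the first variable followed by the translation by `-τ`. -/
def shear (l : ℝ) (τ ξ : ℝ × ℝ) : ℝ × ℝ := (l * ξ.1 - τ.1, ξ.2 - τ.2)

theorem continuous_shear (l : ℝ) (τ : ℝ × ℝ) : Continuous (shear l τ) := by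
  unfold shear
  fun_prop

theorem map_shear (hl : l ≠ 0) (τ : ℝ × ℝ) :
    Measure.map (shear l τ) volume = ENNReal.ofReal |l⁻¹| • volume := by
  have e : shear l τ = Prod.map (fun s => l * s - τ.1) (fun t => t - τ.2) := rfl
  have h1 : Measure.map (fun s : ℝ => l * s - τ.1) volume = ENNReal.ofReal |l⁻¹| • volume := by
    rw [show (fun s : ℝ => l * s - τ.1) = (fun s => s - τ.1) ∘ (fun s => l * s) from rfl,
      ← Measure.map_map (by fun_prop) (by fun_prop), Real.map_volume_mul_left hl,
      Measure.map_smul, (measurePreserving_sub_right volume τ.1).map_eq]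
  rw [e, Measure.volume_eq_prod, ← Measure.map_prod_map _ _ (by fun_prop) (by fun_prop), h1,
    (measurePreserving_sub_right volume τ.2).map_eq, Measure.prod_smul_left]

/-- The change of variables contributes `l^(-1/2)`, crudely at most `2` for `l ≥ 1/2`; only
uniformity in `l` and `τ` matters. -/
theorem eLpNorm_comp_shear_le (hl : 1 / 2 ≤ l) (hg : AEStronglyMeasurable g volume) :
    eLpNorm (fun ξ => g (shear l τ ξ)) 2 volume ≤ 2 * eLpNorm g 2 volume := by
  have hm := map_shear (by linarith : l ≠ 0) τ
  have h0 := eLpNorm_map_measure (p := 2) (f := shear l τ) (μ := volume) (g := g)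
    (by rw [hm]; exact hg.smul_measure _) (continuous_shear l τ).measurable.aemeasurable
  have hc : ENNReal.ofReal |l⁻¹| ≤ 2 := by
    rw [abs_of_nonneg (by positivity), ← ENNReal.ofReal_ofNat]
    refine ENNReal.ofReal_le_ofReal ?_
    rw [inv_le_comm₀ (by linarith) (by norm_num)]
    linarith
  rw [hm, eLpNorm_smul_measure_of_ne_top (by norm_num)] at h0
  refine h0.symm.le.trans (mul_le_mul_left ?_ _)
  refine (ENNReal.rpow_le_rpow hc (by positivity)).trans ?_
  refine (ENNReal.rpow_le_rpow_of_exponent_le (by norm_num) (z := 1) ?_).trans_eq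
    (ENNReal.rpow_one _)
  norm_num

theorem memLp_comp_shear (hl : 1 / 2 ≤ l) (hg : MemLp g 2) :
    MemLp (fun ξ => g (shear l τ ξ)) 2 := by
  refine ⟨?_, (eLpNorm_comp_shear_le hl hg.1).trans_lt
    (ENNReal.mul_lt_top (by norm_num) hg.2)⟩
  refine AEStronglyMeasurable.comp_aemeasurable ?_ (continuous_shear l τ).measurable.aemeasurable
  rw [map_shear (by linarith)]
  exact hg.1.smul_measure _

/-- For maps close to the identity the difference is supported in a fixed ball, whose radius allows
for `l ≥ 1/2`, and is uniformly small by uniform continuity. -/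
theorem exists_eLpNorm_comp_shear_sub_le_of_continuous {f : ℝ × ℝ → ℝ} (hf : Continuous f)
    (hc : HasCompactSupport f) {ε : ℝ} (hε : 0 < ε) : ∃ δ > 0, ∀ l τ, |l - 1| < δ → ‖τ‖ < δ →
      eLpNorm (fun ξ => f (shear l τ ξ) - f ξ) 2 volume ≤ ENNReal.ofReal ε := by
  obtain ⟨K, hK0, hK⟩ := hc.isCompact.isBounded.subset_closedBall_lt 0 (0 : ℝ × ℝ)
  set B := Metric.closedBall (0 : ℝ × ℝ) (2 * (K + 1)) with hB
  set V := (volume B) ^ (2 : ℝ)⁻¹ with hV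
  have hVt : V ≠ ⊤ := (ENNReal.rpow_lt_top_of_nonneg (by norm_num)
    (isCompact_closedBall _ _).measure_lt_top.ne).ne
  set ε' := ε / (V.toReal + 1) with hε'
  have hε'0 : 0 < ε' := by positivity
  obtain ⟨δ, hδ, hδf⟩ := Metric.uniformContinuous_iff.1
    (hc.uniformContinuous_of_continuous hf) ε' hε'0
  refine ⟨min (1 / 2) (δ / (2 * (2 * (K + 1) + 1))), by positivity, fun l τ hl hτ => ?_⟩
  have hl1 := (lt_min_iff.1 hl).1
  have hl2 := (lt_min_iff.1 hl).2
  have hτ1 := (lt_min_iff.1 hτ).1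
  have hτ2 := (lt_min_iff.1 hτ).2
  obtain ⟨hl3, hl4⟩ := abs_lt.1 hl1
  have n1 : |τ.1| ≤ ‖τ‖ := norm_fst_le τ
  have n2 : |τ.2| ≤ ‖τ‖ := norm_snd_le τ
  have hz : ∀ ξ, ξ ∉ B → f (shear l τ ξ) - f ξ = 0 := fun ξ hξ => by
    have h1 : f ξ = 0 := image_eq_zero_of_notMem_tsupport fun h => hξ <|
      Metric.closedBall_subset_closedBall (by linarith) (hK h)
    have h2 : f (shear l τ ξ) = 0 := image_eq_zero_of_notMem_tsupport fun h => hξ <| by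
      have h3 := hK h
      rw [mem_closedBall_zero_iff, Prod.norm_def, max_le_iff] at h3 ⊢
      simp only [shear, Real.norm_eq_abs] at h3
      have h4 := abs_le.1 h3.1
      have h5 := abs_le.1 h3.2
      have h6 := abs_le.1 n1
      have h7 := abs_le.1 n2
      have hl0 : 0 < l := by linarith
      constructor
      · rw [Real.norm_eq_abs]
        have : l * |ξ.1| ≤ K + 1 / 2 := by
          rw [← abs_of_pos hl0, ← abs_mul, abs_le]
          constructor <;> linarith
        nlinarith [abs_nonneg ξ.1]
      · rw [Real.norm_eq_abs, abs_le]
        constructor <;> linarith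
    rw [h1, h2, sub_zero]
  have hb : ∀ ξ, ‖f (shear l τ ξ) - f ξ‖ ≤ ε' := fun ξ => by
    by_cases hξ : ξ ∈ B
    · rw [← dist_eq_norm]
      refine (hδf ?_).le
      rw [hB, mem_closedBall_zero_iff] at hξ
      have m1 : |ξ.1| ≤ 2 * (K + 1) := (norm_fst_le ξ).trans hξ
      rw [dist_eq_norm, Prod.norm_def, max_lt_iff]
      have hd : δ / (2 * (2 * (K + 1) + 1)) * (2 * (2 * (K + 1) + 1)) = δ := by field_simp
      constructor
      · have e : (shear l τ ξ - ξ).1 = (l - 1) * ξ.1 - τ.1 := by simp [shear]; ring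
        rw [e, Real.norm_eq_abs]
        have := abs_sub ((l - 1) * ξ.1) τ.1
        rw [abs_mul] at this
        nlinarith [abs_nonneg (l - 1), abs_nonneg ξ.1]
      · have e : (shear l τ ξ - ξ).2 = - τ.2 := by simp [shear]
        rw [e, norm_neg, Real.norm_eq_abs]
        nlinarith
    · rw [hz ξ hξ, norm_zero]
      exact hε'0.le
  have hs : Function.support (fun ξ => f (shear l τ ξ) - f ξ) ⊆ B := fun ξ hξ =>
    by_contra fun h => hξ (hz ξ h)
  rw [← eLpNorm_restrict_eq_of_support_subset hs]
  refine (eLpNorm_le_of_ae_bound (Eventually.of_forall hb)).trans ?_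
  rw [Measure.restrict_apply_univ, ENNReal.toReal_ofNat, ← hV, ← ENNReal.ofReal_toReal hVt,
    ← ENNReal.ofReal_mul ENNReal.toReal_nonneg]
  refine ENNReal.ofReal_le_ofReal ?_
  rw [hε', ← mul_div_assoc, div_le_iff₀ (by positivity)]
  nlinarith [ENNReal.toReal_nonneg (a := V)]

/-- Density of compactly supported continuous functions, together with the uniform bound on the
composition operators. -/
theorem exists_eLpNorm_comp_shear_sub_le (hg : MemLp g 2) {ε : ℝ} (hε : 0 < ε) :
    ∃ δ > 0, ∀ l τ, |l - 1| < δ → ‖τ‖ < δ →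
      eLpNorm (fun ξ => g (shear l τ ξ) - g ξ) 2 volume ≤ ENNReal.ofReal ε := by
  obtain ⟨f, fc, fg, fcont, fL⟩ := hg.exists_hasCompactSupport_eLpNorm_sub_le (by norm_num)
    (ε := ENNReal.ofReal (ε / 4)) (by simpa using hε)
  obtain ⟨δ, hδ, hδf⟩ := exists_eLpNorm_comp_shear_sub_le_of_continuous fcont fc
    (by positivity : 0 < ε / 4)
  refine ⟨min δ (1 / 2), by positivity, fun l τ hl hτ => ?_⟩
  have hl' : 1 / 2 ≤ l := by
    have := (abs_lt.1 (lt_min_iff.1 hl).2).1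
    linarith
  have hgf := hg.sub fL
  have i1 := memLp_comp_shear (τ := τ) hl' hgf
  have i2 : MemLp (fun ξ => f (shear l τ ξ) - f ξ) 2 := (memLp_comp_shear (τ := τ) hl' fL).sub fL
  have e : (fun ξ => g (shear l τ ξ) - g ξ) = (fun ξ => (g - f) (shear l τ ξ)) +
      (fun ξ => f (shear l τ ξ) - f ξ) - (g - f) := by
    ext ξ
    simp only [Pi.sub_apply, Pi.add_apply]
    ring
  rw [e]
  have h2 := hδf l τ (lt_min_iff.1 hl).1 (lt_min_iff.1 hτ).1
  have h1 := eLpNorm_comp_shear_le (τ := τ) hl' hgf.1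
  refine (eLpNorm_sub_le (i1.add i2).1 hgf.1 (by norm_num)).trans ?_
  refine (add_le_add (eLpNorm_add_le i1.1 i2.1 (by norm_num)) le_rfl).trans ?_
  refine (add_le_add (add_le_add (h1.trans (mul_le_mul_right fg 2)) h2) fg).trans ?_
  rw [← ENNReal.ofReal_ofNat, ← ENNReal.ofReal_mul (by norm_num),
    ← ENNReal.ofReal_add (by positivity) (by positivity),
    ← ENNReal.ofReal_add (by positivity) (by positivity)]
  exact ENNReal.ofReal_le_ofReal (by linarith)

theorem abs_integral_mul_le (hb : MemLp b 2) (hg : MemLp g 2) :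
    |∫ ξ, b ξ * g ξ| ≤ (eLpNorm b 2 volume).toReal * (eLpNorm g 2 volume).toReal := by
  have h1 := abs_real_inner_le_norm (hb.toLp b) (hg.toLp g)
  rw [inner_Lp_eq, Lp.norm_toLp, Lp.norm_toLp] at h1
  refine le_trans (le_of_eq ?_) h1
  exact congrArg _ (integral_congr_ae (hb.coeFn_toLp.mono fun ξ hξ => by simp only [hξ]))

/-- Mollified dilations and translations converge weakly to the identity. -/
theorem exists_abs_integral_conv_shear_sub_le (hb : MemLp b 2) (hg : MemLp g 2)
    (hbm : Measurable b) (hgm : Measurable g) {ε : ℝ} (hε : 0 < ε) :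
    ∃ δ > 0, ∀ l h, |l - 1| < δ → |h| < δ → ∀ χ : ContDiffBump (0 : ℝ × ℝ), |h| + χ.rOut < δ →
      |(∫ ξ, b ξ * conv (χ.normed volume) g (shear l (0, h) ξ)) - ∫ ξ, b ξ * g ξ| ≤ ε := by
  set N := (eLpNorm b 2 volume).toReal with hN
  have hN0 : 0 ≤ N := ENNReal.toReal_nonneg
  obtain ⟨δ, hδ, hδg⟩ := exists_eLpNorm_comp_shear_sub_le hg (by positivity : 0 < ε / (N + 1))
  refine ⟨min δ (1 / 2), by positivity, fun l h hl hh χ hχ => ?_⟩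
  have hl' : 1 / 2 ≤ l := by
    have := (abs_lt.1 (lt_min_iff.1 hl).2).1
    linarith
  set ρ := χ.normed volume with hρ
  have hρc : Continuous ρ := χ.continuous_normed
  have hρi : Integrable ρ := χ.integrable_normed
  have hρ1 : ∫ t, ρ t = 1 := χ.integral_normed
  have hρ0 : ∀ t, 0 ≤ ρ t := χ.nonneg_normed
  have b2 : Integrable fun ξ => b ξ ^ 2 := hb.integrable_sq
  have g2 : Integrable fun ξ => g ξ ^ 2 := hg.integrable_sq
  have bg : Integrable fun ξ => b ξ * g ξ := hb.integrable_mul hg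
  have hmap : Measure.map (Prod.map (shear l (0, h)) id)
      ((volume : Measure (ℝ × ℝ)).prod (volume : Measure (ℝ × ℝ))) =
      ENNReal.ofReal |l⁻¹| • (volume.prod volume) := by
    rw [← Measure.map_prod_map _ _ (continuous_shear _ _).measurable measurable_id,
      map_shear (by linarith), Measure.map_id, Measure.prod_smul_left]
  have i1 : Integrable (fun p : (ℝ × ℝ) × (ℝ × ℝ) => ρ p.2 * g (shear l (0, h) p.1 - p.2) ^ 2)
      (volume.prod volume) := by
    have h0 := hρi.convolution_integrand (ContinuousLinearMap.mul ℝ ℝ) g2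
    have h1 : Integrable (fun p : (ℝ × ℝ) × (ℝ × ℝ) =>
        (ContinuousLinearMap.mul ℝ ℝ) (ρ p.2) (g (p.1 - p.2) ^ 2))
        (Measure.map (Prod.map (shear l (0, h)) id) (volume.prod volume)) := by
      rw [hmap]
      exact h0.smul_measure ENNReal.ofReal_ne_top
    exact h1.comp_measurable ((continuous_shear _ _).measurable.prodMap measurable_id)
  have i2 : Integrable (fun p : (ℝ × ℝ) × (ℝ × ℝ) => b p.1 ^ 2 * ρ p.2) (volume.prod volume) :=
    b2.mul_prod hρi
  have hms := (continuous_shear l (0, h)).measurable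
  have i3 : Integrable (fun p : (ℝ × ℝ) × (ℝ × ℝ) =>
      b p.1 * (ρ p.2 * g (shear l (0, h) p.1 - p.2))) (volume.prod volume) := by
    refine (i1.add i2).mono' ?_ (Eventually.of_forall fun p => ?_)
    · exact ((hbm.comp measurable_fst).mul ((hρc.measurable.comp measurable_snd).mul
        (hgm.comp ((hms.comp measurable_fst).sub measurable_snd)))).aestronglyMeasurable
    · have h0 := hρ0 p.2
      rw [Real.norm_eq_abs, abs_mul, abs_mul, abs_of_nonneg h0, Pi.add_apply,
        ← sq_abs (g _), ← sq_abs (b _)]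
      have := mul_nonneg h0 (sq_nonneg (|b p.1| - |g (shear l (0, h) p.1 - p.2)|))
      have := mul_nonneg h0 (mul_nonneg (abs_nonneg (b p.1))
        (abs_nonneg (g (shear l (0, h) p.1 - p.2))))
      nlinarith
  have i4 : Integrable (fun p : (ℝ × ℝ) × (ℝ × ℝ) => (b p.1 * g p.1) * ρ p.2)
      (volume.prod volume) := bg.mul_prod hρi
  have e1 : ∫ ξ, b ξ * conv ρ g (shear l (0, h) ξ) =
      ∫ p : (ℝ × ℝ) × (ℝ × ℝ), b p.1 * (ρ p.2 * g (shear l (0, h) p.1 - p.2))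
        ∂(volume.prod volume) := by
    rw [integral_prod _ i3]
    simp only [conv, integral_const_mul]
  have e2 : ∫ ξ, b ξ * g ξ =
      ∫ p : (ℝ × ℝ) × (ℝ × ℝ), (b p.1 * g p.1) * ρ p.2 ∂(volume.prod volume) := by
    rw [integral_prod_mul (fun ξ => b ξ * g ξ) ρ, hρ1, mul_one]
  have i5 : Integrable (fun p : (ℝ × ℝ) × (ℝ × ℝ) =>
      b p.1 * (ρ p.2 * g (shear l (0, h) p.1 - p.2)) - (b p.1 * g p.1) * ρ p.2)
      (volume.prod volume) := i3.sub i4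
  rw [e1, e2, ← integral_sub i3 i4, integral_prod_symm _ i5, ← Real.norm_eq_abs]
  refine (norm_integral_le_of_norm_le (g := fun t => ρ t * ε) (hρi.mul_const ε)
    (Eventually.of_forall fun t => ?_)).trans_eq (by rw [integral_mul_const, hρ1, one_mul])
  -- For fixed `t` the mollifier only adds `t` to the translation, so the pairing is an average over
  -- `t` of pairings to which the `L²` continuity applies.
  have e3 : ∀ ξ, b ξ * (ρ t * g (shear l (0, h) ξ - t)) - (b ξ * g ξ) * ρ t =
      ρ t * (b ξ * (g (shear l ((0, h) + t) ξ) - g ξ)) := fun ξ => by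
    have : shear l (0, h) ξ - t = shear l ((0, h) + t) ξ := by
      ext <;> simp [shear]
      ring
    rw [this]
    ring
  simp only [e3]
  rw [integral_const_mul, norm_mul, Real.norm_of_nonneg (hρ0 t), Real.norm_eq_abs]
  by_cases ht : ρ t = 0
  · simp [ht]
  have ht' : t ∈ Metric.ball (0 : ℝ × ℝ) χ.rOut := by
    rw [← χ.support_normed_eq (μ := volume)]
    exact ht
  rw [mem_ball_zero_iff] at ht'
  have hτ : ‖((0 : ℝ), h) + t‖ < δ := by
    refine (norm_add_le _ _).trans_lt ?_
    have : ‖((0 : ℝ), h)‖ = |h| := by simp [Prod.norm_def]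
    rw [this]
    linarith [(lt_min_iff.1 hχ).1]
  have h1 := hδg l _ (lt_min_iff.1 hl).1 hτ
  have m : MemLp (fun ξ => g (shear l ((0, h) + t) ξ) - g ξ) 2 := (memLp_comp_shear hl' hg).sub hg
  refine mul_le_mul_of_nonneg_left ((abs_integral_mul_le hb m).trans ?_) (hρ0 t)
  have h2 := ENNReal.toReal_mono ENNReal.ofReal_ne_top h1
  rw [ENNReal.toReal_ofReal (by positivity)] at h2
  refine (mul_le_mul_of_nonneg_left h2 hN0).trans ?_
  rw [← mul_div_assoc, div_le_iff₀ (by positivity)]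
  nlinarith

end AffineMaps

/-! ### Approximation of weakly differentiable functions by test functions. -/

section Approximation

variable {F : ℝ → ℝ} {S T : Set (ℝ × ℝ)} {R : ℝ} {v g₁ g₂ b₁ b₂ : ℝ × ℝ → ℝ}

/-- There are maps `shear l (0, h)` arbitrarily close to the identity and mollifiers that take
functions on the cell with weak derivatives in `S` to test functions in `T`. -/
def HasApproxShear (F : ℝ → ℝ) (S T : Set (ℝ × ℝ)) (R : ℝ) : Prop :=
  ∀ δ > 0, ∃ (l h : ℝ) (χ : ContDiffBump (0 : ℝ × ℝ)), |l - 1| < δ ∧ |h| < δ ∧ |h| + χ.rOut < δ ∧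
    (∀ ξ ∈ cell F, Metric.closedBall (shear l (0, h) ξ) χ.rOut ⊆ S) ∧
    ∃ K, IsCompact K ∧ K ⊆ T ∧ ∀ ξ t : ℝ × ℝ, ‖t‖ < χ.rOut → shear l (0, h) ξ - t ∈ cell F →
      (shear l (0, h) ξ - t).2 < R → ξ ∈ K ∧ ξ.2 < R + 2

/-- The upward shift `h` is fixed before the dilation and the mollification radius. By uniform
continuity of `F` their effect on the graph is then a fraction of `h`, so a lifted function stays at
height at least `h / 4` above it. -/
theorem IsProfile.exists_compact_of_shear (hF : IsProfile F) {h : ℝ} (h0 : 0 < h) (h1 : h < 1)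
    (R : ℝ) : ∃ s₀ > 0, ∃ K, IsCompact K ∧ K ⊆ aboveGraph F ∧ ∀ l, |l - 1| ≤ s₀ →
      ∀ ξ t : ℝ × ℝ, ‖t‖ < s₀ → shear l (0, h) ξ - t ∈ cell F →
      (shear l (0, h) ξ - t).2 < R → ξ ∈ K ∧ ξ.2 < R + 2 := by
  obtain ⟨η, hη, hηF⟩ := Metric.uniformContinuous_iff.1 hF.uniformContinuous (h / 4) (by positivity)
  obtain ⟨M, -, hM⟩ := hF.exists_lower_bound
  set s₀ := min (1 / 8) (min (η / 6) (h / 4)) with hs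
  have hs1 : s₀ ≤ 1 / 8 := min_le_left _ _
  have hs2 : s₀ ≤ η / 6 := (min_le_right _ _).trans (min_le_left _ _)
  have hs3 : s₀ ≤ h / 4 := (min_le_right _ _).trans (min_le_right _ _)
  refine ⟨s₀, by positivity, (Icc (-2) 2 ×ˢ Icc (-M) (R + 2)) ∩ {ξ | F ξ.1 + h / 4 ≤ ξ.2},
    (isCompact_Icc.prod isCompact_Icc).inter_right (isClosed_le
      ((hF.continuous.comp continuous_fst).add continuous_const) continuous_snd),
    fun ξ hξ => ?_, fun l hl ξ t ht hc hR => ?_⟩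
  · have : F ξ.1 + h / 4 ≤ ξ.2 := hξ.2
    exact (by linarith : F ξ.1 < ξ.2)
  · obtain ⟨⟨c1, c2⟩, c3⟩ := hc
    have c3 : F (l * ξ.1 - 0 - t.1) < ξ.2 - h - t.2 := c3
    have c1 : -(1 / 2) < l * ξ.1 - 0 - t.1 := c1
    have c2 : l * ξ.1 - 0 - t.1 < 1 / 2 := c2
    have hR : ξ.2 - h - t.2 < R := hR
    rw [sub_zero] at c1 c2 c3
    have t1 := abs_lt.1 ((norm_fst_le t).trans_lt ht)
    have t2 := abs_lt.1 ((norm_snd_le t).trans_lt ht)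
    have hl' := abs_le.1 hl
    have hx : |ξ.1| ≤ 1 := by
      have h3 : l * |ξ.1| ≤ 5 / 8 := by
        rw [← abs_of_nonneg (by linarith : 0 ≤ l), ← abs_mul, abs_le]
        constructor <;> linarith
      nlinarith [abs_nonneg ξ.1]
    have hd : |l * ξ.1 - t.1 - ξ.1| < η := by
      have h3 : |(l - 1) * ξ.1| ≤ s₀ := by
        rw [abs_mul]
        nlinarith [abs_nonneg (l - 1), abs_nonneg ξ.1]
      have h4 := abs_le.1 h3
      rw [abs_lt]
      constructor <;> nlinarith
    have hF1 := abs_lt.1 (hηF hd)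
    have hx' := abs_le.1 hx
    have hMξ := hM ξ.1
    have h5 : F ξ.1 + h / 4 ≤ ξ.2 := by linarith
    refine ⟨⟨⟨⟨by linarith, by linarith⟩, ⟨by linarith, by linarith⟩⟩, h5⟩, by linarith⟩

/-- With `l = 1 - s < 1` the images of points of the cell stay away from the lateral sides, so
mollification only uses weak derivatives inside the strip. The new function may reach beyond the
sides, which is allowed for test functions above the graph. -/
theorem IsProfile.hasApproxShear_openStrip (hF : IsProfile F) (R : ℝ) :
    HasApproxShear F openStrip (aboveGraph F) R := fun δ hδ => by
  set h := min (δ / 2) (1 / 2) with hh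
  have h0 : 0 < h := by positivity
  have hle : h ≤ δ / 2 := min_le_left _ _
  obtain ⟨s₀, hs₀, K, hK, hKT, hs⟩ := hF.exists_compact_of_shear h0
    ((min_le_right (δ / 2) (1 / 2)).trans_lt (by norm_num)) R
  set s := min s₀ (min (δ / 2) (1 / 2)) with hs'
  have s0 : 0 < s := by positivity
  have s1 : s ≤ s₀ := min_le_left _ _
  have s2 : s ≤ δ / 2 := (min_le_right _ _).trans (min_le_left _ _)
  have s3 : s ≤ 1 / 2 := (min_le_right _ _).trans (min_le_right _ _)
  have hl : |1 - s - 1| = s := by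
    rw [show 1 - s - 1 = -s by ring, abs_neg, abs_of_pos s0]
  refine ⟨1 - s, h, ⟨s / 8, s / 4, by positivity, by linarith⟩, by linarith,
    by rw [abs_of_pos h0]; linarith, by rw [abs_of_pos h0]; simp only; linarith,
    fun ξ hξ y hy => ?_, K, hK, hKT,
    fun ξ t ht => hs (1 - s) (by linarith) ξ t (ht.trans_le (by simp only; linarith))⟩
  rw [Metric.mem_closedBall, dist_eq_norm] at hy
  have h1 := abs_le.1 ((norm_fst_le _).trans hy)
  simp only [shear, Prod.fst_sub, sub_zero] at h1
  obtain ⟨c1, c2⟩ := hξ.1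
  constructor <;> nlinarith

/-- With `l = 1 + s > 1` the support is squeezed towards the axis of the strip, so it becomes
compact in the cell. Weak derivatives are then needed across the lateral sides, where zero extension
provides them. -/
theorem IsProfile.hasApproxShear_univ (hF : IsProfile F) (R : ℝ) :
    HasApproxShear F univ (cell F) R := fun δ hδ => by
  set h := min (δ / 2) (1 / 2) with hh
  have h0 : 0 < h := by positivity
  have hle : h ≤ δ / 2 := min_le_left _ _
  obtain ⟨s₀, hs₀, K, hK, hKT, hs⟩ := hF.exists_compact_of_shear h0
    ((min_le_right (δ / 2) (1 / 2)).trans_lt (by norm_num)) R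
  set s := min s₀ (δ / 2) with hs'
  have s0 : 0 < s := by positivity
  have s1 : s ≤ s₀ := min_le_left _ _
  have s2 : s ≤ δ / 2 := min_le_right _ _
  have hl : |1 + s - 1| = s := by
    rw [show 1 + s - 1 = s by ring, abs_of_pos s0]
  refine ⟨1 + s, h, ⟨s / 8, s / 4, by positivity, by linarith⟩, by linarith,
    by rw [abs_of_pos h0]; linarith, by rw [abs_of_pos h0]; simp only; linarith,
    fun ξ hξ => subset_univ _, K ∩ {ξ | |ξ.1| ≤ (1 / 2 + s / 4) / (1 + s)},
    hK.inter_right (isClosed_le continuous_fst.abs continuous_const), fun ξ hξ => ?_,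
    fun ξ t ht hc hR => ?_⟩
  · refine ⟨abs_lt.1 (lt_of_le_of_lt hξ.2 ?_), hKT hξ.1⟩
    rw [div_lt_iff₀ (by positivity)]
    linarith
  · simp only at ht
    obtain ⟨h1, h2⟩ := hs (1 + s) (by linarith) ξ t (ht.trans_le (by linarith)) hc hR
    refine ⟨⟨h1, ?_⟩, h2⟩
    have t1 := abs_lt.1 ((norm_fst_le t).trans_lt ht)
    obtain ⟨⟨c1, c2⟩, -⟩ := hc
    simp only [shear, Prod.fst_sub, sub_zero] at c1 c2
    show |ξ.1| ≤ _
    rw [le_div_iff₀ (by positivity), ← abs_of_pos (by linarith : 0 < 1 + s), ← abs_mul, abs_le]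
    constructor <;> linarith

theorem isTest_normed (χ : ContDiffBump (0 : ℝ × ℝ)) : IsTest univ (χ.normed volume) :=
  ⟨χ.contDiff_normed, χ.hasCompactSupport_normed, subset_univ _⟩

theorem isTest_normed_sub (χ : ContDiffBump (0 : ℝ × ℝ)) {x : ℝ × ℝ}
    (h : Metric.closedBall x χ.rOut ⊆ S) : IsTest S fun t => χ.normed volume (x - t) := by
  obtain ⟨h1, h2, -⟩ := (isTest_normed χ).comp_const_sub x
  refine ⟨h1, h2, (closure_minimal (fun t ht => ?_) Metric.isClosed_closedBall).trans h⟩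
  have : x - t ∈ Metric.ball 0 χ.rOut := by
    rw [← χ.support_normed_eq (μ := volume)]
    exact ht
  rw [mem_ball_zero_iff] at this
  rw [Metric.mem_closedBall, dist_comm, dist_eq_norm]
  exact this.le

/-- At `x` the mollification tests `v` with a function supported in the ball about `x`, so the weak
derivative in `S` suffices. -/
theorem d1_conv_normed (χ : ContDiffBump (0 : ℝ × ℝ)) (hv : LocallyIntegrable v) {x : ℝ × ℝ}
    (hx : Metric.closedBall x χ.rOut ⊆ S)
    (hw : ∀ ψ, IsTest S ψ → ∫ ξ, v ξ * d1 ψ ξ = -∫ ξ, g₁ ξ * ψ ξ) :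
    d1 (conv (χ.normed volume) v) x = conv (χ.normed volume) g₁ x := by
  rw [conv_comm, d1_conv hv (isTest_normed χ), conv_comm _ g₁]
  have := hw _ (isTest_normed_sub χ hx)
  simp only [d1_comp_const_sub, mul_neg, integral_neg, neg_inj] at this
  exact this

theorem d2_conv_normed (χ : ContDiffBump (0 : ℝ × ℝ)) (hv : LocallyIntegrable v) {x : ℝ × ℝ}
    (hx : Metric.closedBall x χ.rOut ⊆ S)
    (hw : ∀ ψ, IsTest S ψ → ∫ ξ, v ξ * d2 ψ ξ = -∫ ξ, g₂ ξ * ψ ξ) :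
    d2 (conv (χ.normed volume) v) x = conv (χ.normed volume) g₂ x := by
  rw [conv_comm, d2_conv hv (isTest_normed χ), conv_comm _ g₂]
  have := hw _ (isTest_normed_sub χ hx)
  simp only [d2_comp_const_sub, mul_neg, integral_neg, neg_inj] at this
  exact this

theorem d1_comp_shear {G : ℝ × ℝ → ℝ} (hG : Differentiable ℝ G) (l : ℝ) (τ ξ : ℝ × ℝ) :
    d1 (fun ξ => G (shear l τ ξ)) ξ = l * d1 G (shear l τ ξ) := by
  have h1 : HasDerivAt (fun t : ℝ => l * t - τ.1) l ξ.1 := by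
    simpa using ((hasDerivAt_id ξ.1).const_mul l).sub_const τ.1
  have h2 := HasDerivAt.comp ξ.1 (hasDerivAt_d1 (hG (shear l τ ξ))) h1
  rw [mul_comm]
  exact h2.deriv

theorem d2_comp_shear {G : ℝ × ℝ → ℝ} (hG : Differentiable ℝ G) (l : ℝ) (τ ξ : ℝ × ℝ) :
    d2 (fun ξ => G (shear l τ ξ)) ξ = d2 G (shear l τ ξ) := by
  have h1 : HasDerivAt (fun t : ℝ => t - τ.2) 1 ξ.2 := (hasDerivAt_id ξ.2).sub_const τ.2
  have h2 := HasDerivAt.comp ξ.2 (hasDerivAt_d2 (hG (shear l τ ξ))) h1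
  rw [mul_one] at h2
  exact h2.deriv

/-- Orthogonality of `b` to the gradients of test functions extends to the weak gradient `(g₁, g₂)`
of `v`. A transformed mollification of `v` is a test function, its gradient is the transformed
mollification of `(g₁, g₂)` up to the factor `l`, and it converges weakly to the original. -/
theorem integral_eq_zero_of_forall_test (hap : HasApproxShear F S T R)
    (hv : LocallyIntegrable v) (hv0 : ∀ ξ, v ξ ≠ 0 → ξ ∈ cell F ∧ ξ.2 < R)
    (hg₁ : MemLp g₁ 2) (hg₂ : MemLp g₂ 2) (mg₁ : Measurable g₁) (mg₂ : Measurable g₂)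
    (hw₁ : ∀ ψ, IsTest S ψ → ∫ ξ, v ξ * d1 ψ ξ = -∫ ξ, g₁ ξ * ψ ξ)
    (hw₂ : ∀ ψ, IsTest S ψ → ∫ ξ, v ξ * d2 ψ ξ = -∫ ξ, g₂ ξ * ψ ξ)
    (hb₁ : MemLp b₁ 2) (hb₂ : MemLp b₂ 2) (mb₁ : Measurable b₁) (mb₂ : Measurable b₂)
    (hb₁0 : ∀ ξ, ξ ∉ cell F → b₁ ξ = 0) (hb₂0 : ∀ ξ, ξ ∉ cell F → b₂ ξ = 0)
    (hb : ∀ φ, IsTest T φ → (∀ ξ : ℝ × ℝ, R + 2 ≤ ξ.2 → φ ξ = 0) →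
      ∫ ξ, (b₁ ξ * d1 φ ξ + b₂ ξ * d2 φ ξ) = 0) :
    ∫ ξ, (b₁ ξ * g₁ ξ + b₂ ξ * g₂ ξ) = 0 := by
  have j1 : Integrable fun ξ => b₁ ξ * g₁ ξ := hb₁.integrable_mul hg₁
  have j2 : Integrable fun ξ => b₂ ξ * g₂ ξ := hb₂.integrable_mul hg₂
  rw [integral_add j1 j2]
  set P := ∫ ξ, b₁ ξ * g₁ ξ with hP
  set Q := ∫ ξ, b₂ ξ * g₂ ξ with hQ
  -- Each of the two pairings is off by at most `ε`, and the factor `l` by at most `ε(|P| + ε)`.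
  have key : ∀ ε, 0 < ε → ε ≤ 1 → |P + Q| ≤ ε * (3 + |P|) := fun ε hε hε1 => by
    obtain ⟨δ₁, hδ₁, H1⟩ := exists_abs_integral_conv_shear_sub_le hb₁ hg₁ mb₁ mg₁ hε
    obtain ⟨δ₂, hδ₂, H2⟩ := exists_abs_integral_conv_shear_sub_le hb₂ hg₂ mb₂ mg₂ hε
    obtain ⟨l, h, χ, hl, hh, hχ, hS, K, hK, hKT, hKs⟩ := hap (min (min δ₁ δ₂) ε) (by positivity)
    have l1 := lt_min_iff.1 (lt_min_iff.1 hl).1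
    have l2 := lt_min_iff.1 (lt_min_iff.1 hh).1
    have l3 := lt_min_iff.1 (lt_min_iff.1 hχ).1
    have n1 := H1 l h l1.1 l2.1 χ l3.1
    have n2 := H2 l h l1.2 l2.2 χ l3.2
    have n3 := (lt_min_iff.1 hl).2
    set G := conv (χ.normed volume) v with hG
    have sG : ContDiff ℝ ∞ G := by
      rw [hG, conv_comm]
      exact contDiff_conv hv (isTest_normed χ)
    have dG : Differentiable ℝ G := sG.differentiable (by simp)
    have hsupp : ∀ ξ, G (shear l (0, h) ξ) ≠ 0 → ξ ∈ K ∧ ξ.2 < R + 2 := fun ξ hξ => by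
      obtain ⟨t, ht⟩ : ∃ t, χ.normed volume t * v (shear l (0, h) ξ - t) ≠ 0 := by
        by_contra! h'
        exact hξ (by rw [hG, conv, integral_congr_ae (Eventually.of_forall h')]; simp)
      have ht1 : t ∈ Metric.ball (0 : ℝ × ℝ) χ.rOut := by
        rw [← χ.support_normed_eq (μ := volume)]
        exact left_ne_zero_of_mul ht
      obtain ⟨c1, c2⟩ := hv0 _ (right_ne_zero_of_mul ht)
      exact hKs ξ t (mem_ball_zero_iff.1 ht1) c1 c2
    have hsub : Function.support (fun ξ => G (shear l (0, h) ξ)) ⊆ K := fun ξ hξ => (hsupp ξ hξ).1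
    have hφ : IsTest T fun ξ => G (shear l (0, h) ξ) := by
      refine ⟨sG.comp ?_, HasCompactSupport.of_support_subset_isCompact hK hsub,
        (closure_minimal hsub hK.isClosed).trans hKT⟩
      unfold shear
      fun_prop
    have h0 := hb _ hφ fun ξ hξ => by_contra fun h' => absurd (hsupp ξ h').2 (not_lt.2 hξ)
    have i1 : Integrable fun ξ => b₁ ξ * d1 (fun ξ => G (shear l (0, h) ξ)) ξ :=
      hb₁.integrable_mul (hφ.d1.memLp 2)
    have i2 : Integrable fun ξ => b₂ ξ * d2 (fun ξ => G (shear l (0, h) ξ)) ξ :=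
      hb₂.integrable_mul (hφ.d2.memLp 2)
    have e1 : ∀ ξ, b₁ ξ * d1 (fun ξ => G (shear l (0, h) ξ)) ξ =
        l * (b₁ ξ * conv (χ.normed volume) g₁ (shear l (0, h) ξ)) := fun ξ => by
      by_cases hξ : ξ ∈ cell F
      · rw [d1_comp_shear dG, hG, d1_conv_normed χ hv (hS ξ hξ) hw₁]
        ring
      · rw [hb₁0 ξ hξ]
        ring
    have e2 : ∀ ξ, b₂ ξ * d2 (fun ξ => G (shear l (0, h) ξ)) ξ =
        b₂ ξ * conv (χ.normed volume) g₂ (shear l (0, h) ξ) := fun ξ => by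
      by_cases hξ : ξ ∈ cell F
      · rw [d2_comp_shear dG, hG, d2_conv_normed χ hv (hS ξ hξ) hw₂]
      · rw [hb₂0 ξ hξ]
        ring
    rw [integral_add i1 i2, integral_congr_ae (Eventually.of_forall e1),
      integral_congr_ae (Eventually.of_forall e2), integral_const_mul] at h0
    set p := ∫ ξ, b₁ ξ * conv (χ.normed volume) g₁ (shear l (0, h) ξ) with hp
    set q := ∫ ξ, b₂ ξ * conv (χ.normed volume) g₂ (shear l (0, h) ξ) with hq
    have m1 : |p| ≤ |P| + ε := by
      have := abs_sub_abs_le_abs_sub p P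
      linarith
    have e3 : P + Q = -(p - P) - (q - Q) - (l - 1) * p := by linear_combination h0
    have m2 : |(l - 1) * p| ≤ ε * (|P| + ε) := by
      rw [abs_mul]
      exact mul_le_mul n3.le m1 (abs_nonneg _) hε.le
    rw [e3]
    have a1 := abs_le.1 n1
    have a2 := abs_le.1 n2
    have a3 := abs_le.1 m2
    rw [abs_le]
    constructor <;> nlinarith
  by_contra hne
  have hpos : 0 < |P + Q| := abs_pos.2 hne
  have h3 : 0 < 3 + |P| := by positivity
  have h4 := key (min 1 (|P + Q| / (2 * (3 + |P|)))) (by positivity) (min_le_left _ _)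
  have h5 : min 1 (|P + Q| / (2 * (3 + |P|))) * (3 + |P|) ≤ |P + Q| / 2 := by
    refine (mul_le_mul_of_nonneg_right (min_le_right _ _) h3.le).trans_eq ?_
    field_simp
  linarith

end Approximation

/-! ### Energy estimate at infinity and vanishing of bounded solutions. -/

section Uniqueness

variable {F : ℝ → ℝ} {S T : Set (ℝ × ℝ)} {w : ℝ × ℝ → ℝ}

/-- A smooth cutoff equal to `1` on `(-∞, R]` and to `0` on `[2R, ∞)`. -/
noncomputable def upperCutoff (R t : ℝ) : ℝ := Real.smoothTransition (2 - R⁻¹ * t)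

theorem contDiff_upperCutoff (R : ℝ) : ContDiff ℝ ∞ (upperCutoff R) :=
  Real.smoothTransition.contDiff.comp (by fun_prop)

theorem upperCutoff_eq_one {R t : ℝ} (hR : 0 < R) (ht : t ≤ R) : upperCutoff R t = 1 := by
  refine Real.smoothTransition.one_of_one_le ?_
  have : R⁻¹ * t ≤ 1 := by
    rw [inv_mul_le_iff₀ hR, mul_one]
    exact ht
  linarith

theorem upperCutoff_eq_zero {R t : ℝ} (hR : 0 < R) (ht : 2 * R ≤ t) : upperCutoff R t = 0 := by
  refine Real.smoothTransition.zero_of_nonpos ?_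
  have : 2 ≤ R⁻¹ * t := by
    rw [le_inv_mul_iff₀ hR]
    linarith
  linarith

theorem exists_abs_deriv_upperCutoff_le : ∃ C : ℝ, 0 ≤ C ∧ ∀ R t : ℝ, 0 < R →
    |deriv (upperCutoff R) t| ≤ C / R ∧
    (t ∉ Icc R (2 * R) → deriv (upperCutoff R) t = 0) := by
  obtain ⟨C, hC0, hC⟩ := exists_bound_deriv_smoothTransition
  refine ⟨C, hC0, fun R t hR => ?_⟩
  have hd : ∀ x, deriv (upperCutoff R) x =
      deriv Real.smoothTransition (2 - R⁻¹ * x) * (-R⁻¹) := fun x => by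
    have h1 : HasDerivAt (fun t : ℝ => 2 - R⁻¹ * t) (-R⁻¹) x := by
      simpa using ((hasDerivAt_id x).const_mul R⁻¹).const_sub 2
    have h2 := ((Real.smoothTransition.contDiff (n := 1)).differentiable (by simp)
      (2 - R⁻¹ * x)).hasDerivAt
    exact (h2.comp x h1).deriv
  have hz : t ∉ Icc R (2 * R) → deriv (upperCutoff R) t = 0 := fun ht => by
    rw [mem_Icc, not_and_or, not_le, not_le] at ht
    rcases ht with ht | ht
    · have : upperCutoff R =ᶠ[𝓝 t] fun _ => 1 :=
        (eventually_lt_nhds ht).mono fun y hy => upperCutoff_eq_one hR hy.le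
      rw [this.deriv_eq, deriv_const]
    · have : upperCutoff R =ᶠ[𝓝 t] fun _ => 0 :=
        (eventually_gt_nhds ht).mono fun y hy => upperCutoff_eq_zero hR hy.le
      rw [this.deriv_eq, deriv_const]
  refine ⟨?_, hz⟩
  by_cases ht : t ∈ Icc R (2 * R)
  · have h1 : R⁻¹ * t ≤ 2 := by
      rw [inv_mul_le_iff₀ hR, mul_comm]
      exact ht.2
    have h2 := hC (2 - R⁻¹ * t)
    rw [abs_of_nonneg (by linarith : 0 ≤ 2 - R⁻¹ * t + 1)] at h2
    have h3 : |deriv Real.smoothTransition (2 - R⁻¹ * t)| ≤ C := by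
      nlinarith [abs_nonneg (deriv Real.smoothTransition (2 - R⁻¹ * t))]
    rw [hd, abs_mul, abs_neg, abs_of_pos (inv_pos.2 hR), div_eq_mul_inv]
    exact mul_le_mul_of_nonneg_right h3 (inv_pos.2 hR).le
  · rw [hz ht, abs_zero]
    positivity

theorem integrableOn_cell_mul_test {u φ : ℝ × ℝ → ℝ} (hF : Continuous F)
    (hu : ∀ R, MemLp u 2 (volume.restrict (cell F ∩ {ξ | ξ.2 < R}))) (hφ : IsTest S φ) :
    IntegrableOn (fun ξ => u ξ * φ ξ) (cell F) := by
  obtain ⟨R, hR⟩ := hφ.exists_eq_zero_above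
  have h1 : IntegrableOn (fun ξ => u ξ * φ ξ) (cell F ∩ {ξ | ξ.2 < R}) :=
    (hu R).integrable_mul ((hφ.memLp 2).restrict _)
  refine h1.of_forall_sdiff_eq_zero (measurableSet_cell hF) fun ξ hξ => ?_
  rw [hR ξ (not_lt.1 fun h => hξ.2 ⟨hξ.1, h⟩), mul_zero]

theorem measurable_indicator_of_continuousOn {A : Set (ℝ × ℝ)} {f : ℝ × ℝ → ℝ}
    (hA : MeasurableSet A) (hf : ContinuousOn f A) : Measurable (A.indicator f) := by
  classical
  rw [← piecewise_eq_indicator]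
  exact hf.measurable_piecewise continuousOn_const hA

/-- The Caccioppoli inequality at infinity. -/
theorem setIntegral_sq_gradient_le (hF : IsProfile F) (hap : ∀ R, HasApproxShear F S T R)
    (hw : ContDiffOn ℝ ∞ w (cell F)) (hH : LocallyH1 F w) (hz : ZeroTraceIn F S w)
    (hv : ∀ φ, IsTest T φ → ∫ ξ in cell F, (d1 w ξ * d1 φ ξ + d2 w ξ * d2 φ ξ) = 0)
    {t₀ B : ℝ} (hB : ∀ ξ ∈ cell F, t₀ ≤ ξ.2 → |w ξ| ≤ B) :
    ∃ C, ∀ R, 0 < R → t₀ ≤ R →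
      ∫ ξ in cell F ∩ {ξ | ξ.2 < R}, (d1 w ξ ^ 2 + d2 w ξ ^ 2) ≤ C / R := by
  obtain ⟨C, hC0, hC⟩ := exists_abs_deriv_upperCutoff_le
  refine ⟨4 * (C ^ 2 * B ^ 2), fun R hR htR => ?_⟩
  have hm := measurableSet_cell hF.continuous
  have hO := isOpen_cell hF.continuous
  set η := upperCutoff R with hη
  have ηs : ContDiff ℝ ∞ η := contDiff_upperCutoff R
  have ηd : ∀ t, HasDerivAt η (deriv η t) t := fun t => (ηs.differentiable (by simp) t).hasDerivAt
  have ηc : Continuous (deriv η) := ηs.continuous_deriv (by simp)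
  have η1 : ∀ t, |η t| ≤ 1 := fun t => by
    rw [hη, upperCutoff, abs_of_nonneg (Real.smoothTransition.nonneg _)]
    exact Real.smoothTransition.le_one _
  -- The cutoff ends at `2R`. Lifting and mollifying may raise the support up to `2R + 2`, and the
  -- truncation of the gradient must happen strictly above that.
  set A := cell F ∩ {ξ : ℝ × ℝ | ξ.2 < 2 * R + 3} with hA
  have hAm : MeasurableSet A := hm.inter (isOpen_snd_lt _).measurableSet
  have c0 : ContinuousOn w A := hw.continuousOn.mono inter_subset_left
  have c1 : ContinuousOn (d1 w) A := (contDiffOn_d1 hO hw).continuousOn.mono inter_subset_left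
  have c2 : ContinuousOn (d2 w) A := (contDiffOn_d2 hO hw).continuousOn.mono inter_subset_left
  obtain ⟨m0, m1, m2⟩ := hH (2 * R + 3)
  have hηc : Continuous fun ξ : ℝ × ℝ => η ξ.2 ^ 2 := (ηs.continuous.comp continuous_snd).pow 2
  have hη'c : Continuous fun ξ : ℝ × ℝ => 2 * η ξ.2 * deriv η ξ.2 :=
    ((continuous_const.mul (ηs.continuous.comp continuous_snd))).mul (ηc.comp continuous_snd)
  have z0 : ∀ t, 2 * R ≤ t → η t = 0 := fun t ht => upperCutoff_eq_zero hR ht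
  have bη : ∀ t, |η t ^ 2| ≤ 1 := fun t => by
    rw [abs_pow]
    exact pow_le_one₀ (abs_nonneg _) (η1 t)
  have bη' : ∀ t, |2 * η t * deriv η t| ≤ 2 * (C / R) := fun t => by
    rw [abs_mul, abs_mul, abs_two]
    have := (hC R t hR).1
    nlinarith [η1 t, abs_nonneg (η t), abs_nonneg (deriv η t)]
  have mul_mem : ∀ {k : ℝ × ℝ → ℝ} {f : ℝ × ℝ → ℝ} {D : ℝ}, Continuous k → (∀ ξ, |k ξ| ≤ D) →
      MemLp f 2 (volume.restrict A) → MemLp (fun ξ => k ξ * f ξ) 2 (volume.restrict A) :=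
    fun {k f D} hk hD hf => hf.of_le_mul (c := D)
      (hk.aestronglyMeasurable.mul hf.1) (Eventually.of_forall fun ξ => by
        rw [norm_mul]
        exact mul_le_mul_of_nonneg_right (hD ξ) (norm_nonneg _))
  have M0 := mul_mem hηc (fun ξ => bη ξ.2) m0
  have M1 := mul_mem hηc (fun ξ => bη ξ.2) m1
  have M2 := (mul_mem hηc (fun ξ => bη ξ.2) m2).add (mul_mem hη'c (fun ξ => bη' ξ.2) m0)
  have ind : ∀ {f ψ : ℝ × ℝ → ℝ}, (∀ ξ, 2 * R ≤ ξ.2 → f ξ = 0) →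
      ∫ ξ, A.indicator f ξ * ψ ξ = ∫ ξ in cell F, f ξ * ψ ξ := fun {f ψ} hf => by
    have e : ∀ ξ, A.indicator f ξ * ψ ξ = A.indicator (fun ξ => f ξ * ψ ξ) ξ := fun ξ => by
      by_cases h : ξ ∈ A <;> simp [h]
    rw [integral_congr_ae (Eventually.of_forall e), integral_indicator hAm]
    refine (setIntegral_eq_of_subset_of_forall_sdiff_eq_zero hm inter_subset_left
      fun ξ hξ => ?_).symm
    have h2 : 2 * R + 3 ≤ ξ.2 := not_lt.1 fun h => hξ.2 ⟨hξ.1, h⟩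
    rw [hf ξ (by linarith), zero_mul]
  have ηψ : ∀ {ψ : ℝ × ℝ → ℝ}, IsTest S ψ → IsTest S fun ξ => η ξ.2 ^ 2 * ψ ξ := fun hψ =>
    hψ.mul_left ((ηs.comp contDiff_snd).pow 2)
  have hw1 : ∀ ψ, IsTest S ψ → ∫ ξ, A.indicator (fun ξ => η ξ.2 ^ 2 * w ξ) ξ * d1 ψ ξ =
      -∫ ξ, A.indicator (fun ξ => η ξ.2 ^ 2 * d1 w ξ) ξ * ψ ξ := fun ψ hψ => by
    rw [ind fun ξ hξ => by simp [z0 _ hξ], ind fun ξ hξ => by simp [z0 _ hξ]]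
    have h := (hz _ (ηψ hψ)).1
    have e : ∀ ξ, d1 (fun ξ => η ξ.2 ^ 2 * ψ ξ) ξ = η ξ.2 ^ 2 * d1 ψ ξ := fun ξ => by
      simp [d1]
    simp only [e] at h
    refine Eq.trans ?_ (h.trans (congrArg _ ?_))
    · exact integral_congr_ae (Eventually.of_forall fun ξ => by simp only; ring)
    · exact integral_congr_ae (Eventually.of_forall fun ξ => by simp only; ring)
  have hw2 : ∀ ψ, IsTest S ψ → ∫ ξ, A.indicator (fun ξ => η ξ.2 ^ 2 * w ξ) ξ * d2 ψ ξ =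
      -∫ ξ, A.indicator (fun ξ => η ξ.2 ^ 2 * d2 w ξ + 2 * η ξ.2 * deriv η ξ.2 * w ξ) ξ * ψ ξ :=
      fun ψ hψ => by
    rw [ind fun ξ hξ => by simp [z0 _ hξ], ind fun ξ hξ => by simp [z0 _ hξ]]
    have h := (hz _ (ηψ hψ)).2
    have e : ∀ ξ, d2 (fun ξ => η ξ.2 ^ 2 * ψ ξ) ξ =
        2 * η ξ.2 * deriv η ξ.2 * ψ ξ + η ξ.2 ^ 2 * d2 ψ ξ := fun ξ => by
      have h1 : HasDerivAt (fun t => η t ^ 2) (2 * η ξ.2 * deriv η ξ.2) ξ.2 := by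
        simpa using (ηd ξ.2).fun_pow 2
      exact (h1.mul (hasDerivAt_d2 (hψ.differentiable ξ))).deriv
    have i1 : IntegrableOn (fun ξ => w ξ * (2 * η ξ.2 * deriv η ξ.2 * ψ ξ)) (cell F) := by
      have ht : IsTest S fun ξ => 2 * η ξ.2 * deriv η ξ.2 * ψ ξ := hψ.mul_left
        ((contDiff_const.mul (ηs.comp contDiff_snd)).mul
          ((contDiff_infty_iff_deriv.1 ηs).2.comp contDiff_snd))
      exact integrableOn_cell_mul_test hF.continuous (fun R => (hH R).1) ht
    have i2 : IntegrableOn (fun ξ => w ξ * (η ξ.2 ^ 2 * d2 ψ ξ)) (cell F) :=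
      integrableOn_cell_mul_test hF.continuous (fun R => (hH R).1) (ηψ hψ.d2)
    have i3 : IntegrableOn (fun ξ => d2 w ξ * (η ξ.2 ^ 2 * ψ ξ)) (cell F) :=
      integrableOn_cell_mul_test hF.continuous (fun R => (hH R).2.2) (ηψ hψ)
    simp only [e, mul_add] at h
    rw [integral_add i1 i2] at h
    have e1 : ∫ ξ in cell F, η ξ.2 ^ 2 * w ξ * d2 ψ ξ =
        ∫ ξ in cell F, w ξ * (η ξ.2 ^ 2 * d2 ψ ξ) :=
      integral_congr_ae (Eventually.of_forall fun ξ => by simp only; ring)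
    have e2 : ∫ ξ in cell F, (η ξ.2 ^ 2 * d2 w ξ + 2 * η ξ.2 * deriv η ξ.2 * w ξ) * ψ ξ =
        ∫ ξ in cell F, (d2 w ξ * (η ξ.2 ^ 2 * ψ ξ) + w ξ * (2 * η ξ.2 * deriv η ξ.2 * ψ ξ)) :=
      integral_congr_ae (Eventually.of_forall fun ξ => by simp only; ring)
    rw [e1, e2, integral_add i3 i1]
    linarith
  have L0 : MemLp (A.indicator fun ξ => η ξ.2 ^ 2 * w ξ) 2 :=
    (memLp_indicator_iff_restrict hAm).2 M0
  -- This is the weak equation for `w` tested with `η²w` itself.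
  have main := integral_eq_zero_of_forall_test (F := F) (S := S) (T := T) (R := 2 * R)
    (v := A.indicator fun ξ => η ξ.2 ^ 2 * w ξ)
    (g₁ := A.indicator fun ξ => η ξ.2 ^ 2 * d1 w ξ)
    (g₂ := A.indicator fun ξ => η ξ.2 ^ 2 * d2 w ξ + 2 * η ξ.2 * deriv η ξ.2 * w ξ)
    (b₁ := A.indicator (d1 w)) (b₂ := A.indicator (d2 w)) (hap _)
    (L0.locallyIntegrable (by norm_num))
    (fun ξ hξ => by
      by_cases h : ξ ∈ A
      · refine ⟨h.1, not_le.1 fun h' => hξ ?_⟩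
        simp [h, z0 _ h']
      · exact absurd (indicator_of_notMem h _) hξ)
    ((memLp_indicator_iff_restrict hAm).2 M1) ((memLp_indicator_iff_restrict hAm).2 M2)
    (measurable_indicator_of_continuousOn hAm (hηc.continuousOn.mul c1))
    (measurable_indicator_of_continuousOn hAm ((hηc.continuousOn.mul c2).add
      (hη'c.continuousOn.mul c0)))
    hw1 hw2 ((memLp_indicator_iff_restrict hAm).2 m1) ((memLp_indicator_iff_restrict hAm).2 m2)
    (measurable_indicator_of_continuousOn hAm c1) (measurable_indicator_of_continuousOn hAm c2)
    (fun ξ hξ => indicator_of_notMem (fun h => hξ h.1) _)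
    (fun ξ hξ => indicator_of_notMem (fun h => hξ h.1) _)
    (fun φ hφ hφ0 => by
      rw [← hv φ hφ, ← integral_indicator hm]
      refine integral_congr_ae (Eventually.of_forall fun ξ => ?_)
      by_cases hξ : ξ ∈ cell F
      · by_cases h2 : ξ.2 < 2 * R + 3
        · have : ξ ∈ A := ⟨hξ, h2⟩
          simp [this, hξ]
        · have hd : d1 φ ξ = 0 ∧ d2 φ ξ = 0 := by
            have h3 : φ =ᶠ[𝓝 ξ] fun _ => 0 := by
              filter_upwards [continuous_snd.continuousAt.eventually
                (lt_mem_nhds (by linarith : 2 * R + 2 < ξ.2))] with y hy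
              exact hφ0 y (le_of_lt hy)
            rw [d1_congr h3, d2_congr h3]
            simp [d1, d2]
          have : ξ ∉ A := fun h => h2 h.2
          simp [this, hξ, hd.1, hd.2]
      · have : ξ ∉ A := fun h => hξ h.1
        simp [this, hξ])
  have e3 : ∀ ξ, A.indicator (d1 w) ξ * A.indicator (fun ξ => η ξ.2 ^ 2 * d1 w ξ) ξ +
      A.indicator (d2 w) ξ * A.indicator (fun ξ => η ξ.2 ^ 2 * d2 w ξ +
        2 * η ξ.2 * deriv η ξ.2 * w ξ) ξ = A.indicator (fun ξ => d1 w ξ * (η ξ.2 ^ 2 * d1 w ξ) +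
        d2 w ξ * (η ξ.2 ^ 2 * d2 w ξ + 2 * η ξ.2 * deriv η ξ.2 * w ξ)) ξ := fun ξ => by
    by_cases h : ξ ∈ A <;> simp [h]
  rw [integral_congr_ae (Eventually.of_forall e3), integral_indicator hAm] at main
  have k1 : IntegrableOn (fun ξ => d1 w ξ * (η ξ.2 ^ 2 * d1 w ξ) +
      d2 w ξ * (η ξ.2 ^ 2 * d2 w ξ + 2 * η ξ.2 * deriv η ξ.2 * w ξ)) A :=
    (m1.integrable_mul M1).add (m2.integrable_mul M2)
  have k2 : IntegrableOn (fun ξ => (deriv η ξ.2 * w ξ) ^ 2) A := by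
    have hb : ∀ ξ : ℝ × ℝ, |deriv η ξ.2| ≤ C / R := fun ξ => (hC R ξ.2 hR).1
    exact (mul_mem (ηc.comp continuous_snd) hb m0).integrable_sq
  have k3 : IntegrableOn (fun ξ => d1 w ξ ^ 2 + d2 w ξ ^ 2) A := m1.integrable_sq.add m2.integrable_sq
  have hsub : cell F ∩ {ξ : ℝ × ℝ | ξ.2 < R} ⊆ A := fun ξ hξ => ⟨hξ.1, by
    have : ξ.2 < R := hξ.2
    exact (by linarith : ξ.2 < 2 * R + 3)⟩
  have hRm : MeasurableSet (cell F ∩ {ξ : ℝ × ℝ | ξ.2 < R}) :=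
    hm.inter (isOpen_snd_lt _).measurableSet
  have u1 : ∫ ξ in cell F ∩ {ξ | ξ.2 < R}, (d1 w ξ ^ 2 + d2 w ξ ^ 2) ≤
      ∫ ξ in A, (2 * (d1 w ξ * (η ξ.2 ^ 2 * d1 w ξ) +
      d2 w ξ * (η ξ.2 ^ 2 * d2 w ξ + 2 * η ξ.2 * deriv η ξ.2 * w ξ)) +
      4 * (deriv η ξ.2 * w ξ) ^ 2) := by
    rw [← integral_indicator hRm, ← integral_indicator hAm]
    refine integral_mono ((integrable_indicator_iff hRm).2 (k3.mono_set hsub))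
      ((integrable_indicator_iff hAm).2 ((k1.const_mul 2).add (k2.const_mul 4))) fun ξ => ?_
    -- The difference of the two sides is `(η d1w)² + (η d2w + 2η'w)²`. The bracket with factor `2`
    -- integrates to zero by `main`, leaving only `4(η'w)²`, which lives on an area `R` with `|η'| ≤
    -- C/R`.
    have hpt : η ξ.2 ^ 2 * (d1 w ξ ^ 2 + d2 w ξ ^ 2) ≤ 2 * (d1 w ξ * (η ξ.2 ^ 2 * d1 w ξ) +
        d2 w ξ * (η ξ.2 ^ 2 * d2 w ξ + 2 * η ξ.2 * deriv η ξ.2 * w ξ)) +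
        4 * (deriv η ξ.2 * w ξ) ^ 2 := by
      nlinarith [sq_nonneg (η ξ.2 * d2 w ξ + 2 * (deriv η ξ.2 * w ξ)), sq_nonneg (η ξ.2 * d1 w ξ)]
    have hnn : 0 ≤ η ξ.2 ^ 2 * (d1 w ξ ^ 2 + d2 w ξ ^ 2) := by positivity
    by_cases h1 : ξ ∈ cell F ∩ {ξ : ℝ × ℝ | ξ.2 < R}
    · rw [indicator_of_mem h1, indicator_of_mem (hsub h1)]
      have : η ξ.2 = 1 := upperCutoff_eq_one hR (le_of_lt h1.2)
      rw [this] at hpt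
      simpa [this] using hpt
    · rw [indicator_of_notMem h1]
      by_cases h2 : ξ ∈ A
      · rw [indicator_of_mem h2]
        exact hnn.trans hpt
      · rw [indicator_of_notMem h2]
  rw [integral_add (k1.const_mul 2) (k2.const_mul 4), integral_const_mul, integral_const_mul, main]
    at u1
  set D : Set (ℝ × ℝ) := crossSection ×ˢ Icc R (2 * R) with hD
  have hDm : MeasurableSet D := measurableSet_Ioo.prod measurableSet_Icc
  have hDv : volume.real D = R := by
    rw [hD, Measure.volume_eq_prod, measureReal_prod_prod, crossSection, Real.volume_real_Ioo,
      Real.volume_real_Icc, max_eq_left (by norm_num), max_eq_left (by linarith)]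
    ring
  have hDf : volume D ≠ ⊤ := by
    rw [hD, Measure.volume_eq_prod, Measure.prod_prod]
    simp [crossSection, ENNReal.mul_eq_top]
  have u2 : ∫ ξ in A, (deriv η ξ.2 * w ξ) ^ 2 ≤ C ^ 2 * B ^ 2 / R := by
    have h1 : ∫ ξ in A, (deriv η ξ.2 * w ξ) ^ 2 ≤ ∫ ξ, D.indicator (fun _ => (C / R * B) ^ 2) ξ := by
      rw [← integral_indicator hAm]
      refine integral_mono_of_nonneg (Eventually.of_forall fun ξ =>
        indicator_nonneg (fun ξ _ => sq_nonneg _) ξ)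
        ((integrable_indicator_iff hDm).2 (integrableOn_const hDf)) (Eventually.of_forall fun ξ => ?_)
      by_cases h2 : ξ ∈ A
      · rw [indicator_of_mem h2]
        by_cases h3 : ξ.2 ∈ Icc R (2 * R)
        · have : ξ ∈ D := ⟨⟨h2.1.1.1, h2.1.1.2⟩, h3⟩
          rw [indicator_of_mem this, ← sq_abs, abs_mul]
          exact pow_le_pow_left₀ (by positivity) (mul_le_mul (hC R ξ.2 hR).1
            (hB ξ h2.1 (htR.trans h3.1)) (abs_nonneg _) (by positivity)) 2
        · rw [(hC R ξ.2 hR).2 h3]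
          simp only [zero_mul, ne_eq, OfNat.ofNat_ne_zero, not_false_eq_true, zero_pow]
          exact indicator_nonneg (fun _ _ => sq_nonneg _) _
      · rw [indicator_of_notMem h2]
        exact indicator_nonneg (fun _ _ => sq_nonneg _) _
    rw [integral_indicator hDm, setIntegral_const, hDv, smul_eq_mul] at h1
    refine h1.trans_eq ?_
    field_simp
  calc _ ≤ _ := u1
    _ ≤ 4 * (C ^ 2 * B ^ 2 / R) := by linarith
    _ = _ := by ring

/-- The energy below any fixed height is bounded by `C/R` for all large `R`, hence zero. Continuity
of the gradient makes it vanish at every point. -/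
theorem gradient_eq_zero (hF : IsProfile F) (hap : ∀ R, HasApproxShear F S T R)
    (hw : ContDiffOn ℝ ∞ w (cell F)) (hH : LocallyH1 F w) (hz : ZeroTraceIn F S w)
    (hv : ∀ φ, IsTest T φ → ∫ ξ in cell F, (d1 w ξ * d1 φ ξ + d2 w ξ * d2 φ ξ) = 0)
    {t₀ B : ℝ} (hB : ∀ ξ ∈ cell F, t₀ ≤ ξ.2 → |w ξ| ≤ B) {ξ : ℝ × ℝ}
    (hξ : ξ ∈ cell F) : d1 w ξ = 0 ∧ d2 w ξ = 0 := by
  obtain ⟨C, hC⟩ := setIntegral_sq_gradient_le hF hap hw hH hz hv hB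
  have hO := isOpen_cell hF.continuous
  set A := cell F ∩ {η : ℝ × ℝ | η.2 < ξ.2 + 1} with hA
  have hAo : IsOpen A := hO.inter (isOpen_snd_lt _)
  have hi : ∀ R, IntegrableOn (fun ξ => d1 w ξ ^ 2 + d2 w ξ ^ 2) (cell F ∩ {ξ | ξ.2 < R}) :=
    fun R => (hH R).2.1.integrable_sq.add (hH R).2.2.integrable_sq
  have h0 : ∫ η in A, (d1 w η ^ 2 + d2 w η ^ 2) ≤ 0 := by
    have ht : Tendsto (fun R => C / R) atTop (𝓝 0) := tendsto_const_nhds.div_atTop tendsto_id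
    refine ge_of_tendsto ht ?_
    filter_upwards [eventually_gt_atTop 0, eventually_ge_atTop t₀, eventually_ge_atTop (ξ.2 + 1)]
      with R h1 h2 h3
    refine le_trans ?_ (hC R h1 h2)
    exact setIntegral_mono_set (hi R) (Eventually.of_forall fun _ => by positivity)
      (Eventually.of_forall fun η hη => ⟨hη.1, lt_of_lt_of_le hη.2 h3⟩)
  have h1 : (fun η => d1 w η ^ 2 + d2 w η ^ 2) =ᵐ[volume.restrict A] fun _ => 0 :=
    (setIntegral_eq_zero_iff_of_nonneg_ae (Eventually.of_forall fun _ => by positivity) (hi _)).1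
      (le_antisymm h0 (integral_nonneg fun _ => by positivity))
  have h2 := Measure.eqOn_open_of_ae_eq h1 hAo
    ((((contDiffOn_d1 hO hw).continuousOn.pow 2).add
      ((contDiffOn_d2 hO hw).continuousOn.pow 2)).mono inter_subset_left) continuousOn_const
  have h3 : d1 w ξ ^ 2 + d2 w ξ ^ 2 = 0 := h2 ⟨hξ, by simp⟩
  constructor <;> nlinarith [sq_nonneg (d1 w ξ), sq_nonneg (d2 w ξ)]

/-- Each point is joined to `(0, 1)` by a vertical segment and then a horizontal one at height `1`,
which stays in the cell because `F < 0`. -/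
theorem exists_eq_const_of_gradient_eq_zero (hF : IsProfile F) (hw : ContDiffOn ℝ ∞ w (cell F))
    (h : ∀ ξ ∈ cell F, d1 w ξ = 0 ∧ d2 w ξ = 0) : ∀ ξ ∈ cell F, w ξ = w (0, 1) := fun ξ hξ => by
  have hO := isOpen_cell hF.continuous
  have hd := fun {x} (hx : x ∈ cell F) => differentiableAt_of_contDiffOn hO hw hx
  have e1 : w ξ = w (ξ.1, 1) := by
    have hI : ∀ t, t ∈ Ioi (F ξ.1) → (ξ.1, t) ∈ cell F := fun t ht => ⟨hξ.1, ht⟩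
    exact isOpen_Ioi.is_const_of_deriv_eq_zero isPreconnected_Ioi
      (f := fun t => w (ξ.1, t)) (fun t ht =>
        (hasDerivAt_d2 (hd (hI t ht))).differentiableAt.differentiableWithinAt)
      (fun t ht => (h _ (hI t ht)).2) hξ.2 ((hF.neg _).trans one_pos)
  have e2 : w (ξ.1, 1) = w (0, 1) := by
    have hI : ∀ s, s ∈ crossSection → (s, (1 : ℝ)) ∈ cell F := fun s hs =>
      mem_cell_of_pos hF hs one_pos
    exact isOpen_Ioo.is_const_of_deriv_eq_zero isPreconnected_Ioo
      (f := fun s => w (s, 1)) (fun s hs =>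
        (hasDerivAt_d1 (hd (hI s hs))).differentiableAt.differentiableWithinAt)
      (fun s hs => (h _ (hI s hs)).1) ⟨hξ.1.1, hξ.1.2⟩ (by constructor <;> norm_num)
  rw [e1, e2]

/-- A constant with zero trace on the curved bottom vanishes. -/
theorem ZeroTraceIn.eq_zero_of_const (hF : IsProfile F) {k : ℝ} (hw : ∀ ξ ∈ cell F, w ξ = k)
    (h : ∀ ξ ∈ cell F, d2 w ξ = 0) (hz : ZeroTraceIn F openStrip w) : k = 0 := by
  obtain ⟨M, hM0, hM⟩ := hF.exists_lower_bound
  have hm := measurableSet_cell hF.continuous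
  let f : ContDiffBump (0 : ℝ) := ⟨1 / 8, 1 / 4, by norm_num, by norm_num⟩
  -- The first factor is `1` on the cell and only makes the support compact. On the cell `β` is the
  -- decreasing function `smoothTransition (1 - t)`.
  let β : ℝ → ℝ := fun t => Real.smoothTransition (t + M + 2) * Real.smoothTransition (1 - t)
  have hβ : ContDiff ℝ ∞ β := (Real.smoothTransition.contDiff.comp (by fun_prop)).mul
    (Real.smoothTransition.contDiff.comp (by fun_prop))
  have hβs : Function.support β ⊆ Icc (-M - 2) 1 := fun t ht => by
    by_contra h'
    rw [mem_Icc, not_and_or, not_le, not_le] at h'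
    refine ht ?_
    rcases h' with h' | h'
    · simp [β, Real.smoothTransition.zero_of_nonpos (x := t + M + 2) (by linarith)]
    · simp [β, Real.smoothTransition.zero_of_nonpos (x := 1 - t) (by linarith)]
  have hφ : IsTest openStrip fun ξ => f ξ.1 * β ξ.2 := by
    refine (isTest_prod (A := crossSection) (B := univ) f.contDiff f.hasCompactSupport ?_ hβ
      (HasCompactSupport.of_support_subset_isCompact isCompact_Icc hβs) (subset_univ _)).mono ?_
    · rw [f.tsupport_eq, Real.closedBall_eq_Icc]
      exact Icc_subset_Ioo (by norm_num [f]) (by norm_num [f])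
    · exact fun ξ hξ => ⟨hξ.1.1, hξ.1.2⟩
  have h1 := (hz _ hφ).2
  have h0 : ∫ ξ in cell F, d2 w ξ * (f ξ.1 * β ξ.2) = 0 :=
    (setIntegral_congr_fun hm (g := fun _ => 0)
      (fun ξ hξ => by simp only [h ξ hξ, zero_mul])).trans (integral_zero _ _)
  rw [h0, neg_zero, setIntegral_congr_fun hm (g := fun ξ => -k * -d2 (fun ξ => f ξ.1 * β ξ.2) ξ)
      (fun ξ hξ => by simp only [hw ξ hξ]; ring), integral_const_mul] at h1
  rcases mul_eq_zero.1 h1 with h1 | h1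
  · linarith
  exfalso
  have hβ1 : ∀ t, -M < t → β =ᶠ[𝓝 t] fun t => Real.smoothTransition (1 - t) := fun t ht => by
    filter_upwards [eventually_gt_nhds ht] with y hy
    simp [β, Real.smoothTransition.one_of_one_le (x := y + M + 2) (by linarith)]
  have hanti : Antitone fun t : ℝ => Real.smoothTransition (1 - t) := fun a b hab =>
    Real.smoothTransition.monotone (by linarith)
  -- For `k ≠ 0` the zero trace makes the integral of this nonnegative function vanish, so `β` would
  -- be constant on `t > 0`, although it is positive at `1/4` and zero at `1`.
  have hd : ∀ ξ ∈ cell F, 0 ≤ -d2 (fun ξ => f ξ.1 * β ξ.2) ξ := fun ξ hξ => by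
    rw [d2_prod, (hβ1 ξ.2 ((hM _).trans hξ.2)).deriv_eq]
    have := hanti.deriv_nonpos (x := ξ.2)
    nlinarith [f.nonneg (x := ξ.1)]
  have hi : IntegrableOn (fun ξ => -d2 (fun ξ => f ξ.1 * β ξ.2) ξ) (cell F) :=
    hφ.d2.integrable.neg.integrableOn
  have h2 := (setIntegral_eq_zero_iff_of_nonneg_ae ((ae_restrict_iff' hm).2
    (Eventually.of_forall hd)) hi).1 h1
  have h3 := Measure.eqOn_open_of_ae_eq h2 (isOpen_cell hF.continuous)
    hφ.d2.smooth.continuous.neg.continuousOn continuousOn_const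
  have h4 : ∀ t, 0 < t → deriv β t = 0 := fun t ht => by
    have h5 : -d2 (fun ξ => f ξ.1 * β ξ.2) (0, t) = 0 :=
      h3 (mem_cell_of_pos hF (by constructor <;> norm_num) ht)
    rw [d2_prod, f.one_of_mem_closedBall (Metric.mem_closedBall_self f.rIn_pos.le)] at h5
    simpa using h5
  have h5 : β 1 = β (1 / 4) := isOpen_Ioi.is_const_of_deriv_eq_zero isPreconnected_Ioi
    (hβ.differentiable (by simp)).differentiableOn (fun t ht => h4 t ht) (mem_Ioi.2 one_pos)
    (mem_Ioi.2 (by norm_num))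
  have h6 : β 1 = 0 := by simp [β]
  have h7 : 0 < β (1 / 4) := mul_pos (Real.smoothTransition.pos_of_pos (by linarith))
    (Real.smoothTransition.pos_of_pos (by norm_num))
  linarith

end Uniqueness

/-! ### Uniqueness of `X` and `X̃`. -/

section Difference

variable {F : ℝ → ℝ} {S T : Set (ℝ × ℝ)} {u v w X Xt X' Xt' : ℝ × ℝ → ℝ}

theorem d1_sub_of_contDiffOn (hF : Continuous F) (hu : ContDiffOn ℝ ∞ u (cell F))
    (hv : ContDiffOn ℝ ∞ v (cell F)) : EqOn (d1 fun ξ => u ξ - v ξ) (fun ξ => d1 u ξ - d1 v ξ) (cell F) :=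
  fun _ hξ => d1_sub (differentiableAt_of_contDiffOn (isOpen_cell hF) hu hξ)
    (differentiableAt_of_contDiffOn (isOpen_cell hF) hv hξ)

theorem d2_sub_of_contDiffOn (hF : Continuous F) (hu : ContDiffOn ℝ ∞ u (cell F))
    (hv : ContDiffOn ℝ ∞ v (cell F)) : EqOn (d2 fun ξ => u ξ - v ξ) (fun ξ => d2 u ξ - d2 v ξ) (cell F) :=
  fun _ hξ => d2_sub (differentiableAt_of_contDiffOn (isOpen_cell hF) hu hξ)
    (differentiableAt_of_contDiffOn (isOpen_cell hF) hv hξ)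

theorem LocallyH1.sub (hF : Continuous F) (hu : ContDiffOn ℝ ∞ u (cell F))
    (hv : ContDiffOn ℝ ∞ v (cell F)) (Hu : LocallyH1 F u) (Hv : LocallyH1 F v) :
    LocallyH1 F fun ξ => u ξ - v ξ := fun R => by
  have hm := (measurableSet_cell hF).inter (isOpen_snd_lt R).measurableSet
  refine ⟨(Hu R).1.sub (Hv R).1, ?_, ?_⟩
  · refine (memLp_congr_ae (ae_restrict_of_forall_mem hm fun ξ hξ => ?_)).2
      ((Hu R).2.1.sub (Hv R).2.1)
    exact d1_sub_of_contDiffOn hF hu hv hξ.1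
  · refine (memLp_congr_ae (ae_restrict_of_forall_mem hm fun ξ hξ => ?_)).2
      ((Hu R).2.2.sub (Hv R).2.2)
    exact d2_sub_of_contDiffOn hF hu hv hξ.1

theorem ZeroTraceIn.sub (hF : Continuous F) (hu : ContDiffOn ℝ ∞ u (cell F))
    (hv : ContDiffOn ℝ ∞ v (cell F)) (Hu : LocallyH1 F u) (Hv : LocallyH1 F v)
    (hzu : ZeroTraceIn F S u) (hzv : ZeroTraceIn F S v) :
    ZeroTraceIn F S fun ξ => u ξ - v ξ := fun φ hφ => by
  have hm := measurableSet_cell hF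
  have iu := fun {ψ} (hψ : IsTest S ψ) => integrableOn_cell_mul_test hF (fun R => (Hu R).1) hψ
  have iv := fun {ψ} (hψ : IsTest S ψ) => integrableOn_cell_mul_test hF (fun R => (Hv R).1) hψ
  have iu1 := integrableOn_cell_mul_test hF (fun R => (Hu R).2.1) hφ
  have iv1 := integrableOn_cell_mul_test hF (fun R => (Hv R).2.1) hφ
  have iu2 := integrableOn_cell_mul_test hF (fun R => (Hu R).2.2) hφ
  have iv2 := integrableOn_cell_mul_test hF (fun R => (Hv R).2.2) hφ
  have e1 : ∫ ξ in cell F, d1 (fun ξ => u ξ - v ξ) ξ * φ ξ =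
      ∫ ξ in cell F, (d1 u ξ * φ ξ - d1 v ξ * φ ξ) := setIntegral_congr_fun hm fun ξ hξ => by
    simp only [d1_sub_of_contDiffOn hF hu hv hξ, sub_mul]
  have e2 : ∫ ξ in cell F, d2 (fun ξ => u ξ - v ξ) ξ * φ ξ =
      ∫ ξ in cell F, (d2 u ξ * φ ξ - d2 v ξ * φ ξ) := setIntegral_congr_fun hm fun ξ hξ => by
    simp only [d2_sub_of_contDiffOn hF hu hv hξ, sub_mul]
  rw [e1, e2, integral_sub iu1 iv1, integral_sub iu2 iv2]
  simp only [sub_mul]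
  rw [integral_sub (iu hφ.d1) (iv hφ.d1), integral_sub (iu hφ.d2) (iv hφ.d2), (hzu φ hφ).1,
    (hzv φ hφ).1, (hzu φ hφ).2, (hzv φ hφ).2]
  constructor <;> ring

theorem eq_zero_of_energy (hF : IsProfile F) (hap : ∀ R, HasApproxShear F S T R)
    (hS : openStrip ⊆ S) (hw : ContDiffOn ℝ ∞ w (cell F)) (hH : LocallyH1 F w)
    (hz : ZeroTraceIn F S w)
    (hv : ∀ φ, IsTest T φ → ∫ ξ in cell F, (d1 w ξ * d1 φ ξ + d2 w ξ * d2 φ ξ) = 0)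
    {t₀ B : ℝ} (hB : ∀ ξ ∈ cell F, t₀ ≤ ξ.2 → |w ξ| ≤ B) {ξ : ℝ × ℝ} (hξ : ξ ∈ cell F) :
    w ξ = 0 := by
  have hg : ∀ ξ ∈ cell F, d1 w ξ = 0 ∧ d2 w ξ = 0 := fun ξ hξ =>
    gradient_eq_zero hF hap hw hH hz hv hB hξ
  have hc := exists_eq_const_of_gradient_eq_zero hF hw hg
  rw [hc ξ hξ]
  exact (hz.mono hS).eq_zero_of_const hF hc fun ξ hξ => (hg ξ hξ).2

/-- Both expansions have leading term exactly `ξ₂`, so the difference is bounded at infinity,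
although `X ∼ ξ₂` by itself would allow any sublinear difference. -/
theorem IsX.eqOn (hF : IsProfile F) (hX : IsX F X) (hX' : IsX F X') : EqOn X X' (cell F) := by
  obtain ⟨A, a, -, -, -, v, hv, e⟩ := hX.expansion hF
  obtain ⟨A', a', -, -, -, v', hv', e'⟩ := hX'.expansion hF
  obtain ⟨K, hK⟩ := hv.exists_bound one_pos
  obtain ⟨K', hK'⟩ := hv'.exists_bound one_pos
  obtain ⟨hX, -⟩ := hX
  obtain ⟨hX', -⟩ := hX'
  have hFc := hF.continuous
  have hm := measurableSet_cell hFc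
  intro ξ hξ
  rw [← sub_eq_zero]
  refine eq_zero_of_energy (w := fun ξ => X ξ - X' ξ) (t₀ := 1) (B := |A - A'| + |K| + |K'|) hF
    hF.hasApproxShear_openStrip Subset.rfl (hX.smooth.sub hX'.smooth)
    (LocallyH1.sub hFc hX.smooth hX'.smooth hX.locallyH1 hX'.locallyH1)
    (ZeroTraceIn.sub hFc hX.smooth hX'.smooth hX.locallyH1 hX'.locallyH1 hX.bottom hX'.bottom)
    (fun φ hφ => ?_) (fun η hη h1 => ?_) hξ
  · have i : ∀ {Z}, IsMixedSolution F (fun _ => 0) Z → IntegrableOn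
        (fun ξ => d1 Z ξ * d1 φ ξ + d2 Z ξ * d2 φ ξ) (cell F) := fun hZ =>
      (integrableOn_cell_mul_test hFc (fun R => (hZ.locallyH1 R).2.1) hφ.d1).add
        (integrableOn_cell_mul_test hFc (fun R => (hZ.locallyH1 R).2.2) hφ.d2)
    have e : ∫ ξ in cell F, (d1 (fun ξ => X ξ - X' ξ) ξ * d1 φ ξ +
        d2 (fun ξ => X ξ - X' ξ) ξ * d2 φ ξ) = ∫ ξ in cell F,
        ((d1 X ξ * d1 φ ξ + d2 X ξ * d2 φ ξ) - (d1 X' ξ * d1 φ ξ + d2 X' ξ * d2 φ ξ)) :=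
      setIntegral_congr_fun hm fun ξ hξ => by
        simp only [d1_sub_of_contDiffOn hFc hX.smooth hX'.smooth hξ,
          d2_sub_of_contDiffOn hFc hX.smooth hX'.smooth hξ]
        ring
    rw [e, integral_sub (i hX) (i hX'), hX.variational φ hφ, hX'.variational φ hφ, sub_self]
  · have hp : η ∈ openStrip ∩ upperHalf := ⟨hη.1, (by linarith : 0 < η.2)⟩
    have b : ∀ {K' : ℝ} {z : ℝ}, |z| ≤ K' * Real.exp (-1 * η.2) → |z| ≤ |K'| := fun {K' z} h => by
      refine h.trans ?_
      have h3 : Real.exp (-1 * η.2) ≤ 1 := Real.exp_le_one_iff.2 (by linarith)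
      nlinarith [le_abs_self K', abs_nonneg K', Real.exp_pos (-1 * η.2)]
    have h1' := b (hK η h1)
    have h2' := b (hK' η h1)
    have e3 : X η - X' η = (A - A') + v η - v' η := by rw [e η hp, e' η hp]; ring
    simp only [e3]
    exact (abs_sub _ _).trans (add_le_add ((abs_add_le _ _).trans (add_le_add le_rfl h1')) h2')

/-- The Dirichlet problem is tested with functions supported in the cell, so the energy identity
follows from the pointwise equation. -/
theorem IsXtilde.eqOn (hF : IsProfile F) (hX : IsX F X) (hX' : IsX F X') (hXt : IsXtilde F X Xt)
    (hXt' : IsXtilde F X' Xt') : EqOn Xt Xt' (cell F) := by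
  have hXX := hX.eqOn hF hX'
  obtain ⟨A, a, ha, a0, hac, -⟩ := hX.expansion hF
  obtain ⟨A', a', ha', a0', hac', -⟩ := hX'.expansion hF
  obtain ⟨-, -, -, -, v, hv, e⟩ := hXt.expansion hF hX.1 ha a0 hac
  obtain ⟨-, -, -, -, v', hv', e'⟩ := hXt'.expansion hF hX'.1 ha' a0' hac'
  obtain ⟨K, hK⟩ := hv.exists_bound one_pos
  obtain ⟨K', hK'⟩ := hv'.exists_bound one_pos
  obtain ⟨hZ, -⟩ := hXt
  obtain ⟨hZ', -⟩ := hXt'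
  have hFc := hF.continuous
  have hO := isOpen_cell hFc
  intro ξ hξ
  rw [← sub_eq_zero]
  have hs := hZ.smooth.sub hZ'.smooth
  refine eq_zero_of_energy (w := fun ξ => Xt ξ - Xt' ξ) (t₀ := 1) (B := |K| + |K'|) hF
    hF.hasApproxShear_univ (subset_univ _) hs
    (LocallyH1.sub hFc hZ.smooth hZ'.smooth hZ.locallyH1 hZ'.locallyH1)
    (ZeroTraceIn.sub hFc hZ.smooth hZ'.smooth hZ.locallyH1 hZ'.locallyH1 hZ.boundary hZ'.boundary)
    (fun φ hφ => ?_) (fun η hη h1 => ?_) hξ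
  · set w : ℝ × ℝ → ℝ := fun ξ => Xt ξ - Xt' ξ with hw
    have s1 := contDiffOn_d1 hO hs
    have s2 := contDiffOn_d2 hO hs
    have i1 : IntegrableOn (fun ξ => d1 w ξ * d1 φ ξ) (cell F) :=
      (integrable_mul_test s1.continuousOn hφ.d1).integrableOn
    have i2 : IntegrableOn (fun ξ => d2 w ξ * d2 φ ξ) (cell F) :=
      (integrable_mul_test s2.continuousOn hφ.d2).integrableOn
    have i3 : Integrable fun ξ => d1 (d1 w) ξ * φ ξ :=
      integrable_mul_test (contDiffOn_d1 hO s1).continuousOn hφ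
    have i4 : Integrable fun ξ => d2 (d2 w) ξ * φ ξ :=
      integrable_mul_test (contDiffOn_d2 hO s2).continuousOn hφ
    rw [integral_add i1 i2, hφ.d1.setIntegral_eq, hφ.d2.setIntegral_eq, integral_mul_d1 hO s1 hφ,
      integral_mul_d2 hO s2 hφ, ← neg_add, ← integral_add i3 i4, neg_eq_zero]
    refine integral_eq_zero_of_ae (Eventually.of_forall fun η => ?_)
    by_cases hη : η ∈ cell F
    · have h1 : lap w η = 0 := by
        rw [hw, lap_sub hO hZ.smooth hZ'.smooth hη, hZ.equation η hη, hZ'.equation η hη,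
          eqOn_d1 hO hXX hη, sub_self]
      have : d1 (d1 w) η * φ η + d2 (d2 w) η * φ η = lap w η * φ η := by rw [lap]; ring
      simp [this, h1]
    · simp [hφ.eq_zero hη]
  · have hp : η ∈ openStrip ∩ upperHalf := ⟨hη.1, (by linarith : 0 < η.2)⟩
    have b : ∀ {K' : ℝ} {z : ℝ}, |z| ≤ K' * Real.exp (-1 * η.2) → |z| ≤ |K'| := fun {K' z} h => by
      refine h.trans ?_
      have h3 : Real.exp (-1 * η.2) ≤ 1 := Real.exp_le_one_iff.2 (by linarith)
      nlinarith [le_abs_self K', abs_nonneg K', Real.exp_pos (-1 * η.2)]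
    simp only [e hp, e' hp]
    exact (abs_sub _ _).trans (add_le_add (b (hK η h1)) (b (hK' η h1)))

theorem IsMixedSolution.congr (hF : Continuous F) {f g : ℝ × ℝ → ℝ} (h : IsMixedSolution F f u)
    (hfg : EqOn f g (cell F)) : IsMixedSolution F g u := by
  refine ⟨h.smooth, h.locallyH1, fun ξ hξ => (h.equation ξ hξ).trans (hfg hξ), h.bottom,
    fun φ hφ => ?_⟩
  rw [h.variational φ hφ]
  exact congrArg _ (setIntegral_congr_fun (measurableSet_cell hF) fun ξ hξ => by
    simp only [hfg hξ])

end Difference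

/-! ### The solution `Y` for a given pair `X`, `X̃`. -/

section Solution

variable {F : ℝ → ℝ} {X Xt Y : ℝ × ℝ → ℝ} {c : ℝ}

/-- The weight is bounded below height `2`; above height `1` exponential decay dominates `(ξ₂ +
c)²`. -/
theorem memLp_weighted_of_decay (hF : IsProfile F) (hc : 0 ≤ c)
    (hcF : ∀ ξ ∈ aboveGraph F, 0 < ξ.2 + c) {h : ℝ × ℝ → ℝ} (hh : ContinuousOn h (cell F))
    (hL : MemLp h 2 (volume.restrict (cell F ∩ {ξ | ξ.2 < 2}))) {K : ℝ}
    (hK : ∀ ξ ∈ openStrip, 1 ≤ ξ.2 → |h ξ| ≤ K * Real.exp (-1 * ξ.2)) :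
    MemLp (fun ξ => h ξ * (ξ.2 + c)) 2 (volume.restrict (cell F)) := by
  have hm := measurableSet_cell hF.continuous
  have hmeas : AEStronglyMeasurable (fun ξ : ℝ × ℝ => h ξ * (ξ.2 + c)) (volume.restrict (cell F)) :=
    (hh.mul (continuous_snd.add continuous_const).continuousOn).aestronglyMeasurable hm
  rw [memLp_two_iff_integrable_sq hmeas]
  have i1 : IntegrableOn (fun ξ : ℝ × ℝ => (h ξ * (ξ.2 + c)) ^ 2) (cell F ∩ {ξ | ξ.2 < 2}) := by
    refine (hL.of_le_mul (c := 2 + c) (hmeas.mono_measure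
      (Measure.restrict_mono inter_subset_left le_rfl)) ?_).integrable_sq
    refine ae_restrict_of_forall_mem (hm.inter (isOpen_snd_lt 2).measurableSet) fun ξ hξ => ?_
    have h1 := hcF ξ hξ.1.2
    have h2 : ξ.2 < 2 := hξ.2
    rw [norm_mul, mul_comm, Real.norm_of_nonneg h1.le]
    exact mul_le_mul_of_nonneg_right (by linarith) (norm_nonneg _)
  have i2 : IntegrableOn (fun ξ : ℝ × ℝ => (h ξ * (ξ.2 + c)) ^ 2) (crossSection ×ˢ Ioi 1) := by
    have hsub : crossSection ×ˢ Ioi 1 ⊆ cell F := fun ξ hξ =>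
      mem_cell_of_pos hF hξ.1 (one_pos.trans hξ.2)
    have hb : IntegrableOn (fun ξ : ℝ × ℝ => 2 * K ^ 2 * Real.exp c * Real.exp (-1 * ξ.2))
        (crossSection ×ˢ Ioi 1) := by
      have h1 : IntegrableOn (fun _ : ℝ => 2 * K ^ 2 * Real.exp c) crossSection :=
        integrableOn_const measure_Ioo_lt_top.ne
      have h2 : IntegrableOn (fun t : ℝ => Real.exp (-1 * t)) (Ioi 1) :=
        exp_neg_integrableOn_Ioi 1 one_pos
      have := Integrable.mul_prod h1 h2
      rwa [Measure.prod_restrict, ← Measure.volume_eq_prod] at this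
    refine hb.mono' ((hmeas.mono_measure (Measure.restrict_mono hsub le_rfl)).pow 2) ?_
    refine ae_restrict_of_forall_mem (measurableSet_Ioo.prod measurableSet_Ioi) fun ξ hξ => ?_
    have h1 : 1 < ξ.2 := hξ.2
    have h2 := hK ξ ⟨hξ.1.1, hξ.1.2⟩ h1.le
    have h3 : (ξ.2 + c) ^ 2 ≤ 2 * Real.exp (ξ.2 + c) := by
      nlinarith [Real.quadratic_le_exp_of_nonneg (by linarith : 0 ≤ ξ.2 + c)]
    have h4 : h ξ ^ 2 ≤ (K * Real.exp (-1 * ξ.2)) ^ 2 := by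
      rw [← sq_abs]
      exact pow_le_pow_left₀ (abs_nonneg _) h2 2
    rw [Real.norm_of_nonneg (sq_nonneg _), mul_pow]
    refine (mul_le_mul h4 h3 (sq_nonneg _) (sq_nonneg _)).trans_eq ?_
    rw [Real.exp_add, mul_pow]
    have h5 : Real.exp (-1 * ξ.2) * Real.exp ξ.2 = 1 := by
      rw [← Real.exp_add]
      simp
    linear_combination 2 * K ^ 2 * Real.exp c * Real.exp (-1 * ξ.2) * h5
  refine (i1.union i2).mono_set fun ξ hξ => ?_
  rcases lt_or_ge ξ.2 2 with h1 | h1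
  · exact Or.inl ⟨hξ, h1⟩
  · exact Or.inr ⟨⟨hξ.1.1, hξ.1.2⟩, mem_Ioi.2 (by linarith)⟩

/-- Cauchy–Schwarz: `(ξ₂ + c)⁻¹` is itself square integrable on the half-strip. -/
theorem integrableOn_div_sq_of_memLp (hF : IsProfile F) (hc : 0 < c)
    (hY : MemLp (fun ξ => Y ξ * (ξ.2 + c)⁻¹) 2 (volume.restrict (cell F))) :
    IntegrableOn (fun ξ => Y ξ / (ξ.2 + c) ^ 2) (crossSection ×ˢ Ioi 0) := by
  have hsub : crossSection ×ˢ Ioi 0 ⊆ cell F := fun ξ hξ => mem_cell_of_pos hF hξ.1 hξ.2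
  have h1 := hY.mono_measure (Measure.restrict_mono hsub le_rfl)
  have hm : MeasurableSet (crossSection ×ˢ Ioi (0 : ℝ)) := measurableSet_Ioo.prod measurableSet_Ioi
  have h2 : MemLp (fun ξ : ℝ × ℝ => (ξ.2 + c)⁻¹) 2
      (volume.restrict (crossSection ×ˢ Ioi 0)) := by
    rw [memLp_two_iff_integrable_sq (by fun_prop : Measurable _).aestronglyMeasurable]
    have a1 : IntegrableOn (fun _ : ℝ => (1 : ℝ)) crossSection :=
      integrableOn_const measure_Ioo_lt_top.ne
    have a2 : IntegrableOn (fun t : ℝ => (t + c) ^ (-2 : ℝ)) (Ioi 0) :=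
      integrableOn_add_rpow_Ioi_of_lt (by norm_num) (by linarith)
    have a3 := Integrable.mul_prod a1 a2
    rw [Measure.prod_restrict, ← Measure.volume_eq_prod] at a3
    refine a3.congr (ae_restrict_of_forall_mem hm fun ξ hξ => ?_)
    have h3 : 0 < ξ.2 + c := add_pos hξ.2 hc
    simp only [one_mul]
    rw [Real.rpow_neg h3.le, inv_pow]
    norm_cast
  refine (h1.integrable_mul h2).congr (ae_restrict_of_forall_mem hm fun ξ hξ => ?_)
  simp only [Pi.mul_apply]
  rw [div_eq_mul_inv, pow_two, mul_inv, mul_assoc]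

theorem exists_isMixedSolution_eqUpToExp (hF : IsProfile F) (hX : IsX F X)
    (hXt : IsXtilde F X Xt) : ∃ C Y, IsMixedSolution F (d1 Xt) Y ∧ EqUpToExp F Y C := by
  obtain ⟨c, hc, hcF⟩ := hF.exists_lower_bound
  have hcF' : ∀ ξ ∈ aboveGraph F, 0 < ξ.2 + c := fun ξ hξ => by
    have h1 : F ξ.1 < ξ.2 := hξ
    linarith [hcF ξ.1]
  obtain ⟨A, a, ha, a0, hac, -⟩ := hX.expansion hF
  obtain ⟨b, hb, b0, hbc, v, hv, e⟩ := hXt.expansion hF hX.1 ha a0 hac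
  obtain ⟨v₁, hv₁, e₁⟩ := hv.exists_d1
  obtain ⟨K, hK⟩ := hv₁.exists_bound one_pos
  have hD := hXt.1
  have hs := contDiffOn_d1 (isOpen_cell hF.continuous) hD.smooth
  have hdec : ∀ ξ ∈ openStrip, 1 ≤ ξ.2 → |d1 Xt ξ| ≤ K * Real.exp (-1 * ξ.2) := fun ξ hξ h1 => by
    have hu : ξ ∈ upperHalf := (by linarith : 0 < ξ.2)
    rw [eqOn_d1 (isOpen_openStrip.inter isOpen_upperHalf) e ⟨hξ, hu⟩, e₁ hu]
    exact hK ξ h1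
  obtain ⟨Y, hY, hYw⟩ := exists_isMixedSolution hF.continuous hcF' hs
    (memLp_weighted_of_decay hF hc.le hcF' hs.continuousOn (hD.locallyH1 2).2.1 hdec)
  obtain ⟨C, z, hz, hYz⟩ := hY.expansion_of_isXtilde hF hD ha hb a0 b0 hbc hc
    (integrableOn_div_sq_of_memLp hF hc hYw)
  exact ⟨C, Y, hY, hz.eqUpToExp hF.continuous fun ξ hξ h0 => hYz ξ ⟨hξ.1, h0⟩⟩

end Solution

end CellStrip

/-! ### Independence of the constant from the chosen solutions. -/

theorem proposition1 (F : ℝ → ℝ) (hF : CellStrip.IsProfile F) :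
    ∃ C : ℝ, ∀ X Xt : ℝ × ℝ → ℝ, CellStrip.IsX F X → CellStrip.IsXtilde F X Xt →
      ∃ Y : ℝ × ℝ → ℝ,
        CellStrip.IsMixedSolution F (CellStrip.d1 Xt) Y ∧ CellStrip.EqUpToExp F Y C := by
  -- One pair determines `C` and `Y`. By uniqueness any other pair has the same right-hand side on
  -- the cell, so the same `Y` serves for it.
  by_cases h : ∃ X Xt : ℝ × ℝ → ℝ, CellStrip.IsX F X ∧ CellStrip.IsXtilde F X Xt
  · obtain ⟨X, Xt, hX, hXt⟩ := h
    obtain ⟨C, Y, hY, hYC⟩ := CellStrip.exists_isMixedSolution_eqUpToExp hF hX hXt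
    refine ⟨C, fun X' Xt' hX' hXt' => ⟨Y, hY.congr hF.continuous ?_, hYC⟩⟩
    exact CellStrip.eqOn_d1 (CellStrip.isOpen_cell hF.continuous)
      (CellStrip.IsXtilde.eqOn hF hX hX' hXt hXt')
  -- Without any pair the claim is vacuous and the constant is arbitrary.
  · exact ⟨0, fun X Xt hX hXt => (h ⟨X, Xt, hX, hXt⟩).elim⟩
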